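/- **Theorem (Concentration bound on the generalization error).** Let $d,k,L,W,n\in\mathbb N=\{1,2,\dots\}$ with $k\ge 3$ and $W\ge d+1$, let $0<\kappa\le\mathcal K$ and $L_\nu\ge 0$. *Measures.* Let $\nu$ be a probability measure on $[0,1]^d$ with Lebesgue density $f_\nu(x)=\prod_{i=1}^d f_{\nu_i}(x_i)$, where $f_{\nu_i}\in C^k([0,1])$ is the density of the $i$-th marginal of $\nu$, and let $f_\nu$ be $L_\nu$-Lipschitz on $[0,1]^d$ (Euclidean norm). Let $\mu$ be a probability measure on $[0,1]^d$ with Lebesgue density $f_\mu\in C^k([0,1]^d)$. Assume $\kappa\le f_\nu\le\mathcal K$ and $\kappa\le f_\mu\le\mathcal K$ on $[0,1]^d$. *Model.* Let $\sigma(x)=\max(x,0)^2$, applied componentwise. For $\theta\in\Theta=[-1,1]^q$ let $$v^\theta=\theta_L\circ\sigma\circ\theta_{L-1}\circ\dots\circ\sigma\circ\theta_0:\mathbb R^{d+1}\to\mathbb R^d$$ be the fully connected network with $L$ hidden layers and architecture $(d+1,W,\dots,W,d)$; the entries of $\theta$ are the weights and biases of the affine maps $\theta_0,\dots,\theta_L$,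 so that $q=\big((d+1)W+W\big)+(L-1)(W^2+W)+(Wd+d)$. Let $\Phi^\theta:[0,1]^d\to[0,1]^d$ be the time-one map of the flow of $$y_i'(t)=v^\theta_i(y(t),t)\,y_i(t)\,(1-y_i(t)),\qquad i=1,\dots,d,\ t\in[0,1],$$ and let $\mu_\theta=\Phi^\theta_*\nu$. *Generalization error.* Let $X_1,\dots,X_n$ be i.i.d. random vectors with law $\mu$, and let $$\varepsilon_n^{\mathrm{gen}}=\sup_{\theta\in\Theta}\left|\mathbb E_{X\sim\mu}\big[-\log f_{\mu_\theta}(X)\big]+\frac1n\sum_{j=1}^n\log f_{\mu_\theta}(X_j)\right|,$$ where $f_{\mu_\theta}$ is the continuous Lebesgue density of $\mu_\theta$ on $[0,1]^d$. *Constants.* Let $$\begin{aligned} \mathrm{Lip}_0&=L(2W)^{2^{L+2}+2L-3}(d+1)^{2^L},\qquad C=(2W)^{2^L-2}(d+1)^{2^{L-2}},\\ \mathrm{Lip}_1&=\tfrac14L\big[(2W)^2C\big]^{L-1}\big(8W^2C+2W^2\,\mathrm{Lip}_0+2W(C+1)\big)+\mathrm{Lip}_0,\\ \bar L&=2\Big[\tfrac{L_\nu}{\kappa}e^{\sqrt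 d\sqrt q\,\mathrm{Lip}_1}\,\mathrm{Lip}_0\,2\sqrt q+d!\,2^{d+1}\sqrt d^{\,d}\,e^{2d\sqrt d\sqrt q\,\mathrm{Lip}_1}\,d\,(2\sqrt q)^{d-1}\Big],\\ D&=\tfrac{L_\nu}{\kappa}\sqrt d+d!\,2^{d+1}\sqrt q^{\,d}\,\mathrm{Lip}_1^{\,d}\,e^{2d\sqrt d\sqrt q\,\mathrm{Lip}_1}. \end{aligned}$$ Then these objects are well defined: for every $\theta\in\Theta$ the differential equation has, for each initial value in $[0,1]^d$, exactly one solution on $[0,1]$ with values in $[0,1]^d$, and $\mu_\theta$ has a density on $[0,1]^d$ that is continuous and strictly positive there. Moreover, for every $\varepsilon>0$, $$\mathbb P\left(\varepsilon_n^{\mathrm{gen}}-48\,L\,W^2\,\frac{\bar L}{\sqrt n}>\varepsilon\right)\le\exp\left(-\frac14\cdot\frac{\varepsilon^2n}{D^2}\right).$$ -/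

import Mathlib

open MeasureTheory ProbabilityTheory Set
open scoped NNReal ENNReal

noncomputable section

namespace LtI

/-- The unit cube `[0,1]^d` in Euclidean space. -/
def cube (d : ℕ) : Set (EuclideanSpace ℝ (Fin d)) := {x | ∀ i, x i ∈ Icc (0 : ℝ) 1}

/-- `f` is a Lebesgue density of the measure `μ`, and `μ` lives on `s`. -/
def HasDensityOn {α : Type*} [MeasureSpace α] (μ : Measure α) (f : α → ℝ) (s : Set α) : Prop :=
  (∀ x ∈ s, 0 ≤ f x) ∧ μ = (volume.restrict s).withDensity (fun x => ENNReal.ofReal (f x))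

/-! ### ReQU networks -/

/-- The activation `x ↦ max(x,0)^2`. -/
def requ (x : ℝ) : ℝ := max x 0 ^ 2

/-- Weight matrix (rows indexed by outputs) and bias vector of an affine map `ℝ^m → ℝ^n`. -/
abbrev Layer (m n : ℕ) : Type := (Fin n → Fin m → ℝ) × (Fin n → ℝ)

/-- The affine map of a layer. -/
def Layer.apply {m n : ℕ} (A : Layer m n) (x : Fin m → ℝ) : Fin n → ℝ :=
  fun i => ∑ j, A.1 i j * x j + A.2 i

/-- All weights and biases of the layer lie in `[-1,1]`. -/
def Layer.Bounded {m n : ℕ} (A : Layer m n) : Prop :=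
  (∀ i j, A.1 i j ∈ Icc (-1 : ℝ) 1) ∧ ∀ i, A.2 i ∈ Icc (-1 : ℝ) 1

/-- Parameters of a network with architecture `(d+1, W, …, W, d)` and `L ≥ 1` hidden layers:
the input layer, the `L - 1` layers between hidden layers, and the output layer. -/
abbrev Params (d L W : ℕ) : Type :=
  Layer (d + 1) W × (Fin (L - 1) → Layer W W) × Layer W d

/-- The parameter cube `[-1,1]^q`. -/
def paramCube (d L W : ℕ) : Set (Params d L W) :=
  {θ | θ.1.Bounded ∧ (∀ l, (θ.2.1 l).Bounded) ∧ θ.2.2.Bounded}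

/-- The number `q` of parameters. -/
def numParams (d L W : ℕ) : ℕ :=
  ((d + 1) * W + W) + (L - 1) * (W * W + W) + (W * d + d)

/-- `σ ∘ θ_m ∘ ⋯ ∘ σ ∘ θ_1` for `m` layers of constant width. -/
def hiddenStack {W : ℕ} : (m : ℕ) → (Fin m → Layer W W) → (Fin W → ℝ) → Fin W → ℝ
  | 0, _, a => a
  | m + 1, A, a =>
      fun i => requ ((A (Fin.last m)).apply (hiddenStack m (fun l => A l.castSucc) a) i)

/-- The network `θ_L ∘ σ ∘ θ_{L-1} ∘ ⋯ ∘ σ ∘ θ_0`. -/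
def network {d L W : ℕ} (θ : Params d L W) (z : Fin (d + 1) → ℝ) : Fin d → ℝ :=
  θ.2.2.apply (hiddenStack (L - 1) θ.2.1 (fun i => requ (θ.1.apply z i)))

/-- The time dependent vector field `(x,t) ↦ v^θ(x,t) ⊗ η_d(x)`, `η_d(x)_i = x_i (1 - x_i)`. -/
def vectorField {d L W : ℕ} (θ : Params d L W) (x : EuclideanSpace ℝ (Fin d)) (t : ℝ) :
    EuclideanSpace ℝ (Fin d) :=
  WithLp.toLp 2 fun i =>
    network θ (Fin.snoc (α := fun _ => ℝ) (fun j => x j) t) i * (x i * (1 - x i))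

/-! ### Flows and push-forwards -/

/-- `y` solves `y' = u(y,t)` on `[0,1]`, starts at `x` and stays in the unit cube. -/
structure IsTrajectory {d : ℕ}
    (u : EuclideanSpace ℝ (Fin d) → ℝ → EuclideanSpace ℝ (Fin d))
    (x : EuclideanSpace ℝ (Fin d)) (y : ℝ → EuclideanSpace ℝ (Fin d)) : Prop where
  init : y 0 = x
  mem_cube : ∀ t ∈ Icc (0 : ℝ) 1, y t ∈ cube d
  deriv : ∀ t ∈ Icc (0 : ℝ) 1, HasDerivWithinAt y (u (y t) t) (Icc 0 1) t

open Classical in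
/-- The time-one map of the flow of `u` on the unit cube (the identity where there is no
trajectory, in particular outside of the cube). -/
def flowMap {d : ℕ} (u : EuclideanSpace ℝ (Fin d) → ℝ → EuclideanSpace ℝ (Fin d))
    (x : EuclideanSpace ℝ (Fin d)) : EuclideanSpace ℝ (Fin d) :=
  if h : ∃ y, IsTrajectory u x y then h.choose 1 else x

/-- The model `μ_θ = Φ^θ_* ν`. -/
def model {d L W : ℕ} (ν : Measure (EuclideanSpace ℝ (Fin d))) (θ : Params d L W) :
    Measure (EuclideanSpace ℝ (Fin d)) :=
  ν.map (flowMap (vectorField θ))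

/-- `f` is a Lebesgue density of `ρ` on the unit cube that is continuous there. -/
def IsContDensity {d : ℕ} (ρ : Measure (EuclideanSpace ℝ (Fin d)))
    (f : EuclideanSpace ℝ (Fin d) → ℝ) : Prop :=
  ContinuousOn f (cube d) ∧ HasDensityOn ρ f (cube d)

open Classical in
/-- The continuous density of `ρ` on the unit cube; it is unique on the cube.
(Zero if there is none.) -/
def contDensity {d : ℕ} (ρ : Measure (EuclideanSpace ℝ (Fin d))) :
    EuclideanSpace ℝ (Fin d) → ℝ :=
  if h : ∃ f, IsContDensity ρ f then h.choose else 0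

/-! ### Generalization error -/

/-- The empirical negative log-likelihood of the density `f` on the sample `x`. -/
def empRisk {d n : ℕ} (f : EuclideanSpace ℝ (Fin d) → ℝ)
    (x : Fin n → EuclideanSpace ℝ (Fin d)) : ℝ :=
  -(1 / (n : ℝ)) * ∑ j, Real.log (f (x j))

/-- The generalization error on the sample `x`: the supremum over `θ ∈ [-1,1]^q` of the absolute
difference of the expected and the empirical negative log-likelihood of `μ_θ`. It is taken in
`[0,∞]`, so that it is meaningful without a boundedness condition. -/
def genError (d L W : ℕ) (ν μ : Measure (EuclideanSpace ℝ (Fin d))) {n : ℕ}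
    (x : Fin n → EuclideanSpace ℝ (Fin d)) : ℝ≥0∞ :=
  ⨆ θ ∈ paramCube d L W, ENNReal.ofReal
    |(∫ z, -Real.log (contDensity (model ν θ) z) ∂μ) - empRisk (contDensity (model ν θ)) x|

/-! ### Constants -/

/-- `Lip_0^Θ(L,W,d) = L (2W)^{2^{L+2}+2L-3} (d+1)^{2^L}`. -/
def lip0 (d L W : ℕ) : ℝ :=
  L * (2 * W : ℝ) ^ (2 ^ (L + 2) + 2 * L - 3) * (d + 1 : ℝ) ^ (2 ^ L)

/-- `C(L,W,d) = (2W)^{2^L-2} (d+1)^{2^{L-2}}`; the last exponent is `1/2` for `L = 1`. -/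
def constC (d L W : ℕ) : ℝ :=
  (2 * W : ℝ) ^ (2 ^ L - 2) * (d + 1 : ℝ) ^ ((2 : ℝ) ^ ((L : ℝ) - 2))

/-- `Lip_1^Θ(L,W,d)`. -/
def lip1 (d L W : ℕ) : ℝ :=
  1 / 4 * L * ((2 * W : ℝ) ^ 2 * constC d L W) ^ (L - 1) *
      (8 * (W : ℝ) ^ 2 * constC d L W + 2 * (W : ℝ) ^ 2 * lip0 d L W
        + 2 * W * (constC d L W + 1))
    + lip0 d L W

/-- The constant `L̄_{d,κ,L_ν}(L,W)`. -/
def Lbar (d L W : ℕ) (κ Lν : ℝ) : ℝ :=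
  2 * (Lν / κ * Real.exp (√d * √(numParams d L W) * lip1 d L W)
          * lip0 d L W * (2 * √(numParams d L W))
    + (d.factorial : ℝ) * 2 ^ (d + 1) * √d ^ d
        * Real.exp (2 * d * √d * √(numParams d L W) * lip1 d L W)
        * d * (2 * √(numParams d L W)) ^ (d - 1))

/-- The bounded-differences constant `D_{d,κ,L_ν}(L,W)`. -/
def constD (d L W : ℕ) (κ Lν : ℝ) : ℝ :=
  Lν / κ * √d
    + (d.factorial : ℝ) * 2 ^ (d + 1) * √(numParams d L W) ^ d * lip1 d L W ^ d
        * Real.exp (2 * d * √d * √(numParams d L W) * lip1 d L W)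

end LtI

end

/-! The log-density of the model is explicit. The inverse Ψ of the time-one map is the time-one map
of the reversed field, and log f_θ(y) = log f_ν(Ψ y) + ∫₀¹ (divergence of the reversed field along
its trajectory from y) dt. This is the change of variables formula, with the Jacobian of Ψ computed
by Liouville's formula (`IsCubeField.exists_hasFDerivWithinAt_flowMap`,
`IsCubeField.isContDensity_map`).

Hence the log-likelihoods form a family with two features (`isLipschitzFamily_logModel`): their
oscillation in y is at most R = (L_ν/κ)√d + 2 d Lip₀, and by Grönwall they are Lipschitz in θ for
the sup norm, with a constant Λ = `likelihoodLip`. The network enters only through Lip₀, which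
bounds the coordinates of the field and the diagonal of its spatial derivative as Lipschitz
functions of position and parameter together. ReQU networks are not globally Lipschitz, but for
inputs and weights in [-1,1] the sizes of the layers follow b ↦ (2Wb)², whence the doubly
exponential Lip₀.

The rest concerns the empirical process of such a family over [-1,1]^q. On a dyadic grid, chaining
bounds the mean of the largest deviation by (R + 4√q Λ)/√n (`integral_maxDeviation_le`), and
McDiarmid's inequality with differences R/n controls its fluctuation. A grid so fine that rounding θ
costs ε/2 leaves ε/2 to McDiarmid and gives the tail exp(-ε²n/(2R²))
(`measure_exists_deviation_gt_le`). The finite grid also removes the question whether the supremum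
over θ is measurable. It remains to compare constants: R ≤ D and R + 4√q Λ ≤ 48 L W² L̄. -/

namespace LtI

/-! ### McDiarmid's inequality on a product space. -/

section Concentration

variable {E : Type*} [MeasurableSpace E]

/-- Hoeffding's lemma for a bounded function, in terms of its oscillation. -/
theorem integral_exp_le_of_osc (μ : Measure E) [IsProbabilityMeasure μ] {g : E → ℝ} {c : ℝ}
    (hg : Measurable g) (hc : ∀ x y, |g x - g y| ≤ c) (r : ℝ) :
    ∫ x, Real.exp (r * (g x - ∫ y, g y ∂μ)) ∂μ ≤ Real.exp (c ^ 2 * r ^ 2 / 8) := by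
  obtain ⟨x₀⟩ : Nonempty E := μ.nonempty_of_neZero
  have hc0 : 0 ≤ c := (abs_nonneg _).trans (hc x₀ x₀)
  have hbdd : BddBelow (range g) :=
    ⟨g x₀ - c, by rintro _ ⟨x, rfl⟩; linarith [(abs_le.1 (hc x₀ x)).2]⟩
  have : Nonempty E := ⟨x₀⟩
  have hmem : ∀ᵐ x ∂μ, g x ∈ Icc (⨅ y, g y) ((⨅ y, g y) + c) := by
    refine ae_of_all _ fun x => ⟨ciInf_le hbdd x, ?_⟩
    have : g x - c ≤ ⨅ y, g y := le_ciInf fun y => by linarith [(abs_le.1 (hc x y)).2]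
    linarith
  have h := (hasSubgaussianMGF_of_mem_Icc hg.aemeasurable hmem).mgf_le r
  refine (le_of_eq ?_).trans (h.trans (le_of_eq ?_))
  · rfl
  · congr 1
    push_cast
    rw [add_sub_cancel_left, Real.norm_of_nonneg hc0]
    ring

/-- A product measure on `n + 1` copies, with the first coordinate split off. -/
theorem integral_pi_succ (μ : Measure E) [IsProbabilityMeasure μ] {n : ℕ}
    {F : (Fin (n + 1) → E) → ℝ} (hF : Measurable F) {B : ℝ} (hB : ∀ x, |F x| ≤ B) :
    ∫ x, F x ∂(Measure.pi fun _ : Fin (n + 1) => μ) =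
      ∫ a, ∫ x, F (Fin.cons a x) ∂(Measure.pi fun _ : Fin n => μ) ∂μ := by
  have hmp := (measurePreserving_piFinSuccAbove (fun _ : Fin (n + 1) => μ) 0).symm
  rw [← hmp.integral_comp' (g := F)]
  rw [integral_prod]
  · simp [MeasurableEquiv.piFinSuccAbove, Fin.consEquiv]
  · refine Integrable.of_bound (C := B) ?_ (ae_of_all _ fun x => hB _)
    exact (hF.comp (MeasurableEquiv.measurable _)).aestronglyMeasurable

theorem measurable_finCons {n : ℕ} :
    Measurable fun p : E × (Fin n → E) => (Fin.cons p.1 p.2 : Fin (n + 1) → E) := by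
  refine measurable_pi_lambda _ fun i => ?_
  refine Fin.cases ?_ (fun j => ?_) i
  · simpa using measurable_fst
  · simp only [Fin.cons_succ]
    fun_prop

theorem abs_integral_le_of_abs_le {F : Type*} [MeasurableSpace F] (μ : Measure F)
    [IsProbabilityMeasure μ] {f : F → ℝ} {B : ℝ} (hB : ∀ x, |f x| ≤ B) : |∫ x, f x ∂μ| ≤ B := by
  simpa using norm_integral_le_of_norm_le_const (C := B) (f := f) (μ := μ) (ae_of_all _ hB)

/-- McDiarmid's bounded differences inequality, in exponential moment form. -/
theorem integral_exp_le_of_bounded_differences (μ : Measure E) [IsProbabilityMeasure μ] {c : ℝ}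
    (r : ℝ) (n : ℕ) :
    ∀ f : (Fin n → E) → ℝ, Measurable f → (∃ B, ∀ x, |f x| ≤ B) →
      (∀ x i y, |f (Function.update x i y) - f x| ≤ c) →
      ∫ x, Real.exp (r * (f x - ∫ y, f y ∂(Measure.pi fun _ => μ))) ∂(Measure.pi fun _ => μ)
        ≤ Real.exp (n * c ^ 2 * r ^ 2 / 8) := by
  induction n with
  | zero =>
    intro f _ _ _
    have : ∀ x, f x = f (fun i => i.elim0) := fun x => congrArg f (Subsingleton.elim _ _)
    simp only [this]
    simp
  | succ n ih =>
    rintro f hf ⟨B, hB⟩ hc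
    set π : Measure (Fin n → E) := Measure.pi fun _ => μ
    have hfc := hf.comp (measurable_finCons (E := E) (n := n))
    have hfa : ∀ a, Measurable fun x : Fin n → E => f (Fin.cons a x) := fun a =>
      hfc.comp (measurable_const.prodMk measurable_id)
    have hint : ∀ a, Integrable (fun x : Fin n → E => f (Fin.cons a x)) π := fun a =>
      Integrable.of_bound (hfa a).aestronglyMeasurable B
        (ae_of_all _ fun x => hB _)
    -- The conditional mean given the first coordinate. In f - m = (f - g) + (g - m) the first
    -- summand is handled by induction for each fixed a; the second has oscillation at most c, so
    -- Hoeffding's lemma applies.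
    set g : E → ℝ := fun a => ∫ x, f (Fin.cons a x) ∂π with hgdef
    have hg : Measurable g :=
      (StronglyMeasurable.integral_prod_right (ν := π)
        (f := fun a (x : Fin n → E) => f (Fin.cons a x)) hfc.stronglyMeasurable).measurable
    have hgc : ∀ a b, |g a - g b| ≤ c := by
      intro a b
      rw [← integral_sub (hint a) (hint b)]
      refine abs_integral_le_of_abs_le _ fun x => ?_
      have := hc (Fin.cons b x) 0 a
      rwa [Fin.update_cons_zero] at this
    rw [integral_pi_succ μ hf hB]
    set m := ∫ a, g a ∂μ
    have hgB : ∀ a, |g a| ≤ B := fun a => abs_integral_le_of_abs_le _ fun x => hB _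
    have hm : |m| ≤ B := abs_integral_le_of_abs_le _ hgB
    have hexpB : ∀ s : ℝ, |s| ≤ 2 * B → |Real.exp (r * s)| ≤ Real.exp (|r| * (2 * B)) := by
      intro s hs
      rw [abs_of_pos (Real.exp_pos _), Real.exp_le_exp]
      calc r * s ≤ |r * s| := le_abs_self _
        _ = |r| * |s| := abs_mul _ _
        _ ≤ _ := by gcongr
    have hbd : ∀ x, |Real.exp (r * (f x - m))| ≤ Real.exp (|r| * (2 * B)) := fun x =>
      hexpB _ (by linarith [abs_sub (f x) m, hB x])
    rw [integral_pi_succ μ (by fun_prop) hbd]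
    have hstep : ∀ a, ∫ x, Real.exp (r * (f (Fin.cons a x) - m)) ∂π ≤
        Real.exp (n * c ^ 2 * r ^ 2 / 8) * Real.exp (r * (g a - m)) := by
      intro a
      have h1 := ih (fun x => f (Fin.cons a x)) (hfa a) ⟨B, fun x => hB _⟩ (fun x i y => by
        have := hc (Fin.cons a x) i.succ y
        rwa [← Fin.cons_update] at this)
      calc ∫ x, Real.exp (r * (f (Fin.cons a x) - m)) ∂π
          = ∫ x, Real.exp (r * (f (Fin.cons a x) - g a)) * Real.exp (r * (g a - m)) ∂π := by
            congr 1; ext x; rw [← Real.exp_add, ← mul_add, sub_add_sub_cancel]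
        _ = (∫ x, Real.exp (r * (f (Fin.cons a x) - g a)) ∂π) * Real.exp (r * (g a - m)) :=
            integral_mul_const _ _
        _ ≤ _ := by gcongr
    have hi2 : Integrable (fun a => Real.exp (r * (g a - m))) μ :=
      Integrable.of_bound (C := Real.exp (|r| * (2 * B)))
        (by fun_prop) (ae_of_all _ fun a => hexpB _ (by linarith [abs_sub (g a) m, hgB a]))
    calc _ ≤ ∫ a, Real.exp (n * c ^ 2 * r ^ 2 / 8) * Real.exp (r * (g a - m)) ∂μ := by
          refine integral_mono_of_nonneg (ae_of_all _ fun a => ?_) (hi2.const_mul _)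
            (ae_of_all _ hstep)
          exact integral_nonneg fun x => (Real.exp_pos _).le
      _ = Real.exp (n * c ^ 2 * r ^ 2 / 8) * ∫ a, Real.exp (r * (g a - m)) ∂μ :=
          integral_const_mul _ _
      _ ≤ Real.exp (n * c ^ 2 * r ^ 2 / 8) * Real.exp (c ^ 2 * r ^ 2 / 8) := by
          gcongr; exact integral_exp_le_of_osc μ hg hgc r
      _ = _ := by rw [← Real.exp_add]; push_cast; ring_nf

/-- McDiarmid's inequality. -/
theorem measure_ge_le_of_bounded_differences (μ : Measure E) [IsProbabilityMeasure μ] {c : ℝ}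
    (hc0 : 0 < c) {n : ℕ} (hn : 1 ≤ n) {f : (Fin n → E) → ℝ} (hf : Measurable f) {B : ℝ}
    (hB : ∀ x, |f x| ≤ B) (hc : ∀ x i y, |f (Function.update x i y) - f x| ≤ c) {t : ℝ}
    (ht : 0 ≤ t) :
    (Measure.pi fun _ : Fin n => μ) {x | ∫ y, f y ∂(Measure.pi fun _ => μ) + t ≤ f x} ≤
      ENNReal.ofReal (Real.exp (-2 * t ^ 2 / (n * c ^ 2))) := by
  set π : Measure (Fin n → E) := Measure.pi fun _ => μ
  set m := ∫ y, f y ∂π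
  have hn0 : (0 : ℝ) < n := by exact_mod_cast hn
  -- The minimiser of the Chernoff exponent -r t + n c² r² / 8.
  set r : ℝ := 4 * t / (n * c ^ 2) with hr
  have hr0 : 0 ≤ r := by positivity
  have hint : Integrable (fun x => Real.exp (r * (f x - m))) π := by
    refine Integrable.of_bound (C := Real.exp (r * (B - m))) (by fun_prop)
      (ae_of_all _ fun x => ?_)
    rw [Real.norm_of_nonneg (Real.exp_pos _).le, Real.exp_le_exp]
    gcongr
    exact (abs_le.1 (hB x)).2
  have h := measure_ge_le_exp_mul_mgf (X := fun x => f x - m) (μ := π) t hr0 hint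
  have hmgf : mgf (fun x => f x - m) π r ≤ Real.exp (n * c ^ 2 * r ^ 2 / 8) :=
    integral_exp_le_of_bounded_differences μ r n f hf ⟨B, hB⟩ hc
  have hset : {x | m + t ≤ f x} = {x | t ≤ f x - m} := by
    ext x
    rw [mem_ofPred_eq, mem_ofPred_eq]
    constructor <;> intro h <;> linarith
  rw [hset, ← ofReal_measureReal]
  refine ENNReal.ofReal_le_ofReal (h.trans ?_)
  calc _ ≤ Real.exp (-r * t) * Real.exp (n * c ^ 2 * r ^ 2 / 8) := by gcongr
    _ = _ := by
      rw [← Real.exp_add, hr]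
      congr 1
      field_simp
      ring

end Concentration

end LtI

namespace LtI

/-! ### Deviations of empirical means and a maximal inequality. -/

section Chaining

variable {E : Type*} [MeasurableSpace E]

/-- The deviation of the empirical mean of `h` from its expectation. -/
noncomputable def deviation (μ : Measure E) {n : ℕ} (h : E → ℝ) (x : Fin n → E) : ℝ :=
  ∫ y, h y ∂μ - (1 / n : ℝ) * ∑ j, h (x j)

variable {μ : Measure E} {n : ℕ} {h h' : E → ℝ} {c B : ℝ}

theorem measurable_deviation (hh : Measurable h) :
    Measurable (deviation (n := n) μ h) := by
  unfold deviation; fun_prop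

theorem deviation_sub (hi : Integrable h μ) (hi' : Integrable h' μ) (x : Fin n → E) :
    deviation μ (fun y => h y - h' y) x = deviation μ h x - deviation μ h' x := by
  unfold deviation
  rw [integral_sub hi hi', Finset.sum_sub_distrib]
  ring

theorem abs_mean_le {F : Type*} {h : F → ℝ} (hn : 1 ≤ n) (hB : ∀ y, |h y| ≤ B) (x : Fin n → F) :
    |(1 / n : ℝ) * ∑ j, h (x j)| ≤ B := by
  have hn0 : (0 : ℝ) < n := by exact_mod_cast hn
  rw [abs_mul, abs_of_pos (by positivity : (0 : ℝ) < 1 / n)]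
  calc (1 / n : ℝ) * |∑ j, h (x j)| ≤ 1 / n * ∑ j : Fin n, B := by
        gcongr
        exact (Finset.abs_sum_le_sum_abs _ _).trans (Finset.sum_le_sum fun j _ => hB _)
    _ = B := by simp; field_simp

theorem abs_deviation_le [IsProbabilityMeasure μ] (hn : 1 ≤ n) (hB : ∀ y, |h y| ≤ B)
    (x : Fin n → E) : |deviation μ h x| ≤ 2 * B := by
  have h1 := abs_integral_le_of_abs_le μ hB
  have h2 := abs_mean_le hn hB x
  unfold deviation
  linarith [abs_sub (∫ y, h y ∂μ) ((1 / n : ℝ) * ∑ j, h (x j))]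

theorem sum_update_sub {F : Type*} {h : F → ℝ} (x : Fin n → F) (i : Fin n) (y : F) :
    ∑ j, h (Function.update x i y j) - ∑ j, h (x j) = h y - h (x i) := by
  rw [← Finset.sum_sub_distrib, Finset.sum_eq_single i]
  · simp
  · intro j _ hj; simp [hj]
  · simp

theorem abs_mean_update_sub_le {F : Type*} {h : F → ℝ} (hn : 1 ≤ n)
    (hc : ∀ y z, |h y - h z| ≤ c) (x : Fin n → F) (i : Fin n) (y : F) :
    |(1 / n : ℝ) * ∑ j, h (Function.update x i y j) - (1 / n : ℝ) * ∑ j, h (x j)| ≤ c / n := by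
  have hn0 : (0 : ℝ) < n := by exact_mod_cast hn
  rw [← mul_sub, sum_update_sub, abs_mul, abs_of_pos (by positivity : (0 : ℝ) < 1 / n),
    div_mul_eq_mul_div, one_mul]
  gcongr
  exact hc _ _

theorem abs_deviation_update_sub_le (hn : 1 ≤ n) (hc : ∀ y z, |h y - h z| ≤ c)
    (x : Fin n → E) (i : Fin n) (y : E) :
    |deviation μ h (Function.update x i y) - deviation μ h x| ≤ c / n := by
  rw [abs_sub_comm]
  have := abs_mean_update_sub_le hn hc x i y
  unfold deviation
  rwa [sub_sub_sub_cancel_left]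

/-- The deviation of a function of oscillation at most `c` is sub-Gaussian. -/
theorem integral_exp_deviation_le [IsProbabilityMeasure μ] (hn : 1 ≤ n) (hh : Measurable h)
    (hB : ∀ y, |h y| ≤ B) (hc : ∀ y z, |h y - h z| ≤ c) (r : ℝ) :
    ∫ x, Real.exp (r * deviation μ h x) ∂(Measure.pi fun _ : Fin n => μ) ≤
      Real.exp (c ^ 2 * r ^ 2 / (8 * n)) := by
  have hn0 : (0 : ℝ) < n := by exact_mod_cast hn
  -- The sign is flipped because `deviation` is the expectation minus the empirical mean.
  have key := integral_exp_le_of_bounded_differences μ (c := c / n) (-r) n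
    (fun x => (1 / n : ℝ) * ∑ j, h (x j)) (by fun_prop) ⟨B, abs_mean_le hn hB⟩
    (abs_mean_update_sub_le hn hc)
  have hmean : ∫ x, (1 / n : ℝ) * ∑ j, h (x j) ∂(Measure.pi fun _ : Fin n => μ) =
      ∫ y, h y ∂μ := by
    rw [integral_const_mul, integral_finsetSum]
    · simp_rw [integral_comp_eval (μ := fun _ : Fin n => μ) hh.aestronglyMeasurable]
      simp; field_simp
    · intro j _
      exact Integrable.of_bound (hh.comp (measurable_pi_apply j)).aestronglyMeasurable B (ae_of_all _ fun x => hB _)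
  rw [hmean] at key
  refine (le_of_eq ?_).trans (key.trans (le_of_eq ?_))
  · congr 1; ext x; congr 1; unfold deviation; ring
  · congr 1; field_simp

/-- A maximal inequality for finitely many sub-Gaussian variables. -/
theorem integral_sup'_abs_le {Ω α : Type*} [MeasurableSpace Ω] (P : Measure Ω)
    [IsProbabilityMeasure P] (s : Finset α) (hs : s.Nonempty) (Y : α → Ω → ℝ)
    (hY : ∀ a ∈ s, Measurable (Y a)) (hB : ∀ a ∈ s, ∀ ω, |Y a ω| ≤ B) {r v N : ℝ}
    (hr : 0 < r) (hp : ∀ a ∈ s, ∫ ω, Real.exp (r * Y a ω) ∂P ≤ Real.exp v)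
    (hm : ∀ a ∈ s, ∫ ω, Real.exp (-r * Y a ω) ∂P ≤ Real.exp v) (hN : (s.card : ℝ) ≤ N) :
    ∫ ω, s.sup' hs (fun a => |Y a ω|) ∂P ≤ (Real.log (2 * N) + v) / r := by
  have hN0 : 0 < N := lt_of_lt_of_le (by exact_mod_cast hs.card_pos) hN
  -- C is chosen so that exp(-C) · 2N exp(v) = 1. Integrating the tangent line inequality u ≤ C - 1
  -- + exp(u - C) at u = r max |Y| then gives exactly C, and Jensen's inequality is not needed.
  set C := Real.log (2 * N) + v with hC
  have hexpC : Real.exp (-C) * (2 * N * Real.exp v) = 1 := by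
    rw [hC, neg_add, Real.exp_add, Real.exp_neg, Real.exp_neg, Real.exp_log (by positivity)]
    field_simp
  have hint : ∀ r' : ℝ, ∀ a ∈ s, Integrable (fun ω => Real.exp (r' * Y a ω)) P := by
    intro r' a ha
    have := hY a ha
    refine Integrable.of_bound (C := Real.exp (|r'| * B)) (by fun_prop) (ae_of_all _ fun ω => ?_)
    rw [Real.norm_of_nonneg (Real.exp_pos _).le, Real.exp_le_exp]
    refine (le_abs_self _).trans ?_
    rw [abs_mul]
    gcongr
    exact hB a ha ω
  have hpt : ∀ ω, s.sup' hs (fun a => |Y a ω|) ≤ (1 / r) * (C - 1 + Real.exp (-C) *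
      ∑ a ∈ s, (Real.exp (r * Y a ω) + Real.exp (-r * Y a ω))) := by
    intro ω
    refine Finset.sup'_le _ _ fun a ha => ?_
    rw [one_div, ← div_eq_inv_mul, le_div_iff₀ hr]
    have h1 : Real.exp (r * |Y a ω|) ≤
        ∑ a ∈ s, (Real.exp (r * Y a ω) + Real.exp (-r * Y a ω)) := by
      refine le_trans ?_ (Finset.single_le_sum (f := fun a =>
        Real.exp (r * Y a ω) + Real.exp (-r * Y a ω)) (fun _ _ => by positivity) ha)
      rcases abs_cases (Y a ω) with ⟨h, _⟩ | ⟨h, _⟩ <;> rw [h]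
      · linarith [Real.exp_pos (-r * Y a ω)]
      · rw [mul_neg, ← neg_mul]; linarith [Real.exp_pos (r * Y a ω)]
    have h2 := Real.add_one_le_exp (r * |Y a ω| - C)
    rw [sub_eq_add_neg, Real.exp_add, mul_comm (Real.exp _)] at h2
    have h3 := mul_le_mul_of_nonneg_left h1 (Real.exp_pos (-C)).le
    linarith
  have hint2 : Integrable (fun ω => ∑ a ∈ s, (Real.exp (r * Y a ω) + Real.exp (-r * Y a ω))) P :=
    integrable_finsetSum _ fun a ha => (hint r a ha).add (hint (-r) a ha)
  calc ∫ ω, s.sup' hs (fun a => |Y a ω|) ∂P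
      ≤ ∫ ω, (1 / r) * (C - 1 + Real.exp (-C) *
        ∑ a ∈ s, (Real.exp (r * Y a ω) + Real.exp (-r * Y a ω))) ∂P := by
        refine integral_mono_of_nonneg (ae_of_all _ fun ω => ?_)
          (((integrable_const _).add (hint2.const_mul _)).const_mul _) (ae_of_all _ hpt)
        obtain ⟨a, ha⟩ := hs
        exact (abs_nonneg _).trans (Finset.le_sup' (fun a => |Y a ω|) ha)
    _ = (1 / r) * (C - 1 + Real.exp (-C) * ∑ a ∈ s, (∫ ω, Real.exp (r * Y a ω) ∂P +
          ∫ ω, Real.exp (-r * Y a ω) ∂P)) := by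
        rw [integral_const_mul, integral_add (integrable_const _) (hint2.const_mul _),
          integral_const_mul, integral_finsetSum s (f := fun a ω =>
            Real.exp (r * Y a ω) + Real.exp (-r * Y a ω))
            fun a ha => (hint r a ha).add (hint (-r) a ha)]
        congr 3
        · simp
        · exact Finset.sum_congr rfl fun a ha => integral_add (hint r a ha) (hint (-r) a ha)
    _ ≤ (1 / r) * (C - 1 + Real.exp (-C) * (2 * N * Real.exp v)) := by
        gcongr
        calc _ ≤ ∑ a ∈ s, (Real.exp v + Real.exp v) :=
              Finset.sum_le_sum fun a ha => add_le_add (hp a ha) (hm a ha)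
          _ = s.card * (2 * Real.exp v) := by rw [Finset.sum_const, nsmul_eq_mul]; ring
          _ ≤ N * (2 * Real.exp v) := by gcongr
          _ = _ := by ring
    _ = C / r := by rw [hexpC]; ring

end Chaining

end LtI

namespace LtI

/-! ### Dyadic grids in the parameter cube. -/

section Grid

variable {ι : Type*} [Fintype ι] [DecidableEq ι]

/-- The two values `±1`, indexed by the booleans. -/
def boolSign (b : Bool) : ℝ := if b then 1 else -1

theorem abs_boolSign (b : Bool) : |boolSign b| = 1 := by
  cases b <;> simp [boolSign]

/-- The child of a grid point of generation `k` in the direction of the signs `ε`. -/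
noncomputable def gridChild (k : ℕ) (s : ι → ℝ) (ε : ι → Bool) : ι → ℝ :=
  fun i => s i + boolSign (ε i) * (1 / 2) ^ (k + 1)

/-- The centers of the `2^(k q)` dyadic cubes of side length `2^(1-k)` that form `[-1,1]^q`. -/
noncomputable def dyadicGrid (ι : Type*) [Fintype ι] [DecidableEq ι] : ℕ → Finset (ι → ℝ)
  | 0 => {0}
  | k + 1 => (dyadicGrid ι k ×ˢ (Finset.univ : Finset (ι → Bool))).image
      fun p => gridChild k p.1 p.2

theorem dyadicGrid_nonempty (k : ℕ) : (dyadicGrid ι k).Nonempty := by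
  induction k with
  | zero => simp [dyadicGrid]
  | succ k ih => exact (ih.product Finset.univ_nonempty).image _

/-- Counts the pairs of a grid point and a direction, since these edges index the chaining
increments from generation k to k + 1. -/
theorem card_dyadicGrid_prod_le (k : ℕ) :
    (((dyadicGrid ι k ×ˢ (Finset.univ : Finset (ι → Bool))).card : ℕ) : ℝ) ≤
      2 ^ (Fintype.card ι * (k + 1)) := by
  have h : ∀ k, (dyadicGrid ι k).card ≤ 2 ^ (Fintype.card ι * k) := by
    intro k
    induction k with
    | zero => simp [dyadicGrid]
    | succ k ih =>
      refine Finset.card_image_le.trans ?_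
      rw [Finset.card_product, Finset.card_univ, Fintype.card_fun, Fintype.card_bool,
        mul_add, mul_one, pow_add]
      gcongr
  rw [Finset.card_product, Finset.card_univ, Fintype.card_fun, Fintype.card_bool,
    mul_add, mul_one, pow_add]
  exact_mod_cast Nat.mul_le_mul_right _ (h k)

/-- The margin 2^(-k) is the total length of all later steps, so every grid point is an admissible
parameter. -/
theorem abs_le_of_mem_dyadicGrid {k : ℕ} {s : ι → ℝ} (hs : s ∈ dyadicGrid ι k) (i : ι) :
    |s i| ≤ 1 - (1 / 2) ^ k := by
  induction k generalizing s with
  | zero =>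
    rw [dyadicGrid, Finset.mem_singleton] at hs
    simp [hs]
  | succ k ih =>
    simp only [dyadicGrid, Finset.mem_image, Finset.mem_product, Prod.exists] at hs
    obtain ⟨t, ε, ⟨ht, -⟩, rfl⟩ := hs
    refine (abs_add_le _ _).trans ?_
    rw [abs_mul, abs_boolSign, one_mul, abs_of_pos (by positivity : (0 : ℝ) < (1 / 2) ^ (k + 1))]
    have := ih ht
    rw [pow_succ]
    linarith

theorem exists_mem_dyadicGrid {θ : ι → ℝ} (hθ : ∀ i, |θ i| ≤ 1) (k : ℕ) :
    ∃ s ∈ dyadicGrid ι k, ∀ i, |θ i - s i| ≤ (1 / 2) ^ k := by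
  induction k with
  | zero => exact ⟨0, by simp [dyadicGrid], by simpa using hθ⟩
  | succ k ih =>
    obtain ⟨s, hs, h⟩ := ih
    -- A step of half the error bound, taken towards θ in each coordinate, halves that bound.
    refine ⟨gridChild k s fun i => decide (s i ≤ θ i), ?_, fun i => ?_⟩
    · simp only [dyadicGrid, Finset.mem_image, Finset.mem_product, Prod.exists]
      exact ⟨s, _, ⟨hs, Finset.mem_univ _⟩, rfl⟩
    · have h2 := abs_le.1 (h i)
      unfold gridChild boolSign
      rw [pow_succ]
      by_cases hi : s i ≤ θ i
      · simp only [hi, decide_true, if_true]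
        rw [abs_le]
        constructor <;> linarith
      · simp only [hi, decide_false]
        rw [abs_le]
        simp only [Bool.false_eq_true, if_false]
        constructor <;> linarith

end Grid

/-! ### Chaining and concentration for Lipschitz families. -/

section Chaining

variable {E : Type*} [MeasurableSpace E] {ι : Type*}

/-- A family of bounded functions on `E`, indexed by `[-1,1]^ι`, that is Lipschitz in the index:
`Λ` is the Lipschitz constant, `R` bounds the oscillations and `R₀` that of the central one. -/
structure IsLipschitzFamily (ℓ : (ι → ℝ) → E → ℝ) (Λ R R₀ : ℝ) : Prop where
  pos : 0 < Λ ∧ 0 < R ∧ 0 < R₀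
  measurable : ∀ θ, (∀ i, |θ i| ≤ 1) → Measurable (ℓ θ)
  lipschitz : ∀ θ θ', (∀ i, |θ i| ≤ 1) → (∀ i, |θ' i| ≤ 1) → ∀ δ, (∀ i, |θ i - θ' i| ≤ δ) →
    ∀ y, |ℓ θ y - ℓ θ' y| ≤ Λ * δ
  osc : ∀ θ, (∀ i, |θ i| ≤ 1) → ∀ y z, |ℓ θ y - ℓ θ z| ≤ R
  osc_zero : ∀ y z, |ℓ 0 y - ℓ 0 z| ≤ R₀

/-- Used for integrability only; the size of B enters no final constant. -/
theorem IsLipschitzFamily.exists_bound [Nonempty E] {ℓ : (ι → ℝ) → E → ℝ} {Λ R R₀ : ℝ}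
    (hℓ : IsLipschitzFamily ℓ Λ R R₀) :
    ∃ B, 0 ≤ B ∧ ∀ θ, (∀ i, |θ i| ≤ 1) → ∀ y, |ℓ θ y| ≤ B := by
  obtain ⟨y₀⟩ := ‹Nonempty E›
  have hR := hℓ.pos.2.1
  have hΛ := hℓ.pos.1
  refine ⟨|ℓ 0 y₀| + Λ * 1 + R, by positivity, fun θ hθ y => ?_⟩
  have h1 := hℓ.osc θ hθ y y₀
  have h2 := hℓ.lipschitz θ 0 hθ (by simp) 1 (by simpa using hθ) y₀
  have h3 := abs_sub_abs_le_abs_sub (ℓ θ y) (ℓ θ y₀)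
  have h4 := abs_sub_abs_le_abs_sub (ℓ θ y₀) (ℓ 0 y₀)
  linarith

variable [Fintype ι] [DecidableEq ι]

/-- The maximal deviation over the dyadic grid of generation `k`. -/
noncomputable def maxDeviation (μ : Measure E) {n : ℕ} (ℓ : (ι → ℝ) → E → ℝ) (k : ℕ)
    (x : Fin n → E) : ℝ :=
  (dyadicGrid ι k).sup' (dyadicGrid_nonempty k) fun s => |deviation μ (ℓ s) x|

variable {μ : Measure E} {n : ℕ} {ℓ : (ι → ℝ) → E → ℝ} {Λ R R₀ : ℝ}

theorem abs_le_one_of_mem_dyadicGrid {k : ℕ} {s : ι → ℝ} (hs : s ∈ dyadicGrid ι k) (i : ι) :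
    |s i| ≤ 1 :=
  (abs_le_of_mem_dyadicGrid hs i).trans (by have : (0 : ℝ) < (1 / 2) ^ k := by positivity
                                            linarith)

theorem measurable_maxDeviation (hℓ : IsLipschitzFamily ℓ Λ R R₀) (k : ℕ) :
    Measurable (maxDeviation (n := n) μ ℓ k) := by
  unfold maxDeviation
  have : (fun x : Fin n → E => (dyadicGrid ι k).sup' (dyadicGrid_nonempty k)
      fun s => |deviation μ (ℓ s) x|) = (dyadicGrid ι k).sup' (dyadicGrid_nonempty k)
      (fun s x => |deviation μ (ℓ s) x|) := by
    ext x; rw [Finset.sup'_apply]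
  rw [this]
  refine Finset.measurable_sup' _ fun s hs => ?_
  exact (measurable_deviation (hℓ.measurable s (abs_le_one_of_mem_dyadicGrid hs))).abs

theorem abs_maxDeviation_le [IsProbabilityMeasure μ] (hn : 1 ≤ n) {B : ℝ}
    (hB : ∀ θ, (∀ i, |θ i| ≤ 1) → ∀ y, |ℓ θ y| ≤ B) (k : ℕ) (x : Fin n → E) :
    |maxDeviation μ ℓ k x| ≤ 2 * B := by
  obtain ⟨s, hs⟩ := dyadicGrid_nonempty (ι := ι) k
  have h1 : 0 ≤ maxDeviation μ ℓ k x :=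
    (abs_nonneg _).trans (Finset.le_sup' (fun s => |deviation μ (ℓ s) x|) hs)
  rw [abs_of_nonneg h1]
  exact Finset.sup'_le _ _ fun s hs =>
    abs_deviation_le hn (hB s (abs_le_one_of_mem_dyadicGrid hs)) x

theorem maxDeviation_update_le (hn : 1 ≤ n) (hℓ : IsLipschitzFamily ℓ Λ R R₀) (k : ℕ)
    (x : Fin n → E) (i : Fin n) (y : E) :
    |maxDeviation μ ℓ k (Function.update x i y) - maxDeviation μ ℓ k x| ≤ R / n := by
  have key : ∀ x x' : Fin n → E, (∀ s ∈ dyadicGrid ι k,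
      |deviation μ (ℓ s) x - deviation μ (ℓ s) x'| ≤ R / n) →
      maxDeviation μ ℓ k x ≤ maxDeviation μ ℓ k x' + R / n := by
    intro x x' h
    refine Finset.sup'_le _ _ fun s hs => ?_
    have h1 : |deviation μ (ℓ s) x'| ≤ maxDeviation μ ℓ k x' :=
      Finset.le_sup' (fun s => |deviation μ (ℓ s) x'|) hs
    have h2 := abs_sub_abs_le_abs_sub (deviation μ (ℓ s) x) (deviation μ (ℓ s) x')
    linarith [h s hs]
  have hb : ∀ s ∈ dyadicGrid ι k,
      |deviation μ (ℓ s) (Function.update x i y) - deviation μ (ℓ s) x| ≤ R / n := fun s hs =>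
    abs_deviation_update_sub_le hn (hℓ.osc s (abs_le_one_of_mem_dyadicGrid hs)) x i y
  rw [abs_le]
  constructor
  · linarith [key x _ fun s hs => by rw [abs_sub_comm]; exact hb s hs]
  · linarith [key _ x hb]

variable [IsProbabilityMeasure μ]

/-- The constant 5/6 exceeds log 2 and is such that adding the variance term 1/2 gives 4/3. The
chaining series sums to 3, which makes the final factor 4. -/
theorem log_two_mul_two_pow_le {q : ℕ} (hq : 1 ≤ q) (k : ℕ) :
    Real.log (2 * 2 ^ (q * (k + 1))) ≤ 5 / 6 * q * (k + 2) ^ 2 := by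
  rw [← pow_succ', Real.log_pow]
  have h1 : Real.log 2 ≤ 5 / 6 := by linarith [Real.log_two_lt_d9]
  have hq' : (1 : ℝ) ≤ q := by exact_mod_cast hq
  have hk : (0 : ℝ) ≤ k := by positivity
  push_cast
  calc (q * (k + 1) + 1) * Real.log 2 ≤ (q * (k + 2) : ℝ) * (5 / 6) := by
        gcongr
        · nlinarith
    _ ≤ _ := by nlinarith [mul_nonneg (by positivity : (0 : ℝ) ≤ q) hk,
                  mul_nonneg (mul_nonneg (by positivity : (0 : ℝ) ≤ q) hk) hk]

/-- Generation 0 is the single parameter 0. With r = 2√n / R₀ the variance term is 1/2, and (log 2 +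
1/2)/r ≤ 2/r = R₀/√n. -/
theorem integral_maxDeviation_zero_le (hn : 1 ≤ n) (hℓ : IsLipschitzFamily ℓ Λ R R₀) :
    ∫ x, maxDeviation μ ℓ 0 x ∂(Measure.pi fun _ : Fin n => μ) ≤ R₀ / √n := by
  have hn0 : (0 : ℝ) < n := by exact_mod_cast hn
  have hsn : 0 < √(n : ℝ) := Real.sqrt_pos.2 hn0
  have hsq : √(n : ℝ) ^ 2 = n := Real.sq_sqrt hn0.le
  obtain ⟨hΛ, hR, hR₀⟩ := hℓ.pos
  have : Nonempty E := μ.nonempty_of_neZero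
  obtain ⟨B, hB0, hB⟩ := hℓ.exists_bound
  have hm : ∀ s ∈ dyadicGrid ι 0, Measurable (deviation (n := n) μ (ℓ s)) := fun s hs =>
    measurable_deviation (hℓ.measurable s (abs_le_one_of_mem_dyadicGrid hs))
  have hexp : ∀ r : ℝ, r ^ 2 = 4 * n / R₀ ^ 2 → ∀ s ∈ dyadicGrid ι 0,
      ∫ x, Real.exp (r * deviation μ (ℓ s) x) ∂(Measure.pi fun _ : Fin n => μ) ≤
        Real.exp (1 / 2) := by
    intro r hr s hs
    have hs0 : s = 0 := by simpa [dyadicGrid] using hs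
    subst hs0
    refine (integral_exp_deviation_le hn (hℓ.measurable 0 (by simp)) (hB 0 (by simp))
      hℓ.osc_zero r).trans (le_of_eq ?_)
    rw [hr]
    congr 1
    field_simp
    norm_num
  have h := integral_sup'_abs_le (Measure.pi fun _ : Fin n => μ) (dyadicGrid ι 0)
    (dyadicGrid_nonempty 0) (fun s => deviation μ (ℓ s)) hm
    (fun s hs => abs_deviation_le hn (hB s (abs_le_one_of_mem_dyadicGrid hs)))
    (r := 2 * √n / R₀) (v := 1 / 2) (N := 1) (by positivity)
    (hexp _ (by rw [div_pow, mul_pow, hsq]; norm_num))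
    (hexp _ (by rw [neg_sq, div_pow, mul_pow, hsq]; norm_num)) (by simp [dyadicGrid])
  refine h.trans ?_
  have hlog : Real.log (2 * 1) + 1 / 2 ≤ 2 := by
    rw [mul_one]; linarith [Real.log_two_lt_d9]
  calc _ ≤ 2 / (2 * √n / R₀) := by gcongr
    _ = _ := by field_simp

/-- The deviation at a child is that at its parent plus an increment, the deviation of a function of
oscillation at most 2Λδ with δ = 2^(-k-1). The maximal inequality is applied to all edges, with r
taken so that the logarithm of their number and the variance term are both at most multiples of q (k
+ 2)². -/
theorem integral_maxDeviation_succ_le [Nonempty ι] (hn : 1 ≤ n) (hℓ : IsLipschitzFamily ℓ Λ R R₀) (k : ℕ) :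
    ∫ x, maxDeviation μ ℓ (k + 1) x ∂(Measure.pi fun _ : Fin n => μ) ≤
      ∫ x, maxDeviation μ ℓ k x ∂(Measure.pi fun _ : Fin n => μ) +
        4 / 3 * √(Fintype.card ι) * Λ / √n * ((k + 2) * (1 / 2) ^ (k + 1)) := by
  have hn0 : (0 : ℝ) < n := by exact_mod_cast hn
  have hsn : 0 < √(n : ℝ) := Real.sqrt_pos.2 hn0
  have hsq : √(n : ℝ) ^ 2 = n := Real.sq_sqrt hn0.le
  set q := Fintype.card ι with hqdef
  have hq : 1 ≤ q := Fintype.card_pos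
  have hq0 : (0 : ℝ) < q := by exact_mod_cast hq
  have hqs : 0 < √(q : ℝ) := Real.sqrt_pos.2 hq0
  have hqsq : √(q : ℝ) ^ 2 = q := Real.sq_sqrt hq0.le
  obtain ⟨hΛ, hR, hR₀⟩ := hℓ.pos
  have : Nonempty E := μ.nonempty_of_neZero
  obtain ⟨B, hB0, hB⟩ := hℓ.exists_bound
  set π := Measure.pi fun _ : Fin n => μ
  set δ : ℝ := (1 / 2) ^ (k + 1) with hδdef
  have hδ : 0 < δ := by positivity
  set S := dyadicGrid ι k ×ˢ (Finset.univ : Finset (ι → Bool)) with hS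
  have hSne : S.Nonempty := (dyadicGrid_nonempty k).product Finset.univ_nonempty
  set Y : (ι → ℝ) × (ι → Bool) → (Fin n → E) → ℝ := fun p =>
    deviation μ (fun y => ℓ (gridChild k p.1 p.2) y - ℓ p.1 y)
  have hmem : ∀ p ∈ S, (∀ i, |p.1 i| ≤ 1) ∧ ∀ i, |gridChild k p.1 p.2 i| ≤ 1 := by
    intro p hp
    rw [hS, Finset.mem_product] at hp
    refine ⟨abs_le_one_of_mem_dyadicGrid hp.1, abs_le_one_of_mem_dyadicGrid (k := k + 1) ?_⟩
    simp only [dyadicGrid, Finset.mem_image]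
    exact ⟨p, Finset.mem_product.2 hp, rfl⟩
  have hmeas : ∀ p ∈ S, Measurable fun y => ℓ (gridChild k p.1 p.2) y - ℓ p.1 y := fun p hp =>
    (hℓ.measurable _ (hmem p hp).2).sub (hℓ.measurable _ (hmem p hp).1)
  have hlip : ∀ p ∈ S, ∀ y, |ℓ (gridChild k p.1 p.2) y - ℓ p.1 y| ≤ Λ * δ := fun p hp y =>
    hℓ.lipschitz _ _ (hmem p hp).2 (hmem p hp).1 δ (fun i => by
      rw [gridChild, add_sub_cancel_left, abs_mul, abs_boolSign, one_mul, abs_of_pos hδ]) y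
  have hosc : ∀ p ∈ S, ∀ y z, |(ℓ (gridChild k p.1 p.2) y - ℓ p.1 y) -
      (ℓ (gridChild k p.1 p.2) z - ℓ p.1 z)| ≤ 2 * (Λ * δ) := fun p hp y z =>
    (abs_sub _ _).trans (by linarith [hlip p hp y, hlip p hp z])
  have hYm : ∀ p ∈ S, Measurable (Y p) := fun p hp => measurable_deviation (hmeas p hp)
  have hYB : ∀ p ∈ S, ∀ x, |Y p x| ≤ 2 * (Λ * δ) := fun p hp =>
    abs_deviation_le hn (hlip p hp)
  have hexp : ∀ r : ℝ, r ^ 2 = n * q * (k + 2) ^ 2 / (Λ * δ) ^ 2 → ∀ p ∈ S,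
      ∫ x, Real.exp (r * Y p x) ∂π ≤ Real.exp (q * (k + 2) ^ 2 / 2) := by
    intro r hr p hp
    refine (integral_exp_deviation_le hn (hmeas p hp) (hlip p hp) (hosc p hp) r).trans
      (le_of_eq ?_)
    rw [hr]
    congr 1
    field_simp
    norm_num
  have hr2 : (√n * √q * (k + 2) / (Λ * δ)) ^ 2 = n * q * (k + 2) ^ 2 / (Λ * δ) ^ 2 := by
    rw [div_pow, mul_pow, mul_pow, hsq, hqsq]
  have hmax := integral_sup'_abs_le π S hSne Y hYm hYB (r := √n * √q * (k + 2) / (Λ * δ))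
    (v := q * (k + 2) ^ 2 / 2) (N := 2 ^ (q * (k + 1))) (by positivity) (hexp _ hr2)
    (hexp _ (by rw [neg_sq, hr2])) (card_dyadicGrid_prod_le k)
  have hstep : (Real.log (2 * 2 ^ (q * (k + 1))) + q * (k + 2) ^ 2 / 2) /
      (√n * √q * (k + 2) / (Λ * δ)) ≤ 4 / 3 * √q * Λ / √n * ((k + 2) * δ) := by
    have h1 := log_two_mul_two_pow_le hq k
    calc _ ≤ (4 / 3 * (√q ^ 2) * (k + 2) ^ 2) / (√n * √q * (k + 2) / (Λ * δ)) := by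
          gcongr
          rw [hqsq]
          linarith
      _ = _ := by field_simp
  have hint : ∀ k, Integrable (maxDeviation (n := n) μ ℓ k) π := fun k =>
    Integrable.of_bound (measurable_maxDeviation hℓ k).aestronglyMeasurable (2 * B)
      (ae_of_all _ fun x => abs_maxDeviation_le hn hB k x)
  have hintS : Integrable (fun x => S.sup' hSne fun p => |Y p x|) π := by
    refine Integrable.of_bound (C := 2 * (Λ * δ)) ?_ (ae_of_all _ fun x => ?_)
    · have : (fun x => S.sup' hSne fun p => |Y p x|) = S.sup' hSne (fun p x => |Y p x|) := by
        ext x; rw [Finset.sup'_apply]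
      rw [this]
      exact (Finset.measurable_sup' _ fun p hp => (hYm p hp).abs).aestronglyMeasurable
    · rw [Real.norm_of_nonneg]
      · exact Finset.sup'_le _ _ fun p hp => hYB p hp x
      · obtain ⟨p, hp⟩ := hSne
        exact (abs_nonneg _).trans (Finset.le_sup' (fun p => |Y p x|) hp)
  have hpt : ∀ x : Fin n → E, maxDeviation μ ℓ (k + 1) x ≤
      maxDeviation μ ℓ k x + S.sup' hSne fun p => |Y p x| := by
    intro x
    refine Finset.sup'_le _ _ fun s hs => ?_
    simp only [dyadicGrid, Finset.mem_image] at hs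
    obtain ⟨p, hp', rfl⟩ := hs
    have hp : p ∈ S := hp'
    have h1 : |Y p x| ≤ S.sup' hSne fun p => |Y p x| := Finset.le_sup' (fun p => |Y p x|) hp
    have h2 : |deviation μ (ℓ p.1) x| ≤ maxDeviation μ ℓ k x :=
      Finset.le_sup' (fun s => |deviation μ (ℓ s) x|) (Finset.mem_product.1 hp).1
    have hi : ∀ θ, (∀ i, |θ i| ≤ 1) → Integrable (ℓ θ) μ := fun θ hθ =>
      Integrable.of_bound (hℓ.measurable θ hθ).aestronglyMeasurable B (ae_of_all _ (hB θ hθ))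
    have h3 : Y p x = deviation μ (ℓ (gridChild k p.1 p.2)) x - deviation μ (ℓ p.1) x :=
      deviation_sub (hi _ (hmem p hp).2) (hi _ (hmem p hp).1) x
    rw [h3] at h1
    have h4 := abs_sub_abs_le_abs_sub (deviation μ (ℓ (gridChild k p.1 p.2)) x)
      (deviation μ (ℓ p.1) x)
    linarith
  calc ∫ x, maxDeviation μ ℓ (k + 1) x ∂π
      ≤ ∫ x, (maxDeviation μ ℓ k x + S.sup' hSne fun p => |Y p x|) ∂π :=
        integral_mono (hint _) ((hint k).add hintS) hpt
    _ = ∫ x, maxDeviation μ ℓ k x ∂π + ∫ x, (S.sup' hSne fun p => |Y p x|) ∂π :=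
        integral_add (hint k) hintS
    _ ≤ _ := by linarith

theorem integral_maxDeviation_le [Nonempty ι] (hn : 1 ≤ n) (hℓ : IsLipschitzFamily ℓ Λ R R₀) (k : ℕ) :
    ∫ x, maxDeviation μ ℓ k x ∂(Measure.pi fun _ : Fin n => μ) ≤
      (R₀ + 4 * √(Fintype.card ι) * Λ) / √n := by
  have hΛ := hℓ.pos.1
  -- Here 3 - (k + 3)/2^k is the partial sum of (j + 2)/2^(j + 1) over j < k.
  have h : ∀ k : ℕ, ∫ x, maxDeviation μ ℓ k x ∂(Measure.pi fun _ : Fin n => μ) ≤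
      R₀ / √n + 4 / 3 * √(Fintype.card ι) * Λ / √n * (3 - (k + 3) * (1 / 2) ^ k) := by
    intro k
    induction k with
    | zero => simpa using integral_maxDeviation_zero_le hn hℓ
    | succ k ih =>
      refine (integral_maxDeviation_succ_le hn hℓ k).trans ?_
      refine (add_le_add_left ih _).trans (le_of_eq ?_)
      push_cast
      ring
  refine (h k).trans ?_
  calc _ ≤ R₀ / √n + 4 / 3 * √(Fintype.card ι) * Λ / √n * 3 := by
        gcongr
        have : (0 : ℝ) ≤ (k + 3) * (1 / 2) ^ k := by positivity
        linarith
    _ = _ := by ring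

/-- Concentration of the maximal deviation over a Lipschitz family. -/
theorem measure_exists_deviation_gt_le [Nonempty ι] (hn : 1 ≤ n) (hℓ : IsLipschitzFamily ℓ Λ R R₀) {ε : ℝ}
    (hε : 0 < ε) :
    (Measure.pi fun _ : Fin n => μ) {x | ∃ θ : ι → ℝ, (∀ i, |θ i| ≤ 1) ∧
      (R₀ + 4 * √(Fintype.card ι) * Λ) / √n + ε < |deviation μ (ℓ θ) x|} ≤
      ENNReal.ofReal (Real.exp (-(1 / 2) * (ε ^ 2 * n / R ^ 2))) := by
  have hn0 : (0 : ℝ) < n := by exact_mod_cast hn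
  obtain ⟨hΛ, hR, hR₀⟩ := hℓ.pos
  have : Nonempty E := μ.nonempty_of_neZero
  obtain ⟨B, hB0, hB⟩ := hℓ.exists_bound
  obtain ⟨k, hk⟩ := exists_pow_lt_of_lt_one (show 0 < ε / (4 * Λ) by positivity)
    (show (1 / 2 : ℝ) < 1 by norm_num)
  -- Rounding θ to the grid changes the deviation by at most 2Λ 2^(-k). Half of ε pays for this and
  -- McDiarmid gets the other half, hence the rate 2 · (1/2)² = 1/2.
  have hk' : 2 * (Λ * (1 / 2) ^ k) ≤ ε / 2 := by
    rw [lt_div_iff₀ (by positivity)] at hk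
    linarith
  have h := measure_ge_le_of_bounded_differences μ (c := R / n) (by positivity) hn
    (measurable_maxDeviation (n := n) (μ := μ) hℓ k) (abs_maxDeviation_le hn hB k)
    (maxDeviation_update_le hn hℓ k) (t := ε / 2) (by positivity)
  refine (measure_mono ?_).trans (h.trans (le_of_eq ?_))
  · rintro x ⟨θ, hθ, hx⟩
    obtain ⟨s, hs, hd⟩ := exists_mem_dyadicGrid hθ k
    have hs1 := abs_le_one_of_mem_dyadicGrid hs
    have hi : ∀ θ, (∀ i, |θ i| ≤ 1) → Integrable (ℓ θ) μ := fun θ hθ =>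
      Integrable.of_bound (hℓ.measurable θ hθ).aestronglyMeasurable B (ae_of_all _ (hB θ hθ))
    have h1 := abs_deviation_le (μ := μ) hn (hℓ.lipschitz θ s hθ hs1 _ hd) x
    rw [deviation_sub (hi θ hθ) (hi s hs1)] at h1
    have h2 : |deviation μ (ℓ s) x| ≤ maxDeviation μ ℓ k x :=
      Finset.le_sup' (fun s => |deviation μ (ℓ s) x|) hs
    have h3 := abs_sub_abs_le_abs_sub (deviation μ (ℓ θ) x) (deviation μ (ℓ s) x)
    have h4 := integral_maxDeviation_le (μ := μ) hn hℓ k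
    rw [mem_ofPred_eq]
    linarith
  · congr 2
    field_simp

end Chaining

end LtI

namespace LtI

/-! ### Ordinary differential equations on the unit interval and Liouville's formula. -/

section GlobalSolutions

/-- A bounded vector field that is globally Lipschitz has solutions on the unit interval. -/
theorem exists_solution_of_lipschitz_of_bounded {F : Type*} [NormedAddCommGroup F]
    [NormedSpace ℝ F] [CompleteSpace F] {w : ℝ → F → F} {K B : ℝ≥0}
    (hlip : ∀ t ∈ Icc (0 : ℝ) 1, LipschitzWith K (w t))
    (hcont : ∀ x, ContinuousOn (w · x) (Icc 0 1))
    (hB : ∀ t ∈ Icc (0 : ℝ) 1, ∀ x, ‖w t x‖ ≤ B) (x₀ : F) :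
    ∃ y : ℝ → F, y 0 = x₀ ∧
      ∀ t ∈ Icc (0 : ℝ) 1, HasDerivWithinAt y (w t (y t)) (Icc 0 1) t := by
  -- At speed at most B a solution stays within distance B of x₀ during unit time, so the ball of
  -- radius B serves the whole interval.
  have h : IsPicardLindelof w (⟨0, by simp⟩ : Icc (0 : ℝ) 1) x₀ B 0 B K :=
    { lipschitzOnWith := fun t ht => (hlip t ht).lipschitzOnWith
      continuousOn := fun x _ => hcont x
      norm_le := fun t ht x _ => hB t ht x
      mul_max_le := by simp }
  exact h.exists_eq_forall_mem_Icc_hasDerivWithinAt₀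

theorem hasDerivWithinAt_Ici_of_Icc {F : Type*} [NormedAddCommGroup F] [NormedSpace ℝ F]
    {y : ℝ → F} {y' : F} {t : ℝ} (ht : t ∈ Ico (0 : ℝ) 1)
    (h : HasDerivWithinAt y y' (Icc 0 1) t) : HasDerivWithinAt y y' (Ici t) t := by
  refine (h.mono_of_mem_nhdsWithin ?_)
  exact Filter.mem_of_superset (Icc_mem_nhdsGE ht.2) (Icc_subset_Icc_left ht.1)

/-- Truncation of a real number to `[-R, R]`. -/
def truncate (R x : ℝ) : ℝ := max (-R) (min R x)

theorem abs_truncate_sub_le (R x y : ℝ) : |truncate R x - truncate R y| ≤ |x - y| := by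
  unfold truncate
  refine (abs_max_sub_max_le_max _ _ _ _).trans ?_
  simpa using abs_min_sub_min_le_max R x R y

theorem abs_truncate_le {R : ℝ} (hR : 0 ≤ R) (x : ℝ) : |truncate R x| ≤ R := by
  unfold truncate
  rw [abs_le]
  exact ⟨le_max_left _ _, max_le (by linarith) (min_le_left _ _)⟩

theorem truncate_of_abs_le {R x : ℝ} (h : |x| ≤ R) : truncate R x = x := by
  unfold truncate
  rw [min_eq_right (abs_le.1 h).2, max_eq_right (abs_le.1 h).1]

theorem abs_truncate_le_abs {R : ℝ} (hR : 0 ≤ R) (x : ℝ) : |truncate R x| ≤ |x| := by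
  simpa [truncate_of_abs_le (R := R) (x := 0) (by simpa using hR)] using
    abs_truncate_sub_le R x 0

variable {d : ℕ}

theorem norm_mulVec_le {A : Matrix (Fin d) (Fin d) ℝ} {a : ℝ} (ha0 : 0 ≤ a)
    (ha : ∀ i j, |A i j| ≤ a) (x : Fin d → ℝ) : ‖A.mulVec x‖ ≤ d * a * ‖x‖ := by
  refine (pi_norm_le_iff_of_nonneg (by positivity)).2 fun i => ?_
  rw [Matrix.mulVec, dotProduct, Real.norm_eq_abs]
  calc |∑ j, A i j * x j| ≤ ∑ j, |A i j * x j| := Finset.abs_sum_le_sum_abs _ _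
    _ ≤ ∑ _j : Fin d, a * ‖x‖ := by
        refine Finset.sum_le_sum fun j _ => ?_
        rw [abs_mul]
        gcongr
        · exact ha i j
        · exact norm_le_pi_norm x j
    _ = d * a * ‖x‖ := by simp [mul_assoc]

theorem exists_forall_abs_le_of_continuousOn {A : ℝ → Matrix (Fin d) (Fin d) ℝ}
    (hA : ∀ i j, ContinuousOn (fun t => A t i j) (Icc 0 1)) :
    ∃ a : ℝ, 0 ≤ a ∧ ∀ t ∈ Icc (0 : ℝ) 1, ∀ i j, |A t i j| ≤ a := by
  have h : ∀ i j, ∃ a, ∀ t ∈ Icc (0 : ℝ) 1, |A t i j| ≤ a := fun i j =>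
    isCompact_Icc.exists_bound_of_continuousOn (hA i j)
  choose a ha using h
  refine ⟨∑ i, ∑ j, |a i j|, by positivity, fun t ht i j => ?_⟩
  calc |A t i j| ≤ |a i j| := (ha i j t ht).trans (le_abs_self _)
    _ ≤ ∑ j, |a i j| := Finset.single_le_sum (f := fun j => |a i j|) (by simp) (Finset.mem_univ j)
    _ ≤ _ := Finset.single_le_sum (f := fun i => ∑ j, |a i j|) (fun _ _ => by positivity)
      (Finset.mem_univ i)

/-- Linear differential equations have solutions on the unit interval. -/
theorem exists_linear_solution {A : ℝ → Matrix (Fin d) (Fin d) ℝ}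
    (hA : ∀ i j, ContinuousOn (fun t => A t i j) (Icc 0 1)) (p₀ : Fin d → ℝ) :
    ∃ p : ℝ → Fin d → ℝ, p 0 = p₀ ∧
      ∀ t ∈ Icc (0 : ℝ) 1, HasDerivWithinAt p ((A t).mulVec (p t)) (Icc 0 1) t := by
  obtain ⟨a, ha0, ha⟩ := exists_forall_abs_le_of_continuousOn hA
  -- R is the Grönwall bound of the linear equation. Truncation at R makes the field bounded and
  -- keeps ‖p'‖ ≤ d a ‖p‖, so the solution stays below R and the truncation never acts.
  set R : ℝ := ‖p₀‖ * Real.exp (d * a) with hR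
  have hR0 : 0 ≤ R := by positivity
  have htr : ∀ x : Fin d → ℝ, ‖fun i => truncate R (x i)‖ ≤ R := fun x =>
    (pi_norm_le_iff_of_nonneg hR0).2 fun i => abs_truncate_le hR0 _
  have htr' : ∀ x : Fin d → ℝ, ‖fun i => truncate R (x i)‖ ≤ ‖x‖ := fun x =>
    (pi_norm_le_iff_of_nonneg (norm_nonneg _)).2 fun i =>
      (abs_truncate_le_abs hR0 _).trans (norm_le_pi_norm x i)
  obtain ⟨p, hp0, hp⟩ := exists_solution_of_lipschitz_of_bounded
    (w := fun t x => (A t).mulVec fun i => truncate R (x i))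
    (K := ⟨d * a, by positivity⟩) (B := ⟨d * a * R, by positivity⟩)
    (fun t ht => by
      refine LipschitzWith.of_dist_le_mul fun x y => ?_
      rw [dist_eq_norm, ← Matrix.mulVec_sub, dist_eq_norm]
      refine (norm_mulVec_le ha0 (ha t ht) _).trans ?_
      refine mul_le_mul_of_nonneg_left ?_ (by positivity)
      exact (pi_norm_le_iff_of_nonneg (norm_nonneg _)).2 fun i =>
        (abs_truncate_sub_le _ _ _).trans (norm_le_pi_norm (x - y) i))
    (fun x => by
      refine continuousOn_pi.2 fun i => ?_
      simp only [Matrix.mulVec, dotProduct]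
      exact continuousOn_finsetSum _ fun j _ => (hA i j).mul continuousOn_const)
    (fun t ht x => (norm_mulVec_le ha0 (ha t ht) _).trans
      (mul_le_mul_of_nonneg_left (htr x) (by positivity))) p₀
  refine ⟨p, hp0, fun t ht => ?_⟩
  have hcont : ContinuousOn p (Icc 0 1) := fun t ht => (hp t ht).continuousWithinAt
  have hbd := norm_le_gronwallBound_of_norm_deriv_right_le (δ := ‖p₀‖) (K := d * a) (ε := 0)
    hcont (fun t ht => hasDerivWithinAt_Ici_of_Icc ht (hp t (Ico_subset_Icc_self ht)))
    (by rw [hp0]) (fun t ht => by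
      rw [add_zero]
      exact (norm_mulVec_le ha0 (ha t (Ico_subset_Icc_self ht)) _).trans
        (mul_le_mul_of_nonneg_left (htr' _) (by positivity))) t ht
  rw [gronwallBound_ε0, sub_zero] at hbd
  have hpR : ‖p t‖ ≤ R := hbd.trans (by
    rw [hR]
    refine mul_le_mul_of_nonneg_left (Real.exp_le_exp.2 ?_) (norm_nonneg _)
    exact mul_le_of_le_one_right (by positivity) ht.2)
  have : (fun i => truncate R (p t i)) = p t := funext fun i =>
    truncate_of_abs_le ((norm_le_pi_norm (p t) i).trans hpR)
  have h := hp t ht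
  rwa [this] at h

/-- The fundamental solution of a linear differential equation. -/
theorem exists_fundamental_solution {A : ℝ → Matrix (Fin d) (Fin d) ℝ}
    (hA : ∀ i j, ContinuousOn (fun t => A t i j) (Icc 0 1)) :
    ∃ P : ℝ → Matrix (Fin d) (Fin d) ℝ, P 0 = 1 ∧ ∀ t ∈ Icc (0 : ℝ) 1, ∀ i j,
      HasDerivWithinAt (fun t => P t i j) ((A t * P t) i j) (Icc 0 1) t := by
  choose p hp0 hp using fun j : Fin d => exists_linear_solution hA (fun i => (1 : Matrix _ _ ℝ) i j)
  refine ⟨fun t => Matrix.of fun i j => p j t i, ?_, fun t ht i j => ?_⟩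
  · ext i j
    simp only [Matrix.of_apply, hp0]
  · exact (hasDerivWithinAt_pi.1 (hp j t ht)) i

theorem differentiable_det : Differentiable ℝ fun Q : Fin d → Fin d → ℝ => (Matrix.of Q).det := by
  simp only [Matrix.det_apply, Matrix.of_apply]
  fun_prop

/-- The determinant is 1 + s tr A + s² times a polynomial in s, so only the trace survives at 0. -/
theorem hasDerivAt_det_one_add_smul (A : Matrix (Fin d) (Fin d) ℝ) :
    HasDerivAt (fun s : ℝ => Matrix.det (1 + s • A)) A.trace 0 := by
  rw [funext fun s : ℝ => Matrix.det_one_add_smul s A]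
  have h := (((hasDerivAt_id (0 : ℝ)).const_mul A.trace).const_add 1).add
    (((Polynomial.hasDerivAt (p := (Matrix.det (1 + (Polynomial.X : Polynomial ℝ) •
      A.map Polynomial.C)).divX.divX) 0)).mul ((hasDerivAt_id (0 : ℝ)).pow 2))
  refine (h.congr_deriv (by simp)).congr_of_eventuallyEq (Filter.Eventually.of_forall fun s => ?_)
  simp [pow_two]

/-- **Liouville's formula**, infinitesimal form. -/
theorem hasDerivWithinAt_det {A : Matrix (Fin d) (Fin d) ℝ} {P : ℝ → Matrix (Fin d) (Fin d) ℝ}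
    {s : Set ℝ} {t : ℝ}
    (hP : ∀ i j, HasDerivWithinAt (fun t => P t i j) ((A * P t) i j) s t) :
    HasDerivWithinAt (fun t => (P t).det) (A.trace * (P t).det) s t := by
  have hP' : HasDerivWithinAt (fun t => (P t : Fin d → Fin d → ℝ))
      (A * P t : Matrix (Fin d) (Fin d) ℝ) s t :=
    hasDerivWithinAt_pi.2 fun i => hasDerivWithinAt_pi.2 fun j => hP i j
  have hdet := (differentiable_det (P t)).hasFDerivAt
  have h1 := hdet.comp_hasDerivWithinAt t hP'
  -- The derivative of det at P in the direction AP is read off along the line P + r A P = (1 + r A)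
  -- P, where det factors as det(1 + r A) det P. Uniqueness of the derivative identifies the two
  -- computations.
  have hline : HasDerivAt (fun r : ℝ => (fun i j => P t i j + r * (A * P t) i j :
      Fin d → Fin d → ℝ)) (A * P t : Matrix (Fin d) (Fin d) ℝ) 0 := by
    refine hasDerivAt_pi.2 fun i => hasDerivAt_pi.2 fun j => ?_
    simpa using ((hasDerivAt_id (0 : ℝ)).mul_const ((A * P t) i j)).const_add (P t i j)
  have hdet' : HasFDerivAt (fun Q : Fin d → Fin d → ℝ => (Matrix.of Q).det)
      (fderiv ℝ (fun Q : Fin d → Fin d → ℝ => (Matrix.of Q).det) (P t))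
      (fun i j => P t i j + (0 : ℝ) * (A * P t) i j : Fin d → Fin d → ℝ) := by
    simpa using hdet
  have h2 := hdet'.comp_hasDerivAt (0 : ℝ) hline
  have h3 : HasDerivAt (fun r : ℝ => Matrix.det (1 + r • A) * (P t).det)
      (A.trace * (P t).det) 0 := (hasDerivAt_det_one_add_smul A).mul_const _
  have h4 : (fun r : ℝ => Matrix.det (1 + r • A) * (P t).det) =
      (fun Q : Fin d → Fin d → ℝ => (Matrix.of Q).det) ∘
        fun r : ℝ => (fun i j => P t i j + r * (A * P t) i j : Fin d → Fin d → ℝ) := by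
    ext r
    rw [← Matrix.det_mul, add_mul, one_mul, Matrix.smul_mul]
    rfl
  rw [h4] at h3
  rw [h3.unique h2]
  exact h1

/-- **Liouville's formula**. -/
theorem det_eq_exp_integral_trace {A P : ℝ → Matrix (Fin d) (Fin d) ℝ}
    (hA : ContinuousOn (fun t => (A t).trace) (Icc 0 1)) (hP0 : P 0 = 1)
    (hP : ∀ t ∈ Icc (0 : ℝ) 1, ∀ i j,
      HasDerivWithinAt (fun t => P t i j) ((A t * P t) i j) (Icc 0 1) t) :
    (P 1).det = Real.exp (∫ t in (0 : ℝ)..1, (A t).trace) := by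
  -- Extended by its end values the trace is continuous on all of ℝ, so its primitive has a
  -- two-sided derivative at the end points too.
  set g : ℝ → ℝ := IccExtend zero_le_one ((Icc (0 : ℝ) 1).domRestrict fun t => (A t).trace)
  have hg : Continuous g := (continuousOn_iff_continuous_domRestrict.1 hA).Icc_extend'
  have hgA : ∀ t ∈ Icc (0 : ℝ) 1, g t = (A t).trace := fun t ht =>
    IccExtend_of_mem zero_le_one _ ht
  have hT : ∀ t, HasDerivAt (fun t => ∫ s in (0 : ℝ)..t, g s) (g t) t := fun t =>
    intervalIntegral.integral_hasDerivAt_right (hg.intervalIntegrable _ _)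
      (hg.stronglyMeasurableAtFilter _ _) hg.continuousAt
  have hD : ∀ t ∈ Icc (0 : ℝ) 1, HasDerivWithinAt
      (fun t => (P t).det * Real.exp (-∫ s in (0 : ℝ)..t, g s)) 0 (Icc 0 1) t := by
    intro t ht
    have h := (hasDerivWithinAt_det (hP t ht)).mul ((hT t).neg.exp.hasDerivWithinAt (s := Icc 0 1))
    refine h.congr_deriv ?_
    rw [hgA t ht]
    simp only [Pi.neg_apply]
    ring
  have h := constant_of_has_deriv_right_zero (fun t ht => (hD t ht).continuousWithinAt)
    (fun t ht => hasDerivWithinAt_Ici_of_Icc ht (hD t (Ico_subset_Icc_self ht))) 1 (by simp)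
  simp only [hP0, Matrix.det_one, intervalIntegral.integral_same, neg_zero, Real.exp_zero,
    mul_one] at h
  rw [Real.exp_neg, mul_inv_eq_one₀ (Real.exp_pos _).ne'] at h
  rw [h]
  congr 1
  refine intervalIntegral.integral_congr fun t ht => ?_
  rw [uIcc_of_le zero_le_one] at ht
  exact hgA t ht

end GlobalSolutions

end LtI

namespace LtI

/-! ### Geometry of the unit cube and the projection to it. -/

section Cube

variable {d : ℕ}

theorem EuclideanSpace.norm_le_of_forall_abs_le {x y : EuclideanSpace ℝ (Fin d)}
    (h : ∀ i, |x i| ≤ |y i|) : ‖x‖ ≤ ‖y‖ := by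
  rw [EuclideanSpace.norm_eq, EuclideanSpace.norm_eq]
  refine Real.sqrt_le_sqrt (Finset.sum_le_sum fun i _ => ?_)
  exact pow_le_pow_left₀ (abs_nonneg _) (h i) 2

theorem EuclideanSpace.norm_le_sqrt_mul {x : EuclideanSpace ℝ (Fin d)} {c : ℝ} (hc : 0 ≤ c)
    (h : ∀ i, |x i| ≤ c) : ‖x‖ ≤ √d * c := by
  rw [EuclideanSpace.norm_eq, ← Real.sqrt_sq hc, ← Real.sqrt_mul (by positivity)]
  refine Real.sqrt_le_sqrt ?_
  calc ∑ i, ‖x i‖ ^ 2 ≤ ∑ _i : Fin d, c ^ 2 :=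
        Finset.sum_le_sum fun i _ => pow_le_pow_left₀ (abs_nonneg _) (h i) 2
    _ = d * c ^ 2 := by simp

theorem EuclideanSpace.abs_apply_le_norm (x : EuclideanSpace ℝ (Fin d)) (i : Fin d) :
    |x i| ≤ ‖x‖ := PiLp.norm_apply_le x i

theorem cube_eq_iInter :
    cube d = ⋂ i, (fun x : EuclideanSpace ℝ (Fin d) => x i) ⁻¹' Icc 0 1 := by
  ext x; simp [cube]

theorem isClosed_cube : IsClosed (cube d) := by
  rw [cube_eq_iInter]
  exact isClosed_iInter fun i => isClosed_Icc.preimage (by fun_prop)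

theorem norm_le_of_mem_cube {x : EuclideanSpace ℝ (Fin d)} (hx : x ∈ cube d) : ‖x‖ ≤ √d := by
  simpa using EuclideanSpace.norm_le_sqrt_mul zero_le_one
    fun i => (by rw [abs_of_nonneg (hx i).1]; exact (hx i).2)

theorem dist_le_of_mem_cube {x y : EuclideanSpace ℝ (Fin d)} (hx : x ∈ cube d) (hy : y ∈ cube d) :
    dist x y ≤ √d := by
  rw [dist_eq_norm]
  simpa using EuclideanSpace.norm_le_sqrt_mul (x := x - y) zero_le_one fun i => by
    have h1 := hx i; have h2 := hy i
    rw [PiLp.sub_apply, abs_le]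
    constructor <;> linarith [h1.1, h1.2, h2.1, h2.2]

theorem isCompact_cube : IsCompact (cube d) :=
  Metric.isCompact_of_isClosed_isBounded isClosed_cube
    ((isBounded_iff_forall_norm_le).2 ⟨√d, fun _ => norm_le_of_mem_cube⟩)

theorem measurableSet_cube : MeasurableSet (cube d) := isClosed_cube.measurableSet

/-- A small move towards the center leads into the interior. This makes a continuous density unique
on the whole cube, faces included. -/
theorem cube_subset_closure_interior : cube d ⊆ closure (interior (cube d)) := by
  have hopen : IsOpen {x : EuclideanSpace ℝ (Fin d) | ∀ i, x i ∈ Ioo (0 : ℝ) 1} := by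
    have : {x : EuclideanSpace ℝ (Fin d) | ∀ i, x i ∈ Ioo (0 : ℝ) 1} =
        ⋂ i, (fun x : EuclideanSpace ℝ (Fin d) => x i) ⁻¹' Ioo 0 1 := by ext x; simp
    rw [this]
    exact isOpen_iInter_of_finite fun i => isOpen_Ioo.preimage (by fun_prop)
  have hsub : {x : EuclideanSpace ℝ (Fin d) | ∀ i, x i ∈ Ioo (0 : ℝ) 1} ⊆ interior (cube d) :=
    interior_maximal (fun x hx i => Ioo_subset_Icc_self (hx i)) hopen
  intro x hx
  refine closure_mono hsub ?_
  set c : EuclideanSpace ℝ (Fin d) := WithLp.toLp 2 fun _ => 1 / 2 with hc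
  have hlim : Filter.Tendsto (fun s : ℝ => x + s • (c - x)) (nhdsWithin 0 (Ioo 0 1)) (nhds x) := by
    have : Filter.Tendsto (fun s : ℝ => x + s • (c - x)) (nhds 0) (nhds (x + (0 : ℝ) • (c - x))) :=
      Continuous.tendsto (by fun_prop) 0
    rw [zero_smul, add_zero] at this
    exact this.mono_left nhdsWithin_le_nhds
  have : (nhdsWithin (0 : ℝ) (Ioo 0 1)).NeBot := left_nhdsWithin_Ioo_neBot zero_lt_one
  refine mem_closure_of_tendsto hlim ?_
  filter_upwards [self_mem_nhdsWithin] with s hs i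
  have h1 := hx i
  simp only [PiLp.add_apply, PiLp.smul_apply, PiLp.sub_apply, smul_eq_mul, hc]
  constructor <;> nlinarith [h1.1, h1.2, hs.1, hs.2]

/-- The nearest point projection to the unit cube. -/
def cubeClamp (x : EuclideanSpace ℝ (Fin d)) : EuclideanSpace ℝ (Fin d) :=
  WithLp.toLp 2 fun i => max 0 (min 1 (x i))

theorem cubeClamp_apply (x : EuclideanSpace ℝ (Fin d)) (i : Fin d) :
    cubeClamp x i = max 0 (min 1 (x i)) := rfl

theorem cubeClamp_mem (x : EuclideanSpace ℝ (Fin d)) : cubeClamp x ∈ cube d := fun _ =>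
  ⟨le_max_left _ _, max_le zero_le_one (min_le_left _ _)⟩

theorem cubeClamp_of_mem {x : EuclideanSpace ℝ (Fin d)} (hx : x ∈ cube d) : cubeClamp x = x := by
  ext i
  rw [cubeClamp_apply, min_eq_right (hx i).2, max_eq_right (hx i).1]

theorem lipschitzWith_cubeClamp :
    LipschitzWith 1 (cubeClamp : EuclideanSpace ℝ (Fin d) → EuclideanSpace ℝ (Fin d)) := by
  refine LipschitzWith.of_dist_le_mul fun x y => ?_
  rw [NNReal.coe_one, one_mul, dist_eq_norm, dist_eq_norm]
  refine EuclideanSpace.norm_le_of_forall_abs_le fun i => ?_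
  rw [PiLp.sub_apply, PiLp.sub_apply, cubeClamp_apply, cubeClamp_apply]
  refine (abs_max_sub_max_le_max _ _ _ _).trans ?_
  simpa using abs_min_sub_min_le_max 1 (x i) 1 (y i)

end Cube

/-! ### The flow of a field tangent to the faces of the cube. -/

section Flow

variable {d : ℕ}

/-- A time dependent vector field `w` on the unit cube that is tangent to the faces, with Lipschitz
constant `M` and spatial derivative `J`. -/
structure IsCubeField (w : EuclideanSpace ℝ (Fin d) → ℝ → EuclideanSpace ℝ (Fin d))
    (J : EuclideanSpace ℝ (Fin d) → ℝ → Matrix (Fin d) (Fin d) ℝ) (M : ℝ≥0) : Prop where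
  cont : ContinuousOn (Function.uncurry w) (cube d ×ˢ Icc 0 1)
  cont_deriv : ∀ i j, ContinuousOn (fun p : EuclideanSpace ℝ (Fin d) × ℝ => J p.1 p.2 i j)
    (cube d ×ˢ Icc 0 1)
  lip : ∀ t ∈ Icc (0 : ℝ) 1, LipschitzOnWith M (w · t) (cube d)
  -- A uniform quadratic remainder makes sense up to the faces, and it suits ReQU networks, whose
  -- activation has a Lipschitz derivative but no second derivative at 0.
  taylor : ∃ K : ℝ, ∀ t ∈ Icc (0 : ℝ) 1, ∀ x ∈ cube d, ∀ y ∈ cube d, ∀ i,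
    |w y t i - w x t i - ∑ j, J x t i j * (y j - x j)| ≤ K * ‖y - x‖ ^ 2
  tangent : ∀ t ∈ Icc (0 : ℝ) 1, ∀ x ∈ cube d, ∀ i, x i = 0 ∨ x i = 1 → w x t i = 0

variable {w w' : EuclideanSpace ℝ (Fin d) → ℝ → EuclideanSpace ℝ (Fin d)}
  {J : EuclideanSpace ℝ (Fin d) → ℝ → Matrix (Fin d) (Fin d) ℝ} {M : ℝ≥0}

theorem one_sub_mem_Icc {t : ℝ} (ht : t ∈ Icc (0 : ℝ) 1) : 1 - t ∈ Icc (0 : ℝ) 1 :=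
  ⟨by linarith [ht.2], by linarith [ht.1]⟩

/-- The field obtained by time reversal. -/
theorem IsCubeField.reverse (hw : IsCubeField w J M) :
    IsCubeField (fun x t => -w x (1 - t)) (fun x t => -J x (1 - t)) M where
  cont := (hw.cont.comp (f := fun p : EuclideanSpace ℝ (Fin d) × ℝ => (p.1, 1 - p.2))
    (by fun_prop) fun p hp => ⟨hp.1, one_sub_mem_Icc hp.2⟩).neg
  cont_deriv i j := ((hw.cont_deriv i j).comp
    (f := fun p : EuclideanSpace ℝ (Fin d) × ℝ => (p.1, 1 - p.2))
    (by fun_prop) fun p hp => ⟨hp.1, one_sub_mem_Icc hp.2⟩).neg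
  lip t ht := (hw.lip _ (one_sub_mem_Icc ht)).neg
  taylor := by
    obtain ⟨K, hK⟩ := hw.taylor
    refine ⟨K, fun t ht x hx y hy i => ?_⟩
    refine (le_of_eq ?_).trans (hK (1 - t) (one_sub_mem_Icc ht) x hx y hy i)
    rw [← abs_neg]
    congr 1
    simp only [PiLp.neg_apply, Matrix.neg_apply, neg_mul, Finset.sum_neg_distrib]
    ring
  tangent t ht x hx i h := by
    rw [PiLp.neg_apply, hw.tangent _ (one_sub_mem_Icc ht) x hx i h, neg_zero]

/-- At a contact with the barrier 1 + ε t one has z ≥ 1, so z has speed 0 < ε and cannot cross; then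
ε → 0. Applied to y_i and 1 - y_i it confines trajectories to the cube. -/
theorem le_one_of_deriv_eq_zero {z z' : ℝ → ℝ} (h0 : z 0 ≤ 1)
    (hz : ∀ t ∈ Icc (0 : ℝ) 1, HasDerivWithinAt z (z' t) (Icc 0 1) t)
    (hz' : ∀ t ∈ Icc (0 : ℝ) 1, 1 ≤ z t → z' t = 0) : ∀ t ∈ Icc (0 : ℝ) 1, z t ≤ 1 := by
  intro t ht
  refine le_of_forall_pos_le_add fun ε hε => ?_
  have h := image_le_of_deriv_right_lt_deriv_boundary (f := z) (f' := z')
    (B := fun t => 1 + ε * t) (B' := fun _ => ε) (fun t ht => (hz t ht).continuousWithinAt)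
    (fun t ht => hasDerivWithinAt_Ici_of_Icc ht (hz t (Ico_subset_Icc_self ht))) (by simpa using h0)
    (fun t => by simpa using ((hasDerivAt_id t).const_mul ε).const_add 1)
    (fun t ht hB => by
      rw [hz' t (Ico_subset_Icc_self ht) (by
        rw [hB]; linarith [mul_nonneg hε.le ht.1])]
      exact hε) ht
  exact h.trans (by nlinarith [ht.2])

theorem hasDerivWithinAt_apply {y : ℝ → EuclideanSpace ℝ (Fin d)} {y' : EuclideanSpace ℝ (Fin d)}
    {s : Set ℝ} {t : ℝ} (h : HasDerivWithinAt y y' s t) (i : Fin d) :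
    HasDerivWithinAt (fun t => y t i) (y' i) s t :=
  (EuclideanSpace.proj (𝕜 := ℝ) i).hasFDerivAt.comp_hasDerivWithinAt t h

theorem IsCubeField.exists_bound (hw : IsCubeField w J M) :
    ∃ B : ℝ≥0, ∀ t ∈ Icc (0 : ℝ) 1, ∀ x ∈ cube d, ‖w x t‖ ≤ B := by
  obtain ⟨B, hB⟩ := (isCompact_cube.prod isCompact_Icc).exists_bound_of_continuousOn hw.cont
  exact ⟨⟨|B|, abs_nonneg B⟩, fun t ht x hx => (hB (x, t) ⟨hx, ht⟩).trans (le_abs_self B)⟩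

/-- A field that is tangent to the faces of the cube has a trajectory from each point. -/
theorem IsCubeField.exists_isTrajectory (hw : IsCubeField w J M)
    {x : EuclideanSpace ℝ (Fin d)} (hx : x ∈ cube d) : ∃ y, IsTrajectory w x y := by
  obtain ⟨B, hB⟩ := hw.exists_bound
  -- Composed with the clamp, the field is globally defined, bounded and Lipschitz. A coordinate on
  -- or beyond a face is clamped to that face, where tangency stops it; so the solution stays in the
  -- cube and solves the original equation.
  obtain ⟨y, hy0, hy⟩ := exists_solution_of_lipschitz_of_bounded
    (w := fun t x => w (cubeClamp x) t) (K := M * 1) (B := B)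
    (fun t ht => by
      have := (hw.lip t ht).comp lipschitzWith_cubeClamp.lipschitzOnWith
        (s := univ) fun x _ => cubeClamp_mem x
      rwa [lipschitzOnWith_univ] at this)
    (fun x => hw.cont.comp (f := fun t : ℝ => (cubeClamp x, t)) (by fun_prop)
      fun t ht => ⟨cubeClamp_mem x, ht⟩)
    (fun t ht x => hB t ht _ (cubeClamp_mem x)) x
  have hcoord : ∀ i, ∀ t ∈ Icc (0 : ℝ) 1, HasDerivWithinAt (fun t => y t i)
      (w (cubeClamp (y t)) t i) (Icc 0 1) t := fun i t ht => hasDerivWithinAt_apply (hy t ht) i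
  have hmem : ∀ t ∈ Icc (0 : ℝ) 1, y t ∈ cube d := by
    intro t ht i
    have hle := le_one_of_deriv_eq_zero (z := fun t => y t i) (by rw [hy0]; exact (hx i).2)
      (hcoord i) (fun t ht h => hw.tangent t ht _ (cubeClamp_mem _) i (Or.inr (by
        rw [cubeClamp_apply, min_eq_left h]; simp))) t ht
    have hge := le_one_of_deriv_eq_zero (z := fun t => 1 - y t i)
      (by rw [hy0]; linarith [(hx i).1])
      (fun t ht => (hcoord i t ht).const_sub 1)
      (fun t ht h => by
        rw [hw.tangent t ht _ (cubeClamp_mem _) i (Or.inl (by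
          rw [cubeClamp_apply, max_eq_left]
          exact (min_le_right _ _).trans (by linarith))), neg_zero]) t ht
    exact ⟨by linarith, hle⟩
  refine ⟨y, hy0, hmem, fun t ht => ?_⟩
  have h := hy t ht
  rwa [cubeClamp_of_mem (hmem t ht)] at h

theorem IsTrajectory.continuousOn {x : EuclideanSpace ℝ (Fin d)}
    {y : ℝ → EuclideanSpace ℝ (Fin d)} (hy : IsTrajectory w x y) : ContinuousOn y (Icc 0 1) :=
  fun t ht => (hy.deriv t ht).continuousWithinAt

theorem IsTrajectory.deriv_right {x : EuclideanSpace ℝ (Fin d)}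
    {y : ℝ → EuclideanSpace ℝ (Fin d)} (hy : IsTrajectory w x y) (t : ℝ) (ht : t ∈ Ico (0 : ℝ) 1) :
    HasDerivWithinAt y (w (y t) t) (Ici t) t :=
  hasDerivWithinAt_Ici_of_Icc ht (hy.deriv t (Ico_subset_Icc_self ht))

/-- The estimate exp K - 1 ≤ K exp K removes the division by K, so that K = 0 needs no separate
form. -/
theorem gronwallBound_zero_le {K ε t : ℝ} (hK : 0 ≤ K) (hε : 0 ≤ ε) (ht : t ∈ Icc (0 : ℝ) 1) :
    gronwallBound 0 K ε t ≤ ε * Real.exp K := by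
  refine (gronwallBound_mono le_rfl hε hK ht.2).trans ?_
  rcases hK.eq_or_lt with rfl | hK
  · simp [gronwallBound_K0]
  · rw [gronwallBound_of_K_ne_0 hK.ne']
    have h1 : Real.exp K - 1 ≤ K * Real.exp K := by
      have h2 := Real.add_one_le_exp (-K)
      have h3 : Real.exp (-K) * Real.exp K = 1 := by rw [← Real.exp_add]; simp
      nlinarith [Real.exp_pos K]
    simp only [zero_mul, zero_add, mul_one]
    rw [div_mul_eq_mul_div, div_le_iff₀ hK]
    nlinarith

/-- Grönwall's inequality for trajectories from the same point along two different fields. -/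
theorem IsCubeField.dist_trajectories_le (hw : IsCubeField w J M) {η : ℝ} (hη : 0 ≤ η)
    (hww : ∀ t ∈ Icc (0 : ℝ) 1, ∀ x ∈ cube d, ‖w' x t - w x t‖ ≤ η)
    {x : EuclideanSpace ℝ (Fin d)} {y y' : ℝ → EuclideanSpace ℝ (Fin d)}
    (hy : IsTrajectory w x y) (hy' : IsTrajectory w' x y') {t : ℝ} (ht : t ∈ Icc (0 : ℝ) 1) :
    dist (y' t) (y t) ≤ η * Real.exp M := by
  have h := dist_le_of_approx_trajectories_ODE_of_mem (v := fun t x => w x t) (K := M)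
    (s := fun _ => cube d) (εf := η) (εg := 0) (δ := 0)
    (fun t ht => hw.lip t (Ico_subset_Icc_self ht))
    hy'.continuousOn hy'.deriv_right
    (fun t ht => by
      rw [dist_eq_norm]
      exact hww t (Ico_subset_Icc_self ht) _ (hy'.mem_cube t (Ico_subset_Icc_self ht)))
    (fun t ht => hy'.mem_cube t (Ico_subset_Icc_self ht))
    hy.continuousOn hy.deriv_right (fun t _ => by rw [dist_self])
    (fun t ht => hy.mem_cube t (Ico_subset_Icc_self ht))
    (by rw [hy.init, hy'.init, dist_self]) t ht
  rw [add_zero, sub_zero] at h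
  exact h.trans (gronwallBound_zero_le M.2 hη ht)

/-- Grönwall's inequality for trajectories from two different points. -/
theorem IsCubeField.dist_trajectories_le_mul (hw : IsCubeField w J M)
    {x x' : EuclideanSpace ℝ (Fin d)} {y y' : ℝ → EuclideanSpace ℝ (Fin d)}
    (hy : IsTrajectory w x y) (hy' : IsTrajectory w x' y') {t : ℝ} (ht : t ∈ Icc (0 : ℝ) 1) :
    dist (y t) (y' t) ≤ Real.exp M * dist x x' := by
  have h := dist_le_of_trajectories_ODE_of_mem (v := fun t x => w x t) (K := M)
    (s := fun _ => cube d) (δ := dist x x') (fun t ht => hw.lip t (Ico_subset_Icc_self ht))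
    hy.continuousOn hy.deriv_right (fun t ht => hy.mem_cube t (Ico_subset_Icc_self ht))
    hy'.continuousOn hy'.deriv_right (fun t ht => hy'.mem_cube t (Ico_subset_Icc_self ht))
    (by rw [hy.init, hy'.init]) t ht
  rw [sub_zero] at h
  refine h.trans ?_
  rw [mul_comm]
  refine mul_le_mul_of_nonneg_right (Real.exp_le_exp.2 ?_) dist_nonneg
  exact mul_le_of_le_one_right M.2 ht.2

theorem IsCubeField.eqOn (hw : IsCubeField w J M) {x : EuclideanSpace ℝ (Fin d)}
    {y y' : ℝ → EuclideanSpace ℝ (Fin d)} (hy : IsTrajectory w x y) (hy' : IsTrajectory w x y') :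
    EqOn y y' (Icc 0 1) := fun t ht => by
  have := hw.dist_trajectories_le_mul hy hy' ht
  rw [dist_self, mul_zero] at this
  exact dist_le_zero.1 this

open Classical in
/-- A trajectory from `x`, where there is one. -/
noncomputable def trajectory (w : EuclideanSpace ℝ (Fin d) → ℝ → EuclideanSpace ℝ (Fin d))
    (x : EuclideanSpace ℝ (Fin d)) : ℝ → EuclideanSpace ℝ (Fin d) :=
  if h : ∃ y, IsTrajectory w x y then h.choose else fun _ => x

theorem trajectory_one (x : EuclideanSpace ℝ (Fin d)) : trajectory w x 1 = flowMap w x := by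
  unfold trajectory flowMap
  split_ifs <;> rfl

theorem IsCubeField.isTrajectory (hw : IsCubeField w J M) {x : EuclideanSpace ℝ (Fin d)}
    (hx : x ∈ cube d) : IsTrajectory w x (trajectory w x) := by
  have h := hw.exists_isTrajectory hx
  unfold trajectory
  rw [dif_pos h]
  exact h.choose_spec

theorem IsCubeField.flowMap_eq (hw : IsCubeField w J M) {x : EuclideanSpace ℝ (Fin d)}
    {y : ℝ → EuclideanSpace ℝ (Fin d)} (hy : IsTrajectory w x y) : flowMap w x = y 1 := by
  have hx : x ∈ cube d := by rw [← hy.init]; exact hy.mem_cube 0 (by simp)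
  rw [← trajectory_one]
  exact hw.eqOn (hw.isTrajectory hx) hy (by simp)

theorem flowMap_of_notMem {x : EuclideanSpace ℝ (Fin d)} (hx : x ∉ cube d) : flowMap w x = x := by
  unfold flowMap
  rw [dif_neg]
  rintro ⟨y, hy⟩
  exact hx (by rw [← hy.init]; exact hy.mem_cube 0 (by simp))

theorem IsCubeField.flowMap_mem (hw : IsCubeField w J M) {x : EuclideanSpace ℝ (Fin d)}
    (hx : x ∈ cube d) : flowMap w x ∈ cube d := by
  rw [← trajectory_one]
  exact (hw.isTrajectory hx).mem_cube 1 (by simp)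

theorem IsCubeField.lipschitzOnWith_flowMap (hw : IsCubeField w J M) :
    LipschitzOnWith ⟨Real.exp M, (Real.exp_pos _).le⟩ (flowMap w) (cube d) :=
  LipschitzOnWith.of_dist_le_mul fun x hx y hy => by
    rw [← trajectory_one, ← trajectory_one]
    exact hw.dist_trajectories_le_mul (hw.isTrajectory hx) (hw.isTrajectory hy) (by simp)

theorem IsTrajectory.reverse {x : EuclideanSpace ℝ (Fin d)}
    {y : ℝ → EuclideanSpace ℝ (Fin d)} (hy : IsTrajectory w x y) :
    IsTrajectory (fun x t => -w x (1 - t)) (y 1) (fun t => y (1 - t)) where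
  init := by simp
  mem_cube t ht := hy.mem_cube _ (one_sub_mem_Icc ht)
  deriv t ht := by
    have h1 := hy.deriv (1 - t) (one_sub_mem_Icc ht)
    have h2 : HasDerivWithinAt (fun t : ℝ => 1 - t) (-1) (Icc 0 1) t := by
      simpa using ((hasDerivAt_id t).const_sub 1).hasDerivWithinAt
    have h3 := h1.scomp t h2 fun t ht => one_sub_mem_Icc ht
    rw [neg_one_smul] at h3
    simpa using! h3

/-- A trajectory run backwards is a trajectory of the reversed field, and by uniqueness it is the
one defining that flow map. -/
theorem IsCubeField.flowMap_reverse_flowMap (hw : IsCubeField w J M)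
    {x : EuclideanSpace ℝ (Fin d)} (hx : x ∈ cube d) :
    flowMap (fun x t => -w x (1 - t)) (flowMap w x) = x := by
  have hy := hw.isTrajectory hx
  have h := hw.reverse.flowMap_eq hy.reverse
  rw [trajectory_one, sub_self, hy.init] at h
  exact h

theorem IsCubeField.flowMap_flowMap_reverse (hw : IsCubeField w J M)
    {x : EuclideanSpace ℝ (Fin d)} (hx : x ∈ cube d) :
    flowMap w (flowMap (fun x t => -w x (1 - t)) x) = x := by
  have h := hw.reverse.flowMap_reverse_flowMap hx
  simpa using h

/-- The flow map is differentiable, and its Jacobian determinant is the exponential of the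
integrated divergence. -/
theorem IsCubeField.exists_hasFDerivWithinAt_flowMap (hw : IsCubeField w J M)
    {x : EuclideanSpace ℝ (Fin d)} (hx : x ∈ cube d) :
    ∃ D : EuclideanSpace ℝ (Fin d) →L[ℝ] EuclideanSpace ℝ (Fin d),
      HasFDerivWithinAt (flowMap w) D (cube d) x ∧
      D.det = Real.exp (∫ t in (0 : ℝ)..1, (J (trajectory w x t) t).trace) := by
  set y := trajectory w x
  have hy : IsTrajectory w x y := hw.isTrajectory hx
  have hA : ∀ i j, ContinuousOn (fun t => J (y t) t i j) (Icc 0 1) := fun i j =>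
    (hw.cont_deriv i j).comp (f := fun t => (y t, t)) (hy.continuousOn.prodMk continuousOn_id)
      fun t ht => ⟨hy.mem_cube t ht, ht⟩
  have htr : ContinuousOn (fun t => (J (y t) t).trace) (Icc 0 1) := by
    simp only [Matrix.trace, Matrix.diag_apply]
    exact continuousOn_finsetSum _ fun i _ => hA i i
  obtain ⟨P, hP0, hP⟩ := exists_fundamental_solution hA
  obtain ⟨a, ha0, ha⟩ := exists_forall_abs_le_of_continuousOn hA
  obtain ⟨K, hK⟩ := hw.taylor
  have hK' : ∀ t ∈ Icc (0 : ℝ) 1, ∀ x ∈ cube d, ∀ y ∈ cube d, ∀ i,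
      |w y t i - w x t i - ∑ j, J x t i j * (y j - x j)| ≤ |K| * ‖y - x‖ ^ 2 :=
    fun t ht x hx y hy i => (hK t ht x hx y hy i).trans (by gcongr; exact le_abs_self K)
  set b := (EuclideanSpace.basisFun (Fin d) ℝ).toBasis
  set D := LinearMap.toContinuousLinearMap (Matrix.toLin b b (P 1)) with hD
  have hDapply : ∀ h i, D h i = ∑ j, P 1 i j * h j := by
    intro h i
    have h1 := Matrix.repr_toLin b b (P 1) h
    have h2 := congrFun h1 i
    simpa [b, hD, Matrix.mulVec, dotProduct] using! h2
  refine ⟨D, ?_, ?_⟩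
  · set C := |K| * Real.exp M ^ 2 * Real.exp (d * a) with hC
    have key : ∀ x' ∈ cube d, ∀ i,
        |flowMap w x' i - flowMap w x i - D (x' - x) i| ≤ C * ‖x' - x‖ ^ 2 := by
      intro x' hx' i
      have hy' := hw.isTrajectory hx'
      set y' := trajectory w x'
      -- The candidate derivative is the fundamental solution P of the variational equation. The
      -- linearisation error e starts at 0 and satisfies e' = J e + r with r quadratic in x' - x, so
      -- Grönwall makes e(1) quadratic as well.
      set e : ℝ → Fin d → ℝ := fun t i =>
        y' t i - y t i - ∑ j, P t i j * (x' j - x j) with he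
      set r : ℝ → Fin d → ℝ := fun t i =>
        w (y' t) t i - w (y t) t i - ∑ j, J (y t) t i j * (y' t j - y t j) with hr
      have hder : ∀ t ∈ Icc (0 : ℝ) 1,
          HasDerivWithinAt e ((J (y t) t).mulVec (e t) + r t) (Icc 0 1) t := by
        intro t ht
        refine hasDerivWithinAt_pi.2 fun i => ?_
        have h1 := ((hasDerivWithinAt_apply (hy'.deriv t ht) i).sub
          (hasDerivWithinAt_apply (hy.deriv t ht) i)).sub
          (HasDerivWithinAt.fun_sum (u := Finset.univ)
            fun j _ => (hP t ht i j).mul_const (x' j - x j))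
        refine h1.congr_deriv ?_
        simp only [Pi.add_apply, Matrix.mulVec, dotProduct, he, hr, Matrix.mul_apply, mul_sub,
          Finset.sum_sub_distrib, Finset.mul_sum, Finset.sum_mul]
        have hswap : ∀ z : EuclideanSpace ℝ (Fin d),
            ∑ j, ∑ k, J (y t) t i k * P t k j * z j =
            ∑ k, ∑ j, J (y t) t i k * (P t k j * z j) := fun z => by
          rw [Finset.sum_comm]; simp only [mul_assoc]
        rw [hswap, hswap]
        ring
      have hrb : ∀ t ∈ Icc (0 : ℝ) 1, ‖r t‖ ≤ |K| * (Real.exp M * ‖x' - x‖) ^ 2 := by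
        intro t ht
        refine (pi_norm_le_iff_of_nonneg (by positivity)).2 fun i => ?_
        refine (hK' t ht _ (hy.mem_cube t ht) _ (hy'.mem_cube t ht) i).trans ?_
        have := hw.dist_trajectories_le_mul hy' hy ht
        rw [dist_eq_norm, dist_eq_norm] at this
        gcongr
      have hg := norm_le_gronwallBound_of_norm_deriv_right_le (f := e) (δ := 0) (K := d * a)
        (ε := |K| * (Real.exp M * ‖x' - x‖) ^ 2)
        (fun t ht => (hder t ht).continuousWithinAt)
        (fun t ht => hasDerivWithinAt_Ici_of_Icc ht (hder t (Ico_subset_Icc_self ht)))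
        (by
          refine le_of_eq (norm_eq_zero.2 (funext fun i => ?_))
          simp [he, hP0, hy.init, hy'.init, Matrix.one_apply])
        (fun t ht => (norm_add_le _ _).trans (add_le_add
          (norm_mulVec_le ha0 (ha t (Ico_subset_Icc_self ht)) _)
          (hrb t (Ico_subset_Icc_self ht)))) 1 (by simp)
      have hg' := hg.trans (gronwallBound_zero_le (by positivity) (by positivity) (by simp))
      have h1 := (norm_le_pi_norm (e 1) i).trans hg'
      rw [Real.norm_eq_abs] at h1
      rw [← trajectory_one, ← trajectory_one, hDapply]
      refine h1.trans (le_of_eq ?_)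
      rw [hC]
      ring
    have hO : (fun x' => flowMap w x' - flowMap w x - D (x' - x)) =O[nhdsWithin x (cube d)]
        fun x' => ‖x' - x‖ ^ 2 := by
      refine Asymptotics.IsBigO.of_bound (√d * C) ?_
      filter_upwards [self_mem_nhdsWithin] with x' hx'
      rw [Real.norm_of_nonneg (by positivity), mul_assoc]
      exact EuclideanSpace.norm_le_sqrt_mul (by positivity) fun i => key x' hx' i
    have h0 := Asymptotics.IsBigO.hasFDerivWithinAt (𝕜 := ℝ) hO hx one_lt_two
    have h1 := (h0.add (D.hasFDerivAt (x := x)).hasFDerivWithinAt).add_const (flowMap w x - D x)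
    rw [zero_add] at h1
    refine h1.congr_of_eventuallyEq (Filter.Eventually.of_forall fun x' => ?_) ?_
    · simp only [Pi.add_apply, map_sub]
      abel
    · simp
  · rw [hD, ContinuousLinearMap.det, LinearMap.coe_toContinuousLinearMap, LinearMap.det_toLin]
    exact det_eq_exp_integral_trace htr hP0 hP

end Flow

end LtI

namespace LtI

/-! ### The density of the push-forward and its uniqueness. -/

section Density

variable {d : ℕ} {w : EuclideanSpace ℝ (Fin d) → ℝ → EuclideanSpace ℝ (Fin d)}
  {J : EuclideanSpace ℝ (Fin d) → ℝ → Matrix (Fin d) (Fin d) ℝ} {M : ℝ≥0}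
  {f g : EuclideanSpace ℝ (Fin d) → ℝ} {ν ρ : Measure (EuclideanSpace ℝ (Fin d))}

theorem IsCubeField.continuousOn_trace (hw : IsCubeField w J M) :
    ContinuousOn (fun p : EuclideanSpace ℝ (Fin d) × ℝ => (J p.1 p.2).trace)
      (cube d ×ˢ Icc 0 1) := by
  simp only [Matrix.trace, Matrix.diag_apply]
  exact continuousOn_finsetSum _ fun i _ => hw.cont_deriv i i

theorem IsCubeField.continuousOn_trace_trajectory (hw : IsCubeField w J M)
    {x : EuclideanSpace ℝ (Fin d)} (hx : x ∈ cube d) :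
    ContinuousOn (fun t => (J (trajectory w x t) t).trace) (Icc 0 1) :=
  hw.continuousOn_trace.comp (f := fun t => (trajectory w x t, t))
    ((hw.isTrajectory hx).continuousOn.prodMk continuousOn_id)
    fun t ht => ⟨(hw.isTrajectory hx).mem_cube t ht, ht⟩

theorem IsCubeField.intervalIntegrable_trace (hw : IsCubeField w J M)
    {x : EuclideanSpace ℝ (Fin d)} (hx : x ∈ cube d) :
    IntervalIntegrable (fun t => (J (trajectory w x t) t).trace) volume 0 1 := by
  refine ContinuousOn.intervalIntegrable ?_
  rw [uIcc_of_le zero_le_one]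
  exact hw.continuousOn_trace_trajectory hx

theorem IsCubeField.continuousOn_integral_trace (hw : IsCubeField w J M) :
    ContinuousOn (fun x => ∫ t in (0 : ℝ)..1, (J (trajectory w x t) t).trace) (cube d) := by
  obtain ⟨B, hB⟩ := (isCompact_cube.prod isCompact_Icc).exists_bound_of_continuousOn
    hw.continuousOn_trace
  intro x hx
  refine intervalIntegral.continuousWithinAt_of_dominated_interval (bound := fun _ => B)
    ?_ ?_ (by simp) ?_
  · filter_upwards [self_mem_nhdsWithin] with x hx
    exact (hw.intervalIntegrable_trace hx).aestronglyMeasurable_restrict_uIoc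
  · filter_upwards [self_mem_nhdsWithin] with x hx
    refine ae_of_all _ fun t ht => ?_
    rw [uIoc_of_le zero_le_one] at ht
    have ht' := Ioc_subset_Icc_self ht
    exact hB (trajectory w x t, t) ⟨(hw.isTrajectory hx).mem_cube t ht', ht'⟩
  · refine ae_of_all _ fun t ht => ?_
    rw [uIoc_of_le zero_le_one] at ht
    have ht' := Ioc_subset_Icc_self ht
    have htraj : ContinuousOn (fun x => trajectory w x t) (cube d) :=
      (LipschitzOnWith.of_dist_le_mul (K := ⟨Real.exp M, (Real.exp_pos _).le⟩)
        fun x hx y hy => hw.dist_trajectories_le_mul (hw.isTrajectory hx) (hw.isTrajectory hy)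
          ht').continuousOn
    exact (hw.continuousOn_trace.comp (f := fun x => (trajectory w x t, t))
      (htraj.prodMk continuousOn_const)
      fun x hx => ⟨(hw.isTrajectory hx).mem_cube t ht', ht'⟩) x hx

theorem IsCubeField.measurable_flowMap (hw : IsCubeField w J M) : Measurable (flowMap w) := by
  classical
  have : flowMap w = (cube d).piecewise (flowMap w) id := by
    ext1 x
    by_cases hx : x ∈ cube d
    · rw [piecewise_eq_of_mem _ _ _ hx]
    · rw [piecewise_eq_of_notMem _ _ _ hx, flowMap_of_notMem hx, id]
  rw [this]
  exact hw.lipschitzOnWith_flowMap.continuousOn.measurable_piecewise continuousOn_id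
    measurableSet_cube

/-- The density `f ∘ Φ · det DΦ` of the push-forward under the inverse of the flow map `Φ`. -/
noncomputable def flowDensity (w : EuclideanSpace ℝ (Fin d) → ℝ → EuclideanSpace ℝ (Fin d))
    (J : EuclideanSpace ℝ (Fin d) → ℝ → Matrix (Fin d) (Fin d) ℝ)
    (f : EuclideanSpace ℝ (Fin d) → ℝ) (x : EuclideanSpace ℝ (Fin d)) : ℝ :=
  f (flowMap w x) * Real.exp (∫ t in (0 : ℝ)..1, (J (trajectory w x t) t).trace)

theorem IsCubeField.isContDensity_map (hw : IsCubeField w J M) (hf : HasDensityOn ν f (cube d))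
    (hfc : ContinuousOn f (cube d)) :
    IsContDensity (ν.map (flowMap w))
      (flowDensity (fun x t => -w x (1 - t)) (fun x t => -J x (1 - t)) f) := by
  have hr := hw.reverse
  set w' : EuclideanSpace ℝ (Fin d) → ℝ → EuclideanSpace ℝ (Fin d) := fun x t => -w x (1 - t)
  set J' : EuclideanSpace ℝ (Fin d) → ℝ → Matrix (Fin d) (Fin d) ℝ := fun x t => -J x (1 - t)
  refine ⟨?_, fun x hx => ?_, ?_⟩
  · refine (hfc.comp hr.lipschitzOnWith_flowMap.continuousOn fun x hx => hr.flowMap_mem hx).mul ?_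
    exact Real.continuous_exp.comp_continuousOn hr.continuousOn_integral_trace
  · exact mul_nonneg (hf.1 _ (hr.flowMap_mem hx)) (Real.exp_pos _).le
  · have hD : ∀ x : EuclideanSpace ℝ (Fin d), ∃ D : EuclideanSpace ℝ (Fin d) →L[ℝ]
        EuclideanSpace ℝ (Fin d), x ∈ cube d → HasFDerivWithinAt (flowMap w') D (cube d) x ∧
        D.det = Real.exp (∫ t in (0 : ℝ)..1, (J' (trajectory w' x t) t).trace) := by
      intro x
      by_cases hx : x ∈ cube d
      · obtain ⟨D, h⟩ := hr.exists_hasFDerivWithinAt_flowMap hx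
        exact ⟨D, fun _ => h⟩
      · exact ⟨0, fun h => absurd h hx⟩
    choose D hD using hD
    ext A hA
    -- Preimages under the flow are images under the reversed flow, so the change of variables
    -- theorem applies to the latter.
    have himage : flowMap w ⁻¹' A ∩ cube d = flowMap w' '' (A ∩ cube d) := by
      ext x
      constructor
      · rintro ⟨h1, h2⟩
        exact ⟨flowMap w x, ⟨h1, hw.flowMap_mem h2⟩, hw.flowMap_reverse_flowMap h2⟩
      · rintro ⟨z, ⟨h1, h2⟩, rfl⟩
        refine ⟨?_, hr.flowMap_mem h2⟩
        rw [mem_preimage, hw.flowMap_flowMap_reverse h2]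
        exact h1
    rw [Measure.map_apply hw.measurable_flowMap hA, withDensity_apply _ hA]
    have hAm := hw.measurable_flowMap hA
    rw [hf.2, withDensity_apply _ hAm, Measure.restrict_restrict hAm, himage,
      Measure.restrict_restrict hA,
      lintegral_image_eq_lintegral_abs_det_fderiv_mul volume (hA.inter measurableSet_cube)
        (f' := D) (fun x hx => (hD x hx.2).1.mono inter_subset_right)]
    · refine setLIntegral_congr_fun (hA.inter measurableSet_cube) fun x hx => ?_
      rw [(hD x hx.2).2, abs_of_pos (Real.exp_pos _), flowDensity,
        mul_comm (f _), ENNReal.ofReal_mul (Real.exp_pos _).le]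
    · intro x hx y hy hxy
      have h := congrArg (flowMap w) hxy
      rwa [hw.flowMap_flowMap_reverse hx.2, hw.flowMap_flowMap_reverse hy.2] at h

/-- Two densities agree almost everywhere on the cube, and continuity extends this to the closure of
its interior. Hence `contDensity` may be computed from any explicit formula. -/
theorem IsContDensity.eqOn [IsFiniteMeasure ρ] (hf : IsContDensity ρ f) (hg : IsContDensity ρ g) :
    EqOn f g (cube d) := by
  have hm : ∀ {f : EuclideanSpace ℝ (Fin d) → ℝ}, IsContDensity ρ f →
      AEMeasurable (fun x => ENNReal.ofReal (f x)) (volume.restrict (cube d)) := fun hf =>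
    (hf.1.aemeasurable measurableSet_cube).ennreal_ofReal
  have heq := hf.2.2.symm.trans hg.2.2
  have hfin : ∫⁻ x, ENNReal.ofReal (f x) ∂(volume.restrict (cube d)) ≠ ∞ := by
    have h := congrArg (fun ρ => ρ univ) hf.2.2
    simp only [withDensity_apply _ MeasurableSet.univ, Measure.restrict_univ] at h
    rw [← h]
    exact measure_ne_top _ _
  rw [withDensity_eq_iff (hm hf) (hm hg) hfin] at heq
  refine Measure.eqOn_of_ae_eq ?_ hf.1 hg.1 cube_subset_closure_interior (μ := volume)
  filter_upwards [heq, ae_restrict_mem measurableSet_cube] with x hx hxc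
  exact (ENNReal.ofReal_eq_ofReal_iff (hf.2.1 x hxc) (hg.2.1 x hxc)).1 hx

theorem isContDensity_contDensity (hf : IsContDensity ρ f) : IsContDensity ρ (contDensity ρ) := by
  have h : ∃ f, IsContDensity ρ f := ⟨f, hf⟩
  unfold contDensity
  rw [dif_pos h]
  exact h.choose_spec

theorem contDensity_eqOn [IsFiniteMeasure ρ] (hf : IsContDensity ρ f) :
    EqOn (contDensity ρ) f (cube d) :=
  (isContDensity_contDensity hf).eqOn hf

end Density

end LtI

namespace LtI

/-! ### Size and Lipschitz bounds for ReQU networks and their derivatives. -/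

section Network

theorem abs_requ_sub_le {p r s : ℝ} (hr : |r| ≤ p) (hs : |s| ≤ p) :
    |requ s - requ r| ≤ 2 * p * |s - r| := by
  unfold requ
  rw [sq_sub_sq, abs_mul]
  have h1 : |max s 0 - max r 0| ≤ |s - r| := abs_max_sub_max_le_abs _ _ _
  have h2 : |max s 0 + max r 0| ≤ 2 * p := by
    rw [abs_of_nonneg (by positivity)]
    linarith [max_le (le_of_abs_le hr) ((abs_nonneg _).trans hr),
      max_le (le_of_abs_le hs) ((abs_nonneg _).trans hr)]
  exact mul_le_mul h2 h1 (abs_nonneg _) ((abs_nonneg _).trans h2)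

/-- The derivative 2 max(·, 0) is 2-Lipschitz, which gives a quadratic remainder with constant 1
across the kink. -/
theorem abs_requ_sub_sub_le (r s : ℝ) :
    |requ s - requ r - 2 * max r 0 * (s - r)| ≤ (s - r) ^ 2 := by
  unfold requ
  rw [abs_le]
  rcases max_cases r 0 with ⟨h1, h1'⟩ | ⟨h1, h1'⟩ <;>
  rcases max_cases s 0 with ⟨h2, h2'⟩ | ⟨h2, h2'⟩ <;>
  rw [h1, h2] <;> constructor <;> nlinarith

theorem continuous_requ : Continuous requ := by unfold requ; fun_prop

theorem abs_sum_mul_le {m W : ℕ} (hm : m ≤ W) {u v : Fin m → ℝ} {p q : ℝ} (hp : 0 ≤ p)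
    (hq : 0 ≤ q) (hu : ∀ k, |u k| ≤ p) (hv : ∀ k, |v k| ≤ q) :
    |∑ k, u k * v k| ≤ W * (p * q) := by
  calc |∑ k, u k * v k| ≤ ∑ k, |u k * v k| := Finset.abs_sum_le_sum_abs _ _
    _ ≤ ∑ _k : Fin m, p * q := Finset.sum_le_sum fun k _ => by
        rw [abs_mul]; exact mul_le_mul (hu k) (hv k) (abs_nonneg _) hp
    _ = m * (p * q) := by simp
    _ ≤ W * (p * q) := by gcongr

/-- The entries of two layers differ by at most `δ`. -/
def Layer.Close {m n : ℕ} (δ : ℝ) (A A' : Layer m n) : Prop :=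
  (∀ i j, |A.1 i j - A'.1 i j| ≤ δ) ∧ ∀ i, |A.2 i - A'.2 i| ≤ δ

/-- The derivative of `requ ∘ A`. -/
noncomputable def Layer.requDeriv {m n : ℕ} (A : Layer m n) (a : Fin m → ℝ) :
    (Fin m → ℝ) →ₗ[ℝ] (Fin n → ℝ) :=
  Matrix.toLin' (Matrix.of fun i k => 2 * max (A.apply a i) 0 * A.1 i k)

theorem Layer.requDeriv_apply {m n : ℕ} (A : Layer m n) (a v : Fin m → ℝ) (i : Fin n) :
    A.requDeriv a v i = 2 * max (A.apply a i) 0 * ∑ k, A.1 i k * v k := by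
  simp [Layer.requDeriv, Matrix.mulVec, dotProduct, Finset.mul_sum, mul_assoc]

/-- Bounds on the values `a`, `a'` and the derivatives `v`, `v'` of a layer at two points at
distance `δ`. -/
structure LayerBound {m : ℕ} (δ b e f : ℝ) (a a' v v' : Fin m → ℝ) : Prop where
  value : ∀ i, |a i| ≤ b
  value' : ∀ i, |a' i| ≤ b
  -- Lipschitz constants are measured relative to b: through a layer b is squared up to a factor,
  -- while e and f only grow by additive terms.
  lip : ∀ i, |a i - a' i| ≤ e * b * δ
  deriv : ∀ i, |v i| ≤ b
  deriv' : ∀ i, |v' i| ≤ b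
  deriv_lip : ∀ i, |v i - v' i| ≤ f * b * δ

variable {m n W : ℕ} {δ b e f : ℝ} {a a' v v' : Fin m → ℝ} {A A' : Layer m n}

theorem Layer.Bounded.abs_weight_le (hA : A.Bounded) (i : Fin n) (k : Fin m) : |A.1 i k| ≤ 1 :=
  abs_le.2 (hA.1 i k)

theorem Layer.Bounded.abs_bias_le (hA : A.Bounded) (i : Fin n) : |A.2 i| ≤ 1 :=
  abs_le.2 (hA.2 i)

theorem one_le_mul_of_one_le (hW : 1 ≤ W) (hb : 1 ≤ b) : 1 ≤ W * b := by
  have : (1 : ℝ) ≤ W := by exact_mod_cast hW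
  nlinarith

theorem Layer.abs_apply_le (hm : m ≤ W) (hW : 1 ≤ W) (hb : 1 ≤ b) (hA : A.Bounded)
    (ha : ∀ i, |a i| ≤ b) (i : Fin n) : |A.apply a i| ≤ 2 * W * b := by
  have h1 := abs_sum_mul_le hm zero_le_one (by linarith) (hA.abs_weight_le i) ha
  have h2 := hA.abs_bias_le i
  have h3 := one_le_mul_of_one_le hW hb
  unfold Layer.apply
  refine (abs_add_le _ _).trans ?_
  linarith

theorem Layer.abs_apply_sub_le (hm : m ≤ W) (hW : 1 ≤ W) (hb : 1 ≤ b) (he : 0 ≤ e) (hδ : 0 ≤ δ)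
    (hA : A.Bounded) (hAA : A.Close δ A') (ha' : ∀ i, |a' i| ≤ b)
    (haa : ∀ i, |a i - a' i| ≤ e * b * δ) (i : Fin n) :
    |A.apply a i - A'.apply a' i| ≤ W * b * (e + 2) * δ := by
  have h1 := abs_sum_mul_le hm zero_le_one (by positivity) (hA.abs_weight_le i) haa
  have h2 := abs_sum_mul_le hm hδ (by linarith) (hAA.1 i) ha'
  have h3 := hAA.2 i
  have h4 := one_le_mul_of_one_le hW hb
  have h5 : A.apply a i - A'.apply a' i = ∑ k, A.1 i k * (a k - a' k) +
      ∑ k, (A.1 i k - A'.1 i k) * a' k + (A.2 i - A'.2 i) := by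
    unfold Layer.apply
    simp only [mul_sub, sub_mul, Finset.sum_sub_distrib]
    ring
  rw [h5]
  refine (abs_add_three _ _ _).trans ?_
  nlinarith

theorem abs_sum_weight_le (hm : m ≤ W) (hb : 0 ≤ b) (hA : A.Bounded) (hv : ∀ i, |v i| ≤ b)
    (i : Fin n) : |∑ k, A.1 i k * v k| ≤ W * b := by
  simpa using abs_sum_mul_le hm zero_le_one hb (hA.abs_weight_le i) hv

theorem abs_sum_weight_sub_le (hm : m ≤ W) (hb : 0 ≤ b) (hf : 0 ≤ f) (hδ : 0 ≤ δ)
    (hA : A.Bounded) (hAA : A.Close δ A') (hv' : ∀ i, |v' i| ≤ b)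
    (hvv : ∀ i, |v i - v' i| ≤ f * b * δ) (i : Fin n) :
    |∑ k, A.1 i k * v k - ∑ k, A'.1 i k * v' k| ≤ W * b * (f + 1) * δ := by
  have h1 := abs_sum_mul_le hm zero_le_one (by positivity) (hA.abs_weight_le i) hvv
  have h2 := abs_sum_mul_le hm hδ hb (hAA.1 i) hv'
  have h3 : ∑ k, A.1 i k * v k - ∑ k, A'.1 i k * v' k = ∑ k, A.1 i k * (v k - v' k) +
      ∑ k, (A.1 i k - A'.1 i k) * v' k := by
    simp only [mul_sub, sub_mul, Finset.sum_sub_distrib]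
    ring
  rw [h3]
  refine (abs_add_le _ _).trans ?_
  linarith

/-- How the bounds propagate through a layer. -/
theorem LayerBound.requ (h : LayerBound δ b e f a a' v v') (hm : m ≤ W) (hW : 1 ≤ W)
    (hb : 1 ≤ b) (he : 0 ≤ e) (hf : 0 ≤ f) (hδ : 0 ≤ δ) (hA : A.Bounded) (hA' : A'.Bounded)
    (hAA : A.Close δ A') :
    LayerBound δ ((2 * W * b) ^ 2) (e + 2) (f + e / 2 + 2)
      (fun i => LtI.requ (A.apply a i)) (fun i => LtI.requ (A'.apply a' i))
      (A.requDeriv a v) (A'.requDeriv a' v') := by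
  have hb0 : 0 ≤ b := by linarith
  have hp := fun i => Layer.abs_apply_le hm hW hb hA h.value i
  have hp' := fun i => Layer.abs_apply_le hm hW hb hA' h.value' i
  have hpp := fun i => Layer.abs_apply_sub_le hm hW hb he hδ hA hAA h.value' h.lip i
  have hs := fun i => abs_sum_weight_le hm hb0 hA h.deriv i
  have hs' := fun i => abs_sum_weight_le hm hb0 hA' h.deriv' i
  have hss := fun i => abs_sum_weight_sub_le hm hb0 hf hδ hA hAA h.deriv' h.deriv_lip i
  have hmax : ∀ {r p : ℝ}, |r| ≤ p → 0 ≤ max r 0 ∧ max r 0 ≤ p := fun h =>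
    ⟨le_max_right _ _, max_le (le_of_abs_le h) ((abs_nonneg _).trans h)⟩
  have hrequ : ∀ {r p : ℝ}, |r| ≤ p → |LtI.requ r| ≤ p ^ 2 := by
    intro r p hr
    unfold LtI.requ
    rw [abs_of_nonneg (by positivity)]
    exact pow_le_pow_left₀ (hmax hr).1 (hmax hr).2 2
  have hder : ∀ {r p s q : ℝ}, |r| ≤ p → |s| ≤ q → |2 * max r 0 * s| ≤ 2 * p * q := by
    intro r p s q hr hs
    rw [abs_mul, abs_of_nonneg (by linarith [(hmax hr).1])]
    exact mul_le_mul (by linarith [(hmax hr).2]) hs (abs_nonneg _)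
      (by linarith [(abs_nonneg _).trans hr])
  refine ⟨fun i => hrequ (hp i), fun i => hrequ (hp' i), fun i => ?_, fun i => ?_, fun i => ?_,
    fun i => ?_⟩
  · refine (abs_requ_sub_le (hp' i) (hp i)).trans ?_
    calc 2 * (2 * W * b) * |A.apply a i - A'.apply a' i|
        ≤ 2 * (2 * W * b) * (W * b * (e + 2) * δ) := by gcongr; exact hpp i
      _ = _ := by ring
  · rw [Layer.requDeriv_apply]
    refine (hder (hp i) (hs i)).trans (le_of_eq (by ring))
  · rw [Layer.requDeriv_apply]
    refine (hder (hp' i) (hs' i)).trans (le_of_eq (by ring))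
  · rw [Layer.requDeriv_apply, Layer.requDeriv_apply]
    set r := A.apply a i
    set r' := A'.apply a' i
    set s := ∑ k, A.1 i k * v k
    set s' := ∑ k, A'.1 i k * v' k
    -- In units of (2Wb)² δ the change of the activation slope contributes e/2 + 1 and the change of
    -- the tangent vector f + 1.
    have h1 : 2 * max r 0 * s - 2 * max r' 0 * s' =
        2 * ((max r 0 - max r' 0) * s) + 2 * max r' 0 * (s - s') := by ring
    rw [h1]
    refine (abs_add_le _ _).trans ?_
    have h2 : |2 * ((max r 0 - max r' 0) * s)| ≤ 2 * (W * b * (e + 2) * δ * (W * b)) := by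
      rw [abs_mul, abs_two, abs_mul]
      have h3 := (abs_max_sub_max_le_abs r r' 0).trans (hpp i)
      exact mul_le_mul_of_nonneg_left (mul_le_mul h3 (hs i) (abs_nonneg _)
        ((abs_nonneg _).trans h3)) zero_le_two
    refine (add_le_add h2 (hder (hp' i) (hss i))).trans (le_of_eq (by ring))

/-- The derivative of a stack of hidden layers. -/
noncomputable def hiddenStackDeriv {W : ℕ} : (m : ℕ) → (Fin m → Layer W W) → (Fin W → ℝ) →
    (Fin W → ℝ) →ₗ[ℝ] (Fin W → ℝ)
  | 0, _, _ => LinearMap.id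
  | m + 1, A, a => (A (Fin.last m)).requDeriv (hiddenStack m (fun l => A l.castSucc) a) ∘ₗ
      hiddenStackDeriv m (fun l => A l.castSucc) a

/-- The bound on the values in the `l`-th hidden layer. -/
noncomputable def layerSize (W l : ℕ) : ℝ := (2 * W : ℝ) ^ (2 ^ (l + 1) - 2)

theorem layerSize_succ (W l : ℕ) : (2 * W * layerSize W l) ^ 2 = layerSize W (l + 1) := by
  unfold layerSize
  have h : 2 ≤ 2 ^ (l + 1) := by
    calc 2 = 2 ^ 1 := rfl
      _ ≤ 2 ^ (l + 1) := Nat.pow_le_pow_right (by norm_num) (by omega)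
  rw [← pow_succ', ← pow_mul]
  congr 1
  rw [pow_succ 2 (l + 1)]
  omega

theorem one_le_layerSize (hW : 1 ≤ W) (l : ℕ) : 1 ≤ layerSize W l := by
  have : (1 : ℝ) ≤ W := by exact_mod_cast hW
  exact one_le_pow₀ (by linarith)

theorem LayerBound.mono {f' : ℝ} (h : LayerBound δ b e f a a' v v') (hb : 0 ≤ b) (hδ : 0 ≤ δ)
    (hf : f ≤ f') : LayerBound δ b e f' a a' v v' :=
  { h with deriv_lip := fun i => (h.deriv_lip i).trans (by gcongr) }

/-- Per layer e grows by 2, and f by e/2 + 2 = l + 5/2 ≤ 6l + 3, the increment of 3l². -/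
theorem LayerBound.hiddenStack {a a' v v' : Fin W → ℝ} (hW : 1 ≤ W) (hδ : 0 ≤ δ) {l : ℕ}
    (h : LayerBound δ (layerSize W l) (1 + 2 * l) (3 * l ^ 2) a a' v v') (m : ℕ) :
    ∀ {A A' : Fin m → Layer W W}, (∀ i, (A i).Bounded) → (∀ i, (A' i).Bounded) →
      (∀ i, (A i).Close δ (A' i)) →
      LayerBound δ (layerSize W (l + m)) (1 + 2 * (l + m : ℕ)) (3 * ((l + m : ℕ) : ℝ) ^ 2)
        (LtI.hiddenStack m A a) (LtI.hiddenStack m A' a')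
        (hiddenStackDeriv m A a v) (hiddenStackDeriv m A' a' v') := by
  induction m with
  | zero => intros; exact h
  | succ m ih =>
    intro A A' hA hA' hAA
    have h1 := ih (fun i => hA i.castSucc) (fun i => hA' i.castSucc) (fun i => hAA i.castSucc)
    have h2 := h1.requ le_rfl hW (one_le_layerSize hW _) (by positivity) (by positivity) hδ
      (hA (Fin.last m)) (hA' (Fin.last m)) (hAA (Fin.last m))
    rw [layerSize_succ] at h2
    have h3 := h2.mono (f' := 3 * ((l + (m + 1) : ℕ) : ℝ) ^ 2)
      (by linarith [one_le_layerSize hW (l + m + 1)]) hδ (by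
        push_cast
        have : (0 : ℝ) ≤ l + m := by positivity
        nlinarith)
    have h4 : (1 : ℝ) + 2 * ((l + m : ℕ) : ℝ) + 2 = 1 + 2 * ((l + (m + 1) : ℕ) : ℝ) := by
      push_cast; ring
    rw [h4] at h3
    exact h3

variable {d L : ℕ}

/-- The derivative of the network in its input. -/
noncomputable def networkDeriv (θ : Params d L W) (z : Fin (d + 1) → ℝ) :
    (Fin (d + 1) → ℝ) →ₗ[ℝ] (Fin d → ℝ) :=
  Matrix.toLin' (Matrix.of θ.2.2.1) ∘ₗ
    hiddenStackDeriv (L - 1) θ.2.1 (fun i => requ (θ.1.apply z i)) ∘ₗ θ.1.requDeriv z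

theorem networkDeriv_apply (θ : Params d L W) (z v : Fin (d + 1) → ℝ) (i : Fin d) :
    networkDeriv θ z v i = ∑ k, θ.2.2.1 i k * hiddenStackDeriv (L - 1) θ.2.1
      (fun i => requ (θ.1.apply z i)) (θ.1.requDeriv z v) k := by
  simp [networkDeriv, Matrix.mulVec, dotProduct]

/-- The entries of two parameters differ by at most `δ`. -/
def Params.Close (δ : ℝ) (θ θ' : Params d L W) : Prop :=
  θ.1.Close δ θ'.1 ∧ (∀ l, (θ.2.1 l).Close δ (θ'.2.1 l)) ∧ θ.2.2.Close δ θ'.2.2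

/-- The derivative bounds of the network. -/
structure NetworkBound (δ b : ℝ) (L : ℕ) {d : ℕ} (a a' v v' : Fin d → ℝ) : Prop where
  value : ∀ i, |a i| ≤ 2 * b
  lip : ∀ i, |a i - a' i| ≤ b * (2 * L + 3) * δ
  deriv : ∀ i, |v i| ≤ b
  deriv_lip : ∀ i, |v i - v' i| ≤ b * (3 * L ^ 2 + 1) * δ

/-- The input has the bounds of index 0 (size 1, e = 1, f = 0). The first layer is treated apart
because of its input width d + 1; it leads to index 1, and the L - 1 remaining ones to index L. -/
theorem LayerBound.stack_requ (hL : 1 ≤ L) (hW : d + 1 ≤ W) (hδ : 0 ≤ δ) {θ θ' : Params d L W}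
    (hθ : θ ∈ paramCube d L W) (hθ' : θ' ∈ paramCube d L W) (hθθ : Params.Close δ θ θ')
    {z z' v v' : Fin (d + 1) → ℝ} (h : LayerBound δ 1 1 0 z z' v v') :
    LayerBound δ (layerSize W L) (1 + 2 * L) (3 * (L : ℝ) ^ 2)
      (LtI.hiddenStack (L - 1) θ.2.1 fun i => LtI.requ (θ.1.apply z i))
      (LtI.hiddenStack (L - 1) θ'.2.1 fun i => LtI.requ (θ'.1.apply z' i))
      (hiddenStackDeriv (L - 1) θ.2.1 (fun i => LtI.requ (θ.1.apply z i)) (θ.1.requDeriv z v))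
      (hiddenStackDeriv (L - 1) θ'.2.1 (fun i => LtI.requ (θ'.1.apply z' i))
        (θ'.1.requDeriv z' v')) := by
  have hW1 : 1 ≤ W := by omega
  have h1 := h.requ hW hW1 le_rfl zero_le_one le_rfl hδ hθ.1 hθ'.1 hθθ.1
  have h2 : LayerBound δ (layerSize W 1) (1 + 2 * (1 : ℕ)) (3 * ((1 : ℕ) : ℝ) ^ 2)
      (fun i => LtI.requ (θ.1.apply z i)) (fun i => LtI.requ (θ'.1.apply z' i))
      (θ.1.requDeriv z v) (θ'.1.requDeriv z' v') := by
    have h3 : ((2 * W * 1 : ℝ)) ^ 2 = layerSize W 1 := by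
      rw [← layerSize_succ]; simp [layerSize]
    rw [h3] at h1
    have h4 := h1.mono (f' := 3 * ((1 : ℕ) : ℝ) ^ 2)
      (by linarith [one_le_layerSize hW1 1]) hδ (by norm_num)
    rwa [show (1 : ℝ) + 2 = 1 + 2 * (1 : ℕ) by norm_num] at h4
  have h5 := h2.hiddenStack hW1 hδ (L - 1) hθ.2.1 hθ'.2.1 hθθ.2.1
  rwa [show 1 + (L - 1) = L by omega] at h5

theorem networkBound (hL : 1 ≤ L) (hW : d + 1 ≤ W) (hδ : 0 ≤ δ) {θ θ' : Params d L W}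
    (hθ : θ ∈ paramCube d L W) (hθ' : θ' ∈ paramCube d L W) (hθθ : Params.Close δ θ θ')
    {z z' v v' : Fin (d + 1) → ℝ} (h : LayerBound δ 1 1 0 z z' v v') :
    NetworkBound δ (W * layerSize W L) L (network θ z) (network θ' z')
      (networkDeriv θ z v) (networkDeriv θ' z' v') := by
  have hW1 : 1 ≤ W := by omega
  have h1 := h.stack_requ hL hW hδ hθ hθ' hθθ
  have hb := one_le_layerSize hW1 L
  have hb0 : 0 ≤ layerSize W L := by linarith
  refine ⟨fun i => ?_, fun i => ?_, fun i => ?_, fun i => ?_⟩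
  · refine (Layer.abs_apply_le le_rfl hW1 hb hθ.2.2 h1.value i).trans (le_of_eq (by ring))
  · refine (Layer.abs_apply_sub_le le_rfl hW1 hb (by positivity) hδ hθ.2.2 hθθ.2.2
      h1.value' h1.lip i).trans (le_of_eq (by ring))
  · rw [networkDeriv_apply]
    exact abs_sum_weight_le le_rfl hb0 hθ.2.2 h1.deriv i
  · rw [networkDeriv_apply, networkDeriv_apply]
    exact abs_sum_weight_sub_le le_rfl hb0 (by positivity) hδ hθ.2.2 hθθ.2.2
      h1.deriv' h1.deriv_lip i

end Network

end LtI

namespace LtI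

/-! ### Quadratic Taylor remainder and continuity of the network. -/

section NetworkTaylor

variable {m n W d L : ℕ} {δ η b e f g : ℝ}

theorem Layer.Close.refl (A : Layer m n) (hη : 0 ≤ η) : A.Close η A :=
  ⟨fun i j => by simpa using hη, fun i => by simpa using hη⟩

theorem Params.Close.refl (θ : Params d L W) (hη : 0 ≤ η) : Params.Close η θ θ :=
  ⟨.refl _ hη, fun _ => .refl _ hη, .refl _ hη⟩

theorem Layer.abs_apply_sub_sub_le (hm : m ≤ W) (hg : 0 ≤ g) {A : Layer m n} (hA : A.Bounded)
    {a a' u : Fin m → ℝ} (hu : ∀ i, |a' i - a i - u i| ≤ g * η ^ 2) (i : Fin n) :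
    |A.apply a' i - A.apply a i - ∑ k, A.1 i k * u k| ≤ W * g * η ^ 2 := by
  have h := abs_sum_mul_le hm zero_le_one (by positivity) (hA.abs_weight_le i) hu
  have h1 : A.apply a' i - A.apply a i - ∑ k, A.1 i k * u k =
      ∑ k, A.1 i k * (a' k - a k - u k) := by
    unfold Layer.apply
    simp only [mul_sub, Finset.sum_sub_distrib]
    ring
  rw [h1]
  exact h.trans (le_of_eq (by ring))

/-- Two sources of error: the remainder of the activation, and its slope times the remainder
inherited from earlier layers. The affine part adds none. -/
theorem Layer.abs_requ_sub_sub_le (hm : m ≤ W) (hW : 1 ≤ W) (hb : 1 ≤ b) (he : 0 ≤ e)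
    (hg : 0 ≤ g) (hη : 0 ≤ η) {A : Layer m n} (hA : A.Bounded) {a a' v v' u : Fin m → ℝ}
    (h : LayerBound η b e f a a' v v') (hu : ∀ i, |a' i - a i - u i| ≤ g * η ^ 2) (i : Fin n) :
    |requ (A.apply a' i) - requ (A.apply a i) - A.requDeriv a u i| ≤
      ((W * b * (e + 2)) ^ 2 + 2 * (2 * W * b) * (W * g)) * η ^ 2 := by
  rw [Layer.requDeriv_apply]
  set r := A.apply a i
  set s := A.apply a' i
  set q := ∑ k, A.1 i k * u k
  have h1 := LtI.abs_requ_sub_sub_le r s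
  have h2 : |r - s| ≤ W * b * (e + 2) * η :=
    Layer.abs_apply_sub_le hm hW hb he hη hA (.refl _ hη) h.value' h.lip i
  have h3 : |s - r - q| ≤ W * g * η ^ 2 := Layer.abs_apply_sub_sub_le hm hg hA hu i
  have h4 : |r| ≤ 2 * W * b := Layer.abs_apply_le hm hW hb hA h.value i
  have h5 : |2 * max r 0 * (s - r - q)| ≤ 2 * (2 * W * b) * (W * g * η ^ 2) := by
    rw [abs_mul, abs_of_nonneg (by positivity)]
    have : max r 0 ≤ 2 * W * b := max_le (le_of_abs_le h4) ((abs_nonneg _).trans h4)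
    gcongr
  have h6 : (s - r) ^ 2 ≤ (W * b * (e + 2) * η) ^ 2 := by
    rw [← sq_abs, abs_sub_comm]
    exact pow_le_pow_left₀ (abs_nonneg _) h2 2
  have h7 : requ s - requ r - 2 * max r 0 * q =
      (requ s - requ r - 2 * max r 0 * (s - r)) + 2 * max r 0 * (s - r - q) := by ring
  rw [h7]
  refine (abs_add_le _ _).trans ((add_le_add (h1.trans h6) h5).trans (le_of_eq (by ring)))

theorem exists_hiddenStack_taylor (hW : 1 ≤ W) (l : ℕ) (hg : 0 ≤ g) (m : ℕ) :
    ∃ K, 0 ≤ K ∧ ∀ A : Fin m → Layer W W, (∀ i, (A i).Bounded) → ∀ (η : ℝ)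
      (a a' v v' u : Fin W → ℝ), 0 ≤ η →
      LayerBound η (layerSize W l) (1 + 2 * l) (3 * (l : ℝ) ^ 2) a a' v v' →
      (∀ i, |a' i - a i - u i| ≤ g * η ^ 2) → ∀ i,
      |hiddenStack m A a' i - hiddenStack m A a i - hiddenStackDeriv m A a u i| ≤ K * η ^ 2 := by
  induction m with
  | zero => exact ⟨g, hg, fun A _ η a a' v v' u _ _ hu => hu⟩
  | succ m ih =>
    obtain ⟨K, hK0, hK⟩ := ih
    have hb := one_le_layerSize hW (l + m)
    refine ⟨(W * layerSize W (l + m) * ((1 + 2 * (l + m : ℕ)) + 2)) ^ 2 +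
      2 * (2 * W * layerSize W (l + m)) * (W * K), by positivity,
      fun A hA η a a' v v' u hη h hu i => ?_⟩
    have h1 := hK _ (fun i => hA i.castSucc) η a a' v v' u hη h hu
    have h2 := h.hiddenStack hW hη m (fun i => hA i.castSucc) (fun i => hA i.castSucc)
      (fun i => .refl _ hη)
    exact Layer.abs_requ_sub_sub_le le_rfl hW hb (by positivity) hK0 hη (hA (Fin.last m)) h2 h1 i

/-- K is left implicit because it only serves the differentiability of the flow and enters no final
constant. -/
theorem exists_network_taylor (hW : d + 1 ≤ W) :
    ∃ K, 0 ≤ K ∧ ∀ θ ∈ paramCube d L W, ∀ (η : ℝ) (z z' : Fin (d + 1) → ℝ), 0 ≤ η →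
      (∀ i, |z i| ≤ 1) → (∀ i, |z' i| ≤ 1) → (∀ i, |z i - z' i| ≤ η) → ∀ i,
      |network θ z' i - network θ z i - networkDeriv θ z (z' - z) i| ≤ K * η ^ 2 := by
  have hW1 : 1 ≤ W := by omega
  set g : ℝ := (W * 1 * (1 + 2)) ^ 2 + 2 * (2 * W * 1) * (W * 0) with hg
  obtain ⟨K, hK0, hK⟩ := exists_hiddenStack_taylor hW1 1 (g := g) (by positivity) (L - 1)
  refine ⟨W * K, by positivity, fun θ hθ η z z' hη hz hz' hzz i => ?_⟩
  -- Only the value and Lipschitz bounds matter here, so the tangent vectors are set to 0.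
  have h0 : LayerBound η 1 1 0 z z' (0 : Fin (d + 1) → ℝ) 0 :=
    ⟨hz, hz', by simpa using hzz, by simp, by simp, by simp⟩
  have h1 : LayerBound η (layerSize W 1) (1 + 2 * (1 : ℕ)) (3 * ((1 : ℕ) : ℝ) ^ 2)
      (fun i => requ (θ.1.apply z i)) (fun i => requ (θ.1.apply z' i))
      (θ.1.requDeriv z 0) (θ.1.requDeriv z' 0) := by
    have h := h0.requ hW hW1 le_rfl zero_le_one le_rfl hη hθ.1 hθ.1 (.refl _ hη)
    have h3 : ((2 * W * 1 : ℝ)) ^ 2 = layerSize W 1 := by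
      rw [← layerSize_succ]; simp [layerSize]
    rw [h3] at h
    have h4 := h.mono (f' := 3 * ((1 : ℕ) : ℝ) ^ 2)
      (by linarith [one_le_layerSize hW1 1]) hη (by norm_num)
    rwa [show (1 : ℝ) + 2 = 1 + 2 * (1 : ℕ) by norm_num] at h4
  have h2 := hK θ.2.1 hθ.2.1 η _ _ _ _ (θ.1.requDeriv z (z' - z)) hη h1
    (Layer.abs_requ_sub_sub_le hW hW1 le_rfl zero_le_one le_rfl hη hθ.1 h0
      (u := z' - z) (by simp))
  rw [networkDeriv_apply]
  exact Layer.abs_apply_sub_sub_le le_rfl hK0 hθ.2.2 h2 i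

theorem continuous_layer_apply (A : Layer m n) : Continuous A.apply := by
  unfold Layer.apply; fun_prop

theorem continuous_hiddenStack (m : ℕ) (A : Fin m → Layer W W) : Continuous (hiddenStack m A) := by
  induction m with
  | zero => exact continuous_id
  | succ m ih =>
    refine continuous_pi fun i => continuous_requ.comp ?_
    exact (continuous_apply i).comp ((continuous_layer_apply _).comp (ih _))

theorem continuous_requDeriv {X : Type*} [TopologicalSpace X] (A : Layer m n)
    {a v : X → Fin m → ℝ} (ha : Continuous a) (hv : Continuous v) :
    Continuous fun x => A.requDeriv (a x) (v x) := by
  refine continuous_pi fun i => ?_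
  simp only [Layer.requDeriv_apply]
  have := (continuous_apply i).comp ((continuous_layer_apply A).comp ha)
  simp only [Function.comp_def] at this
  fun_prop

theorem continuous_hiddenStackDeriv {X : Type*} [TopologicalSpace X] (m : ℕ)
    (A : Fin m → Layer W W) {a v : X → Fin W → ℝ} (ha : Continuous a) (hv : Continuous v) :
    Continuous fun x => hiddenStackDeriv m A (a x) (v x) := by
  induction m with
  | zero => exact hv
  | succ m ih => exact continuous_requDeriv _ ((continuous_hiddenStack _ _).comp ha) (ih _)

theorem continuous_requ_layer (A : Layer m n) : Continuous fun z i => requ (A.apply z i) :=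
  continuous_pi fun i => continuous_requ.comp ((continuous_apply i).comp (continuous_layer_apply A))

theorem continuous_network (θ : Params d L W) : Continuous (network θ) :=
  (continuous_layer_apply _).comp ((continuous_hiddenStack _ _).comp (continuous_requ_layer _))

theorem continuous_networkDeriv (θ : Params d L W) (v : Fin (d + 1) → ℝ) (i : Fin d) :
    Continuous fun z => networkDeriv θ z v i := by
  simp only [networkDeriv_apply]
  have := continuous_hiddenStackDeriv (L - 1) θ.2.1 (continuous_requ_layer θ.1)
    (continuous_requDeriv θ.1 continuous_id (continuous_const (y := v)))
  exact continuous_finsetSum _ fun k _ => continuous_const.mul ((continuous_apply k).comp this)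

end NetworkTaylor

/-! ### The vector field of the model and its divergence. -/

section Field

variable {d L W : ℕ} {δ : ℝ}

/-- The input of the network at `(x, t)`. -/
def netInput (x : EuclideanSpace ℝ (Fin d)) (t : ℝ) : Fin (d + 1) → ℝ :=
  Fin.snoc (α := fun _ => ℝ) (fun j => x j) t

theorem vectorField_apply (θ : Params d L W) (x : EuclideanSpace ℝ (Fin d)) (t : ℝ) (i : Fin d) :
    vectorField θ x t i = network θ (netInput x t) i * (x i * (1 - x i)) := rfl

/-- The spatial derivative of the vector field. -/
noncomputable def fieldDeriv (θ : Params d L W) (x : EuclideanSpace ℝ (Fin d)) (t : ℝ) :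
    Matrix (Fin d) (Fin d) ℝ :=
  Matrix.of fun i j => networkDeriv θ (netInput x t) (Pi.single j.castSucc 1) i *
    (x i * (1 - x i)) + if i = j then network θ (netInput x t) i * (1 - 2 * x i) else 0

theorem abs_netInput_le {x : EuclideanSpace ℝ (Fin d)} (hx : x ∈ cube d) {t : ℝ}
    (ht : t ∈ Icc (0 : ℝ) 1) (i : Fin (d + 1)) : |netInput x t i| ≤ 1 := by
  unfold netInput
  refine Fin.lastCases ?_ (fun j => ?_) i
  · rw [Fin.snoc_last, abs_of_nonneg ht.1]; exact ht.2
  · rw [Fin.snoc_castSucc, abs_of_nonneg (hx j).1]; exact (hx j).2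

theorem abs_netInput_sub_le {x x' : EuclideanSpace ℝ (Fin d)} (hδ : 0 ≤ δ)
    (hxx : ∀ i, |x i - x' i| ≤ δ) (t : ℝ) (i : Fin (d + 1)) :
    |netInput x t i - netInput x' t i| ≤ δ := by
  unfold netInput
  refine Fin.lastCases ?_ (fun j => ?_) i
  · simpa [Fin.snoc_last] using hδ
  · simpa [Fin.snoc_castSucc] using hxx j

theorem continuous_netInput :
    Continuous fun p : EuclideanSpace ℝ (Fin d) × ℝ => netInput p.1 p.2 := by
  refine continuous_pi fun i => ?_
  unfold netInput
  refine Fin.lastCases ?_ (fun j => ?_) i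
  · simpa [Fin.snoc_last] using continuous_snd
  · simp only [Fin.snoc_castSucc]; fun_prop

/-- Both inputs carry the same time, so the last coordinate of their difference vanishes and only
spatial directions remain. -/
theorem networkDeriv_netInput_sub (θ : Params d L W) (z : Fin (d + 1) → ℝ)
    (x y : EuclideanSpace ℝ (Fin d)) (t : ℝ) (i : Fin d) :
    networkDeriv θ z (netInput y t - netInput x t) i =
      ∑ j, networkDeriv θ z (Pi.single j.castSucc 1) i * (y j - x j) := by
  rw [LinearMap.pi_apply_eq_sum_univ, Fin.sum_univ_castSucc]
  simp only [netInput, Pi.sub_apply, Fin.snoc_castSucc, Fin.snoc_last, sub_self, zero_smul,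
    add_zero, Finset.sum_apply, Pi.smul_apply, smul_eq_mul]
  refine Finset.sum_congr rfl fun j _ => ?_
  have h : (fun k => if j.castSucc = k then (1 : ℝ) else 0) = Pi.single j.castSucc 1 :=
    funext fun k => by simp [Pi.single_apply, eq_comm]
  rw [h, mul_comm]

theorem fieldDeriv_sum (θ : Params d L W) (x y : EuclideanSpace ℝ (Fin d)) (t : ℝ) (i : Fin d) :
    ∑ j, fieldDeriv θ x t i j * (y j - x j) =
      networkDeriv θ (netInput x t) (netInput y t - netInput x t) i * (x i * (1 - x i)) +
      network θ (netInput x t) i * (1 - 2 * x i) * (y i - x i) := by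
  rw [networkDeriv_netInput_sub]
  simp only [fieldDeriv, Matrix.of_apply, add_mul, Finset.sum_add_distrib, ite_mul, zero_mul,
    Finset.sum_ite_eq, Finset.mem_univ, if_true, Finset.sum_mul]
  congr 1
  exact Finset.sum_congr rfl fun j _ => by ring

/-- The factor 11 L² is what the divergence needs: (3L² + 1)/4 + 1 + (2L + 3) + 4 ≤ 11 L², with
equality at L = 1. The exponent in Lip₀ splits into that of `layerSize`, one factor 2W, and a
surplus that absorbs 11 L. -/
theorem layerSize_le_lip0 (hd : 1 ≤ d) (hL : 1 ≤ L) (hW : d + 1 ≤ W) :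
    11 * L ^ 2 * (W * layerSize W L) ≤ lip0 d L W := by
  have hL0 : (1 : ℝ) ≤ L := by exact_mod_cast hL
  have hW2 : (2 : ℝ) ≤ W := by exact_mod_cast (by omega : 2 ≤ W)
  have hW4 : (4 : ℝ) ≤ 2 * W := by linarith
  have hpow : 4 ≤ 2 ^ (L + 1) := by
    calc 4 = 2 ^ 2 := rfl
      _ ≤ 2 ^ (L + 1) := Nat.pow_le_pow_right (by norm_num) (by omega)
  have hexp : 2 ^ (L + 2) + 2 * L - 3 = (2 ^ (L + 1) - 2) + 1 + (2 ^ (L + 1) + 2 * L - 2) := by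
    rw [pow_succ 2 (L + 1)]
    omega
  have h1 : (11 : ℝ) * L ≤ 2 * (2 * W) ^ (2 ^ (L + 1) + 2 * L - 2) := by
    have hLpow : (L : ℝ) ≤ 4 ^ L := by exact_mod_cast (Nat.lt_pow_self (by norm_num)).le
    calc (11 : ℝ) * L ≤ 2 * (4 ^ 2 * 4 ^ L) := by nlinarith
      _ = 2 * 4 ^ (2 + L) := by rw [pow_add]
      _ ≤ 2 * (2 * W) ^ (2 + L) := by gcongr
      _ ≤ 2 * (2 * W) ^ (2 ^ (L + 1) + 2 * L - 2) := by
          gcongr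
          · linarith
          · omega
  have hd1 : (1 : ℝ) ≤ (d + 1 : ℝ) ^ (2 ^ L) := one_le_pow₀ (by linarith [(d.cast_nonneg : (0:ℝ) ≤ d)])
  have hb : 0 ≤ layerSize W L := by linarith [one_le_layerSize (by omega : 1 ≤ W) L]
  unfold lip0
  rw [hexp, pow_add, pow_add, pow_one]
  change _ ≤ L * (layerSize W L * (2 * W) * _) * _
  calc (11 : ℝ) * L ^ 2 * (W * layerSize W L) = (L * W * layerSize W L) * (11 * L) := by ring
    _ ≤ (L * W * layerSize W L) * (2 * (2 * W) ^ (2 ^ (L + 1) + 2 * L - 2)) := by gcongr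
    _ = L * (layerSize W L * (2 * W) * (2 * W) ^ (2 ^ (L + 1) + 2 * L - 2)) * 1 := by ring
    _ ≤ _ := by gcongr

variable {θ θ' : Params d L W} {x x' : EuclideanSpace ℝ (Fin d)} {t : ℝ}

theorem networkBound_netInput (hL : 1 ≤ L) (hW : d + 1 ≤ W) (hδ : 0 ≤ δ)
    (hθ : θ ∈ paramCube d L W) (hθ' : θ' ∈ paramCube d L W) (hθθ : Params.Close δ θ θ')
    (hx : x ∈ cube d) (hx' : x' ∈ cube d) (hxx : ∀ i, |x i - x' i| ≤ δ)
    (ht : t ∈ Icc (0 : ℝ) 1) (j : Fin d) :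
    NetworkBound δ (W * layerSize W L) L (network θ (netInput x t)) (network θ' (netInput x' t))
      (networkDeriv θ (netInput x t) (Pi.single j.castSucc 1))
      (networkDeriv θ' (netInput x' t) (Pi.single j.castSucc 1)) := by
  have hs : ∀ i, |(Pi.single j.castSucc 1 : Fin (d + 1) → ℝ) i| ≤ 1 := fun i => by
    rw [Pi.single_apply]; split_ifs <;> simp
  exact networkBound hL hW hδ hθ hθ' hθθ ⟨abs_netInput_le hx ht, abs_netInput_le hx' ht,
    fun i => by simpa using abs_netInput_sub_le hδ hxx t i, hs, hs, by simp⟩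

theorem mul_one_sub_bounds {s : ℝ} (hs : s ∈ Icc (0 : ℝ) 1) : |s * (1 - s)| ≤ 1 / 4 := by
  rw [abs_of_nonneg (mul_nonneg hs.1 (by linarith [hs.2]))]
  nlinarith [sq_nonneg (s - 1 / 2)]

theorem abs_mul_one_sub_sub_le {r s : ℝ} (hr : r ∈ Icc (0 : ℝ) 1) (hs : s ∈ Icc (0 : ℝ) 1) :
    |r * (1 - r) - s * (1 - s)| ≤ |r - s| := by
  have h : r * (1 - r) - s * (1 - s) = (r - s) * (1 - r - s) := by ring
  rw [h, abs_mul]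
  refine mul_le_of_le_one_right (abs_nonneg _) (abs_le.2 ⟨?_, ?_⟩) <;>
    linarith [hr.1, hr.2, hs.1, hs.2]

theorem abs_mul_sub_mul_le {p p' s s' P S p₁ s₁ : ℝ} (hp : |p - p'| ≤ p₁) (hs : |s| ≤ S)
    (hp' : |p'| ≤ P) (hss : |s - s'| ≤ s₁) : |p * s - p' * s'| ≤ p₁ * S + P * s₁ := by
  have h : p * s - p' * s' = (p - p') * s + p' * (s - s') := by ring
  rw [h]
  refine (abs_add_le _ _).trans (add_le_add ?_ ?_) <;> rw [abs_mul]
  · exact mul_le_mul hp hs (abs_nonneg _) ((abs_nonneg _).trans hp)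
  · exact mul_le_mul hp' hss (abs_nonneg _) ((abs_nonneg _).trans hp')

/-- The vector field is Lipschitz in the position and the parameter. -/
theorem abs_vectorField_sub_le (hd : 1 ≤ d) (hL : 1 ≤ L) (hW : d + 1 ≤ W) (hδ : 0 ≤ δ)
    (hθ : θ ∈ paramCube d L W) (hθ' : θ' ∈ paramCube d L W) (hθθ : Params.Close δ θ θ')
    (hx : x ∈ cube d) (hx' : x' ∈ cube d) (hxx : ∀ i, |x i - x' i| ≤ δ)
    (ht : t ∈ Icc (0 : ℝ) 1) (i : Fin d) :
    |vectorField θ x t i - vectorField θ' x' t i| ≤ lip0 d L W * δ := by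
  have hb := networkBound_netInput hL hW hδ hθ hθ' hθθ hx hx' hxx ht i
  -- `NetworkBound` bounds values only at its first point; this second instance supplies them at the
  -- primed one.
  have hb' := networkBound_netInput hL hW hδ hθ' hθ' (.refl _ hδ) hx' hx'
    (fun i => by simpa using hδ) ht i
  rw [vectorField_apply, vectorField_apply]
  have h := abs_mul_sub_mul_le (hb.lip i) (mul_one_sub_bounds (hx i)) (hb'.value i)
    ((abs_mul_one_sub_sub_le (hx i) (hx' i)).trans (hxx i))
  refine h.trans ?_
  have hlip := layerSize_le_lip0 hd hL hW
  have hL0 : (1 : ℝ) ≤ L := by exact_mod_cast hL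
  have hs : 0 ≤ W * layerSize W L := by
    have := one_le_layerSize (by omega : 1 ≤ W) L
    positivity
  have h2 : W * layerSize W L * ((2 * L + 3) / 4 + 2) ≤ W * layerSize W L * (11 * L ^ 2) := by
    gcongr
    nlinarith
  calc _ = W * layerSize W L * ((2 * L + 3) / 4 + 2) * δ := by ring
    _ ≤ lip0 d L W * δ := by gcongr; linarith

theorem fieldDeriv_diag (θ : Params d L W) (x : EuclideanSpace ℝ (Fin d)) (t : ℝ) (i : Fin d) :
    fieldDeriv θ x t i i = networkDeriv θ (netInput x t) (Pi.single i.castSucc 1) i *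
      (x i * (1 - x i)) + network θ (netInput x t) i * (1 - 2 * x i) := by
  simp [fieldDeriv]

theorem abs_one_sub_two_mul_le {s : ℝ} (hs : s ∈ Icc (0 : ℝ) 1) : |1 - 2 * s| ≤ 1 :=
  abs_le.2 ⟨by linarith [hs.2], by linarith [hs.1]⟩

theorem abs_trace_fieldDeriv_le (hd : 1 ≤ d) (hL : 1 ≤ L) (hW : d + 1 ≤ W)
    (hθ : θ ∈ paramCube d L W) (hx : x ∈ cube d) (ht : t ∈ Icc (0 : ℝ) 1) :
    |(fieldDeriv θ x t).trace| ≤ d * lip0 d L W := by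
  have hlip := layerSize_le_lip0 hd hL hW
  have hL0 : (1 : ℝ) ≤ L := by exact_mod_cast hL
  have hs : 0 ≤ W * layerSize W L := by
    have := one_le_layerSize (by omega : 1 ≤ W) L
    positivity
  have hi : ∀ i, |fieldDeriv θ x t i i| ≤ lip0 d L W := by
    intro i
    have hb := networkBound_netInput hL hW le_rfl hθ hθ (.refl _ le_rfl) hx hx
      (fun i => by simp) ht i
    rw [fieldDeriv_diag]
    refine (abs_add_le _ _).trans ?_
    have h1 := mul_le_mul (hb.deriv i) (mul_one_sub_bounds (hx i)) (abs_nonneg _) hs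
    have h2 := mul_le_mul (hb.value i) (abs_one_sub_two_mul_le (hx i)) (abs_nonneg _)
      ((abs_nonneg _).trans (hb.value i))
    rw [← abs_mul] at h1 h2
    have h4 : W * layerSize W L * (1 / 4 + 2) ≤ W * layerSize W L * (11 * L ^ 2) := by
      gcongr
      nlinarith
    linarith
  calc |(fieldDeriv θ x t).trace| ≤ ∑ i, |fieldDeriv θ x t i i| := Finset.abs_sum_le_sum_abs _ _
    _ ≤ ∑ _i : Fin d, lip0 d L W := Finset.sum_le_sum fun i _ => hi i
    _ = d * lip0 d L W := by simp

/-- The divergence is Lipschitz in the position and the parameter. -/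
theorem abs_trace_fieldDeriv_sub_le (hd : 1 ≤ d) (hL : 1 ≤ L) (hW : d + 1 ≤ W) (hδ : 0 ≤ δ)
    (hθ : θ ∈ paramCube d L W) (hθ' : θ' ∈ paramCube d L W) (hθθ : Params.Close δ θ θ')
    (hx : x ∈ cube d) (hx' : x' ∈ cube d) (hxx : ∀ i, |x i - x' i| ≤ δ)
    (ht : t ∈ Icc (0 : ℝ) 1) :
    |(fieldDeriv θ x t).trace - (fieldDeriv θ' x' t).trace| ≤ d * (lip0 d L W * δ) := by
  have hlip := layerSize_le_lip0 hd hL hW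
  have hL0 : (1 : ℝ) ≤ L := by exact_mod_cast hL
  have hs : 0 ≤ W * layerSize W L := by
    have := one_le_layerSize (by omega : 1 ≤ W) L
    positivity
  have hi : ∀ i, |fieldDeriv θ x t i i - fieldDeriv θ' x' t i i| ≤ lip0 d L W * δ := by
    intro i
    have hb := networkBound_netInput hL hW hδ hθ hθ' hθθ hx hx' hxx ht i
    have hb' := networkBound_netInput hL hW hδ hθ' hθ' (.refl _ hδ) hx' hx'
      (fun i => by simpa using hδ) ht i
    rw [fieldDeriv_diag, fieldDeriv_diag, add_sub_add_comm]
    refine (abs_add_le _ _).trans ?_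
    have h1 := abs_mul_sub_mul_le (hb.deriv_lip i) (mul_one_sub_bounds (hx i)) (hb'.deriv i)
      ((abs_mul_one_sub_sub_le (hx i) (hx' i)).trans (hxx i))
    have h3 : |(1 - 2 * x i) - (1 - 2 * x' i)| ≤ 2 * δ := by
      rw [show (1 - 2 * x i) - (1 - 2 * x' i) = -(2 * (x i - x' i)) by ring, abs_neg, abs_mul,
        abs_two]
      linarith [hxx i]
    have h2 := abs_mul_sub_mul_le (hb.lip i) (abs_one_sub_two_mul_le (hx i)) (hb'.value i) h3
    have h4 : W * layerSize W L * ((3 * L ^ 2 + 1) / 4 + 1 + (2 * L + 3) + 4) ≤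
        W * layerSize W L * (11 * L ^ 2) := by
      gcongr
      nlinarith
    calc _ ≤ W * layerSize W L * ((3 * L ^ 2 + 1) / 4 + 1 + (2 * L + 3) + 4) * δ := by linarith
      _ ≤ lip0 d L W * δ := by gcongr; linarith
  calc |(fieldDeriv θ x t).trace - (fieldDeriv θ' x' t).trace|
      = |∑ i, (fieldDeriv θ x t i i - fieldDeriv θ' x' t i i)| := by
        rw [Finset.sum_sub_distrib]; rfl
    _ ≤ ∑ i, |fieldDeriv θ x t i i - fieldDeriv θ' x' t i i| := Finset.abs_sum_le_sum_abs _ _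
    _ ≤ ∑ _i : Fin d, lip0 d L W * δ := Finset.sum_le_sum fun i _ => hi i
    _ = _ := by simp

theorem lip0_nonneg : 0 ≤ lip0 d L W := by unfold lip0; positivity

theorem norm_vectorField_sub_le (hd : 1 ≤ d) (hL : 1 ≤ L) (hW : d + 1 ≤ W) (hδ : 0 ≤ δ)
    (hθ : θ ∈ paramCube d L W) (hθ' : θ' ∈ paramCube d L W) (hθθ : Params.Close δ θ θ')
    (hx : x ∈ cube d) (hx' : x' ∈ cube d) (hxx : ∀ i, |x i - x' i| ≤ δ)
    (ht : t ∈ Icc (0 : ℝ) 1) :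
    ‖vectorField θ x t - vectorField θ' x' t‖ ≤ √d * (lip0 d L W * δ) :=
  EuclideanSpace.norm_le_sqrt_mul (mul_nonneg lip0_nonneg hδ)
    fun i => abs_vectorField_sub_le hd hL hW hδ hθ hθ' hθθ hx hx' hxx ht i

/-- The Lipschitz constant of the vector field in the Euclidean norm. -/
noncomputable def fieldLip (d L W : ℕ) : ℝ≥0 := ⟨√d * lip0 d L W, by
  have := lip0_nonneg (d := d) (L := L) (W := W); positivity⟩

theorem isCubeField_vectorField (hd : 1 ≤ d) (hL : 1 ≤ L) (hW : d + 1 ≤ W)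
    (hθ : θ ∈ paramCube d L W) :
    IsCubeField (vectorField θ) (fieldDeriv θ) (fieldLip d L W) where
  cont := by
    have h : Continuous (Function.uncurry (vectorField θ)) := by
      unfold Function.uncurry vectorField
      refine (PiLp.continuous_toLp 2 _).comp (continuous_pi fun i => ?_)
      have h1 := (continuous_apply i).comp ((continuous_network θ).comp continuous_netInput)
      exact h1.mul (by fun_prop)
    exact h.continuousOn
  cont_deriv i j := by
    refine Continuous.continuousOn ?_
    have h1 := (continuous_networkDeriv θ (Pi.single j.castSucc 1) i).comp continuous_netInput
    have h2 := (continuous_apply i).comp ((continuous_network θ).comp continuous_netInput)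
    simp only [fieldDeriv, Matrix.of_apply]
    refine (h1.mul (by fun_prop)).add ?_
    split_ifs
    · exact h2.mul (by fun_prop)
    · exact continuous_const
  lip t ht := LipschitzOnWith.of_dist_le_mul fun x hx y hy => by
    rw [dist_eq_norm, dist_eq_norm]
    refine (norm_vectorField_sub_le hd hL hW (norm_nonneg (x - y)) hθ hθ
      (.refl _ (norm_nonneg _)) hx hy (fun i => EuclideanSpace.abs_apply_le_norm (x - y) i)
      ht).trans (le_of_eq ?_)
    change _ = √d * lip0 d L W * _
    ring
  taylor := by
    obtain ⟨K, hK0, hK⟩ := exists_network_taylor (d := d) (L := L) hW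
    refine ⟨K * (1 / 4) + W * layerSize W L * (2 * L + 3) + 2 * (W * layerSize W L), fun t ht x hx y hy i => ?_⟩
    set η := ‖y - x‖ with hηdef
    have hη : 0 ≤ η := norm_nonneg _
    have hyx : ∀ i, |y i - x i| ≤ η := fun i => EuclideanSpace.abs_apply_le_norm (y - x) i
    have hxy : ∀ i, |x i - y i| ≤ η := fun i => by rw [abs_sub_comm]; exact hyx i
    have h1 := hK θ hθ η _ _ hη (abs_netInput_le hx ht) (abs_netInput_le hy ht)
      (abs_netInput_sub_le hη hxy t) i
    have hB := networkBound_netInput hL hW hη hθ hθ (.refl _ hη) hx hy hxy ht i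
    have h2 := hB.lip i
    have h3 := hB.value i
    rw [vectorField_apply, vectorField_apply, fieldDeriv_sum]
    set N := network θ (netInput x t) i
    set N' := network θ (netInput y t) i
    set D := networkDeriv θ (netInput x t) (netInput y t - netInput x t) i
    -- Product rule with remainder: the Taylor error of the network, a product of two first-order
    -- differences, and the exact quadratic error of s(1 - s).
    have heq : N' * (y i * (1 - y i)) - N * (x i * (1 - x i)) -
        (D * (x i * (1 - x i)) + N * (1 - 2 * x i) * (y i - x i)) =
        (N' - N - D) * (x i * (1 - x i)) + (N' - N) * (y i * (1 - y i) - x i * (1 - x i)) +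
        -(N * ((y i - x i) * (y i - x i))) := by ring
    rw [heq]
    refine (abs_add_three _ _ _).trans ?_
    have h4 := (abs_mul_one_sub_sub_le (hy i) (hx i)).trans (hyx i)
    have e1 := mul_le_mul h1 (mul_one_sub_bounds (hx i)) (abs_nonneg _) (by positivity)
    have e2 := mul_le_mul h2 h4 (abs_nonneg _) ((abs_nonneg _).trans h2)
    have e3 := mul_le_mul h3 (mul_le_mul (hyx i) (hyx i) (abs_nonneg _) hη)
      (by positivity) ((abs_nonneg _).trans h3)
    rw [abs_sub_comm, ← abs_mul] at e2
    rw [← abs_mul] at e1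
    rw [← abs_mul, ← abs_mul] at e3
    rw [abs_neg]
    linarith
  tangent t ht x hx i h := by
    rw [vectorField_apply]
    rcases h with h | h <;> simp [h]

end Field

end LtI

namespace LtI

/-! ### Oscillation and stability of the log-density of a flow. -/

section LogDensity

variable {d : ℕ} {w : EuclideanSpace ℝ (Fin d) → ℝ → EuclideanSpace ℝ (Fin d)}
  {J : EuclideanSpace ℝ (Fin d) → ℝ → Matrix (Fin d) (Fin d) ℝ} {M : ℝ≥0}
  {f : EuclideanSpace ℝ (Fin d) → ℝ}

/-- The logarithm of the flow density, extended from the cube to the whole space by clamping. -/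
noncomputable def logFlowDensity (w : EuclideanSpace ℝ (Fin d) → ℝ → EuclideanSpace ℝ (Fin d))
    (J : EuclideanSpace ℝ (Fin d) → ℝ → Matrix (Fin d) (Fin d) ℝ)
    (f : EuclideanSpace ℝ (Fin d) → ℝ) (y : EuclideanSpace ℝ (Fin d)) : ℝ :=
  Real.log (f (flowMap w (cubeClamp y))) +
    ∫ t in (0 : ℝ)..1, (J (trajectory w (cubeClamp y) t) t).trace

theorem IsCubeField.flowDensity_pos (hw : IsCubeField w J M) (hf : ∀ x ∈ cube d, 0 < f x)
    {y : EuclideanSpace ℝ (Fin d)} (hy : y ∈ cube d) : 0 < flowDensity w J f y :=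
  mul_pos (hf _ (hw.flowMap_mem hy)) (Real.exp_pos _)

theorem IsCubeField.log_flowDensity (hw : IsCubeField w J M) (hf : ∀ x ∈ cube d, 0 < f x)
    {y : EuclideanSpace ℝ (Fin d)} (hy : y ∈ cube d) :
    Real.log (flowDensity w J f y) = logFlowDensity w J f y := by
  rw [flowDensity, logFlowDensity, cubeClamp_of_mem hy,
    Real.log_mul (hf _ (hw.flowMap_mem hy)).ne' (Real.exp_pos _).ne', Real.log_exp]

theorem IsCubeField.continuous_logFlowDensity (hw : IsCubeField w J M)
    (hf : ∀ x ∈ cube d, 0 < f x) (hfc : ContinuousOn f (cube d)) :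
    Continuous (logFlowDensity w J f) := by
  have hclamp : Continuous (cubeClamp (d := d)) := lipschitzWith_cubeClamp.continuous
  have h1 : Continuous fun y => flowMap w (cubeClamp y) :=
    hw.lipschitzOnWith_flowMap.continuousOn.comp_continuous hclamp cubeClamp_mem
  have h2 : Continuous fun y => f (flowMap w (cubeClamp y)) :=
    hfc.comp_continuous h1 fun y => hw.flowMap_mem (cubeClamp_mem y)
  exact (h2.log fun y => (hf _ (hw.flowMap_mem (cubeClamp_mem y))).ne').add
    (hw.continuousOn_integral_trace.comp_continuous hclamp cubeClamp_mem)

theorem abs_log_sub_log_le {κ a b : ℝ} (hκ : 0 < κ) (ha : κ ≤ a) (hb : κ ≤ b) :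
    |Real.log a - Real.log b| ≤ |a - b| / κ := by
  have key : ∀ {a b : ℝ}, κ ≤ a → κ ≤ b → Real.log a - Real.log b ≤ |a - b| / κ := by
    intro a b ha hb
    have hb0 : 0 < b := hκ.trans_le hb
    rw [← Real.log_div (hκ.trans_le ha).ne' hb0.ne']
    calc Real.log (a / b) ≤ a / b - 1 := Real.log_le_sub_one_of_pos (div_pos (hκ.trans_le ha) hb0)
      _ = (a - b) / b := by field_simp
      _ ≤ |a - b| / b := by gcongr; exact le_abs_self _
      _ ≤ |a - b| / κ := by gcongr
  refine abs_le.2 ⟨?_, key ha hb⟩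
  have := key hb ha
  rw [abs_sub_comm] at this
  linarith

theorem abs_log_comp_sub_le {κ : ℝ} (hκ : 0 < κ) {l : ℝ≥0} (hl : LipschitzOnWith l f (cube d))
    (hf : ∀ x ∈ cube d, κ ≤ f x) {x y : EuclideanSpace ℝ (Fin d)} (hx : x ∈ cube d)
    (hy : y ∈ cube d) : |Real.log (f x) - Real.log (f y)| ≤ l / κ * dist x y := by
  refine (abs_log_sub_log_le hκ (hf x hx) (hf y hy)).trans ?_
  rw [div_mul_eq_mul_div]
  gcongr
  exact hl.dist_le_mul x hx y hy

/-- On the cube, of diameter √d, the function log f is (l/κ)-Lipschitz; each of the two divergence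
integrals is at most T. -/
theorem IsCubeField.abs_logFlowDensity_sub_le (hw : IsCubeField w J M) {κ T : ℝ} (hκ : 0 < κ)
    {l : ℝ≥0} (hl : LipschitzOnWith l f (cube d)) (hf : ∀ x ∈ cube d, κ ≤ f x)
    (hT : ∀ x ∈ cube d, ∀ t ∈ Icc (0 : ℝ) 1, |(J x t).trace| ≤ T)
    (y z : EuclideanSpace ℝ (Fin d)) :
    |logFlowDensity w J f y - logFlowDensity w J f z| ≤ l / κ * √d + 2 * T := by
  have hI : ∀ y, |∫ t in (0 : ℝ)..1, (J (trajectory w (cubeClamp y) t) t).trace| ≤ T := by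
    intro y
    have h := intervalIntegral.norm_integral_le_of_norm_le_const (a := 0) (b := 1)
      (C := T) (f := fun t => (J (trajectory w (cubeClamp y) t) t).trace) fun t ht => by
        rw [uIoc_of_le zero_le_one] at ht
        have ht' : t ∈ Icc (0 : ℝ) 1 := ⟨ht.1.le, ht.2⟩
        exact hT _ ((hw.isTrajectory (cubeClamp_mem y)).mem_cube t ht') t ht'
    simpa using h
  have h1 := abs_log_comp_sub_le hκ hl hf (hw.flowMap_mem (cubeClamp_mem y))
    (hw.flowMap_mem (cubeClamp_mem z))
  have h2 : (l : ℝ) / κ * dist (flowMap w (cubeClamp y)) (flowMap w (cubeClamp z)) ≤ l / κ * √d := by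
    gcongr
    exact dist_le_of_mem_cube (hw.flowMap_mem (cubeClamp_mem y)) (hw.flowMap_mem (cubeClamp_mem z))
  have h3 := abs_le.1 (hI y)
  have h4 := abs_le.1 (hI z)
  have h5 := abs_le.1 (h1.trans h2)
  unfold logFlowDensity
  exact abs_le.2 ⟨by linarith [h5.1, h3.1, h4.2], by linarith [h5.2, h3.2, h4.1]⟩

/-- By Grönwall the trajectories of the two fields from the same point stay within η exp M. This
displacement moves the argument of log f, and T measures its effect on the divergence together with
the change of field. -/
theorem IsCubeField.abs_logFlowDensity_sub_field_le
    {w' : EuclideanSpace ℝ (Fin d) → ℝ → EuclideanSpace ℝ (Fin d)}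
    {J' : EuclideanSpace ℝ (Fin d) → ℝ → Matrix (Fin d) (Fin d) ℝ} {M' : ℝ≥0}
    (hw : IsCubeField w J M) (hw' : IsCubeField w' J' M') {κ η T : ℝ} (hκ : 0 < κ)
    {l : ℝ≥0} (hl : LipschitzOnWith l f (cube d)) (hf : ∀ x ∈ cube d, κ ≤ f x) (hη : 0 ≤ η)
    (hww : ∀ t ∈ Icc (0 : ℝ) 1, ∀ x ∈ cube d, ‖w' x t - w x t‖ ≤ η)
    (hT : ∀ t ∈ Icc (0 : ℝ) 1, ∀ x ∈ cube d, ∀ x' ∈ cube d, dist x' x ≤ η * Real.exp M →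
      |(J' x' t).trace - (J x t).trace| ≤ T)
    (y : EuclideanSpace ℝ (Fin d)) :
    |logFlowDensity w' J' f y - logFlowDensity w J f y| ≤ l / κ * (η * Real.exp M) + T := by
  have hc := cubeClamp_mem y
  have hd : ∀ {t : ℝ}, t ∈ Icc (0 : ℝ) 1 →
      dist (trajectory w' (cubeClamp y) t) (trajectory w (cubeClamp y) t) ≤ η * Real.exp M :=
    fun ht => hw.dist_trajectories_le hη hww (hw.isTrajectory hc) (hw'.isTrajectory hc) ht
  have h1 : |Real.log (f (flowMap w' (cubeClamp y))) - Real.log (f (flowMap w (cubeClamp y)))| ≤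
      l / κ * (η * Real.exp M) := by
    refine (abs_log_comp_sub_le hκ hl hf (hw'.flowMap_mem hc) (hw.flowMap_mem hc)).trans ?_
    rw [← trajectory_one, ← trajectory_one]
    gcongr
    exact hd ⟨zero_le_one, le_rfl⟩
  have h2 : |(∫ t in (0 : ℝ)..1, (J' (trajectory w' (cubeClamp y) t) t).trace) -
      ∫ t in (0 : ℝ)..1, (J (trajectory w (cubeClamp y) t) t).trace| ≤ T := by
    rw [← intervalIntegral.integral_sub (hw'.intervalIntegrable_trace hc)
      (hw.intervalIntegrable_trace hc)]
    have h := intervalIntegral.norm_integral_le_of_norm_le_const (a := 0) (b := 1) (C := T)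
      (f := fun t => (J' (trajectory w' (cubeClamp y) t) t).trace -
        (J (trajectory w (cubeClamp y) t) t).trace) fun t ht => by
        rw [uIoc_of_le zero_le_one] at ht
        have ht' : t ∈ Icc (0 : ℝ) 1 := ⟨ht.1.le, ht.2⟩
        exact hT t ht' _ ((hw.isTrajectory hc).mem_cube t ht') _
          ((hw'.isTrajectory hc).mem_cube t ht') (hd ht')
    simpa using h
  unfold logFlowDensity
  rw [add_sub_add_comm]
  exact (abs_add_le _ _).trans (add_le_add h1 h2)

end LogDensity

/-! ### Network parameters as points of a cube over a finite index set. -/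

section Flatten

variable {d L W : ℕ} {δ : ℝ}

/-- The index set of the entries of a layer. -/
abbrev LayerIndex (m n : ℕ) : Type := (Fin n × Fin m) ⊕ Fin n

/-- The index set of the entries of all layers of a network. -/
abbrev ParamIndex (d L W : ℕ) : Type :=
  LayerIndex (d + 1) W ⊕ (Fin (L - 1) × LayerIndex W W) ⊕ LayerIndex W d

/-- The layer with the given entries. -/
def Layer.ofEntries {m n : ℕ} (v : LayerIndex m n → ℝ) : Layer m n :=
  (fun i j => v (.inl (i, j)), fun i => v (.inr i))

/-- The network parameters with the given entries. -/
def Params.ofEntries (v : ParamIndex d L W → ℝ) : Params d L W :=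
  (Layer.ofEntries fun i => v (.inl i), fun l => Layer.ofEntries fun i => v (.inr (.inl (l, i))),
    Layer.ofEntries fun i => v (.inr (.inr i)))

theorem card_paramIndex : Fintype.card (ParamIndex d L W) = numParams d L W := by
  simp only [Fintype.card_sum, Fintype.card_prod, Fintype.card_fin, numParams]
  ring

theorem Params.ofEntries_mem {v : ParamIndex d L W → ℝ} (hv : ∀ i, |v i| ≤ 1) :
    ofEntries v ∈ paramCube d L W :=
  ⟨⟨fun _ _ => abs_le.1 (hv _), fun _ => abs_le.1 (hv _)⟩,
    fun _ => ⟨fun _ _ => abs_le.1 (hv _), fun _ => abs_le.1 (hv _)⟩,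
    ⟨fun _ _ => abs_le.1 (hv _), fun _ => abs_le.1 (hv _)⟩⟩

theorem Params.exists_ofEntries_eq {θ : Params d L W} (hθ : θ ∈ paramCube d L W) :
    ∃ v : ParamIndex d L W → ℝ, (∀ i, |v i| ≤ 1) ∧ ofEntries v = θ := by
  refine ⟨Sum.elim (Sum.elim (fun p => θ.1.1 p.1 p.2) θ.1.2)
    (Sum.elim (fun p => Sum.elim (fun r => (θ.2.1 p.1).1 r.1 r.2) (θ.2.1 p.1).2 p.2)
      (Sum.elim (fun p => θ.2.2.1 p.1 p.2) θ.2.2.2)), ?_, rfl⟩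
  rintro ((⟨i, j⟩ | i) | ⟨l, (⟨i, j⟩ | i)⟩ | (⟨i, j⟩ | i))
  · exact abs_le.2 (hθ.1.1 i j)
  · exact abs_le.2 (hθ.1.2 i)
  · exact abs_le.2 ((hθ.2.1 l).1 i j)
  · exact abs_le.2 ((hθ.2.1 l).2 i)
  · exact abs_le.2 (hθ.2.2.1 i j)
  · exact abs_le.2 (hθ.2.2.2 i)

theorem Params.close_ofEntries {v v' : ParamIndex d L W → ℝ} (h : ∀ i, |v i - v' i| ≤ δ) :
    Params.Close δ (ofEntries v) (ofEntries v') :=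
  ⟨⟨fun _ _ => h _, fun _ => h _⟩, fun _ => ⟨fun _ _ => h _, fun _ => h _⟩,
    ⟨fun _ _ => h _, fun _ => h _⟩⟩

theorem Params.Close.mono {δ' : ℝ} {θ θ' : Params d L W} (h : Params.Close δ θ θ') (hδ : δ ≤ δ') :
    Params.Close δ' θ θ' :=
  ⟨⟨fun i j => (h.1.1 i j).trans hδ, fun i => (h.1.2 i).trans hδ⟩,
    fun l => ⟨fun i j => ((h.2.1 l).1 i j).trans hδ, fun i => ((h.2.1 l).2 i).trans hδ⟩,
    ⟨fun i j => (h.2.2.1 i j).trans hδ, fun i => (h.2.2.2 i).trans hδ⟩⟩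

end Flatten

/-! ### The log-likelihoods of the model as a Lipschitz family. -/

section Model

variable {d L W : ℕ} {f : EuclideanSpace ℝ (Fin d) → ℝ} {κ : ℝ} {l : ℝ≥0} {θ : Params d L W}

/-- The logarithm of the model density, clamped to the cube. -/
noncomputable def logModel (f : EuclideanSpace ℝ (Fin d) → ℝ) (θ : Params d L W) :
    EuclideanSpace ℝ (Fin d) → ℝ :=
  logFlowDensity (fun x t => -vectorField θ x (1 - t)) (fun x t => -fieldDeriv θ x (1 - t)) f

theorem isContDensity_model (hd : 1 ≤ d) (hL : 1 ≤ L) (hW : d + 1 ≤ W)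
    {ν : Measure (EuclideanSpace ℝ (Fin d))} (hθ : θ ∈ paramCube d L W)
    (hν : HasDensityOn ν f (cube d)) (hf : ContinuousOn f (cube d)) :
    IsContDensity (model ν θ) (flowDensity (fun x t => -vectorField θ x (1 - t))
      (fun x t => -fieldDeriv θ x (1 - t)) f) :=
  (isCubeField_vectorField hd hL hW hθ).isContDensity_map hν hf

theorem isProbabilityMeasure_model (hd : 1 ≤ d) (hL : 1 ≤ L) (hW : d + 1 ≤ W)
    (ν : Measure (EuclideanSpace ℝ (Fin d))) [IsProbabilityMeasure ν]
    (hθ : θ ∈ paramCube d L W) : IsProbabilityMeasure (model ν θ) :=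
  Measure.isProbabilityMeasure_map
    (isCubeField_vectorField hd hL hW hθ).measurable_flowMap.aemeasurable

theorem contDensity_model_pos (hd : 1 ≤ d) (hL : 1 ≤ L) (hW : d + 1 ≤ W)
    {ν : Measure (EuclideanSpace ℝ (Fin d))} [IsProbabilityMeasure ν] (hθ : θ ∈ paramCube d L W)
    (hν : HasDensityOn ν f (cube d)) (hfc : ContinuousOn f (cube d))
    (hf : ∀ x ∈ cube d, 0 < f x) {x : EuclideanSpace ℝ (Fin d)} (hx : x ∈ cube d) :
    0 < contDensity (model ν θ) x := by
  have := isProbabilityMeasure_model hd hL hW ν hθ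
  rw [contDensity_eqOn (isContDensity_model hd hL hW hθ hν hfc) hx]
  exact (isCubeField_vectorField hd hL hW hθ).reverse.flowDensity_pos hf hx

theorem log_contDensity_model (hd : 1 ≤ d) (hL : 1 ≤ L) (hW : d + 1 ≤ W)
    {ν : Measure (EuclideanSpace ℝ (Fin d))} [IsProbabilityMeasure ν] (hθ : θ ∈ paramCube d L W)
    (hν : HasDensityOn ν f (cube d)) (hfc : ContinuousOn f (cube d))
    (hf : ∀ x ∈ cube d, 0 < f x) {x : EuclideanSpace ℝ (Fin d)} (hx : x ∈ cube d) :
    Real.log (contDensity (model ν θ) x) = logModel f θ x := by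
  have := isProbabilityMeasure_model hd hL hW ν hθ
  rw [contDensity_eqOn (isContDensity_model hd hL hW hθ hν hfc) hx]
  exact (isCubeField_vectorField hd hL hW hθ).reverse.log_flowDensity hf hx

/-- The Lipschitz constant of the log-likelihood in the parameter. -/
noncomputable def likelihoodLip (d L W : ℕ) (r : ℝ) : ℝ :=
  r * (√d * lip0 d L W * Real.exp (√d * lip0 d L W)) +
    d * (lip0 d L W * (√d * lip0 d L W * Real.exp (√d * lip0 d L W) + 1))

theorem one_le_lip0 (hd : 1 ≤ d) (hL : 1 ≤ L) (hW : d + 1 ≤ W) : 1 ≤ lip0 d L W := by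
  refine le_trans ?_ (layerSize_le_lip0 hd hL hW)
  have hL0 : (1 : ℝ) ≤ L := by exact_mod_cast hL
  have hW0 : (1 : ℝ) ≤ W := by exact_mod_cast (by omega : 1 ≤ W)
  have h1 := one_le_layerSize (by omega : 1 ≤ W) L
  have h2 : (1 : ℝ) ≤ L ^ 2 := one_le_pow₀ hL0
  have h3 : (1 : ℝ) ≤ W * layerSize W L := one_le_mul_of_one_le_of_one_le hW0 h1
  nlinarith

theorem isLipschitzFamily_logModel (hd : 1 ≤ d) (hL : 1 ≤ L) (hW : d + 1 ≤ W) (hκ : 0 < κ)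
    (hl : LipschitzOnWith l f (cube d)) (hf : ∀ x ∈ cube d, κ ≤ f x) :
    IsLipschitzFamily (fun v : ParamIndex d L W → ℝ => logModel f (Params.ofEntries v))
      (likelihoodLip d L W (l / κ)) (l / κ * √d + 2 * (d * lip0 d L W))
      (l / κ * √d + 2 * (d * lip0 d L W)) := by
  have h0 := one_le_lip0 hd hL hW
  have hd0 : (0 : ℝ) < d := by exact_mod_cast hd
  have hosc : ∀ v : ParamIndex d L W → ℝ, (∀ i, |v i| ≤ 1) → ∀ y z,
      |logModel f (Params.ofEntries v) y - logModel f (Params.ofEntries v) z| ≤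
        l / κ * √d + 2 * (d * lip0 d L W) := fun v hv y z =>
    (isCubeField_vectorField hd hL hW (Params.ofEntries_mem hv)).reverse.abs_logFlowDensity_sub_le
      hκ hl hf (fun x hx t ht => by
        rw [Matrix.trace_neg, abs_neg]
        exact abs_trace_fieldDeriv_le hd hL hW (Params.ofEntries_mem hv) hx (one_sub_mem_Icc ht)) y z
  have hR : 0 < l / κ * √d + 2 * (d * lip0 d L W) := by positivity
  refine ⟨⟨by unfold likelihoodLip; positivity, hR, hR⟩, fun v hv => ?_, ?_, hosc,
    hosc 0 (by simp)⟩
  · exact ((isCubeField_vectorField hd hL hW (Params.ofEntries_mem hv)).reverse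
      |>.continuous_logFlowDensity (fun x hx => hκ.trans_le (hf x hx)) hl.continuousOn).measurable
  · intro v v' hv hv' δ hδ y
    -- The index of an output bias, which exists as d ≥ 1, shows that the bound δ is not vacuous.
    have hδ0 : 0 ≤ δ := (abs_nonneg _).trans (hδ (.inr (.inr (.inr ⟨0, hd⟩))))
    have hθ := Params.ofEntries_mem hv
    have hθ' := Params.ofEntries_mem hv'
    have hc := Params.close_ofEntries hδ
    have h := (isCubeField_vectorField hd hL hW hθ').reverse.abs_logFlowDensity_sub_field_le
      (isCubeField_vectorField hd hL hW hθ).reverse hκ hl hf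
      (η := √d * (lip0 d L W * δ))
      -- The divergence estimate takes one common bound for position and parameter; the trajectory
      -- displacement plus δ dominates both.
      (T := d * (lip0 d L W * (√d * (lip0 d L W * δ) * Real.exp (fieldLip d L W) + δ)))
      (by positivity)
      (fun t ht x hx => by
        rw [neg_sub_neg, norm_sub_rev]
        exact norm_vectorField_sub_le hd hL hW hδ0 hθ hθ' hc hx hx
          (fun i => by simpa using hδ0) (one_sub_mem_Icc ht))
      (fun t ht x hx x' hx' hxx => by
        rw [Matrix.trace_neg, Matrix.trace_neg, neg_sub_neg, abs_sub_comm]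
        have hp : 0 ≤ √d * (lip0 d L W * δ) * Real.exp (fieldLip d L W) := by positivity
        refine abs_trace_fieldDeriv_sub_le hd hL hW (by positivity) hθ hθ'
          (hc.mono (by linarith)) hx' hx (fun i => ?_) (one_sub_mem_Icc ht)
        have := EuclideanSpace.abs_apply_le_norm (x' - x) i
        rw [dist_eq_norm] at hxx
        rw [PiLp.sub_apply] at this
        linarith) y
    refine h.trans (le_of_eq ?_)
    have : ((fieldLip d L W : ℝ≥0) : ℝ) = √d * lip0 d L W := rfl
    rw [this, likelihoodLip]
    ring

end Model

end LtI

namespace LtI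

/-! ### Comparison of the constants. -/

section Constants

variable {d L W : ℕ} {r : ℝ}

/-- The estimates above produce Lip₀ only; this lets constants written with Lip₁ absorb them. -/
theorem lip0_le_lip1 : lip0 d L W ≤ lip1 d L W := by
  have h0 : 0 ≤ lip0 d L W := lip0_nonneg
  have hC : 0 ≤ constC d L W := by unfold constC; positivity
  unfold lip1
  exact le_add_of_nonneg_left (by positivity)

theorem sq_le_two_mul_exp {s : ℝ} (hs : 0 ≤ s) : s ^ 2 ≤ 2 * Real.exp s := by
  linarith [Real.quadratic_le_exp_of_nonneg hs]

theorem one_le_sqrt_numParams (hd : 1 ≤ d) : 1 ≤ √(numParams d L W) := by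
  rw [Real.one_le_sqrt]
  have : 1 ≤ numParams d L W := by unfold numParams; omega
  exact_mod_cast this

theorem one_le_sqrt_dim (hd : 1 ≤ d) : 1 ≤ √(d : ℝ) := by
  rw [Real.one_le_sqrt]
  exact_mod_cast hd

theorem four_le_factorial_mul (hd : 1 ≤ d) : (4 : ℝ) ≤ d.factorial * 2 ^ (d + 1) := by
  have h1 : (1 : ℝ) ≤ d.factorial := by exact_mod_cast d.factorial_pos
  have h2 : (4 : ℝ) ≤ 2 ^ (d + 1) := by
    calc (4 : ℝ) = 2 ^ (1 + 1) := by norm_num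
      _ ≤ 2 ^ (d + 1) := pow_le_pow_right₀ (by norm_num) (by omega)
  nlinarith

/-- The exponent `√d √q Lip₁` dominates the sizes entering the chaining bound. -/
theorem exponent_bounds (hd : 1 ≤ d) (hL : 1 ≤ L) (hW : d + 1 ≤ W) :
    √d * lip0 d L W ≤ √d * √(numParams d L W) * lip1 d L W ∧
    √(numParams d L W) * lip0 d L W ≤ √d * √(numParams d L W) * lip1 d L W ∧
    lip0 d L W ≤ √d * √(numParams d L W) * lip1 d L W := by
  have hq := one_le_sqrt_numParams (d := d) (L := L) (W := W) hd
  have hs := one_le_sqrt_dim hd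
  have h0 := one_le_lip0 hd hL hW
  have h01 := lip0_le_lip1 (d := d) (L := L) (W := W)
  have h1 : √d * lip0 d L W ≤ √d * √(numParams d L W) * lip1 d L W := by
    rw [mul_assoc]
    gcongr
    exact h01.trans (le_mul_of_one_le_left (by linarith) hq)
  refine ⟨h1, ?_, (le_mul_of_one_le_left (by linarith) hs).trans h1⟩
  rw [mul_assoc]
  exact (mul_le_mul_of_nonneg_left h01 (by positivity)).trans
    (le_mul_of_one_le_left (mul_nonneg (by positivity) (by linarith)) hs)

/-- With S = √d √q Lip₁ one has 2 d Lip₀ ≤ 2dS ≤ exp(2dS), and the other factors of that summand of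
D are at least 1. -/
theorem range_le_constD (hd : 1 ≤ d) (hL : 1 ≤ L) (hW : d + 1 ≤ W) {κ l : ℝ} :
    l / κ * √d + 2 * (d * lip0 d L W) ≤ constD d L W κ l := by
  obtain ⟨-, -, h⟩ := exponent_bounds hd hL hW
  have h0 := one_le_lip0 hd hL hW
  have h1 : 1 ≤ √(numParams d L W) ^ d := one_le_pow₀ (one_le_sqrt_numParams hd)
  have h2 : 1 ≤ lip1 d L W ^ d := one_le_pow₀ (h0.trans lip0_le_lip1)
  have h3 := four_le_factorial_mul hd
  have hE : 2 * (d * lip0 d L W) ≤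
      Real.exp (2 * d * √d * √(numParams d L W) * lip1 d L W) := by
    refine le_trans ?_ ((le_add_of_nonneg_right zero_le_one).trans (Real.add_one_le_exp _))
    calc 2 * (d * lip0 d L W) ≤ 2 * (d * (√d * √(numParams d L W) * lip1 d L W)) := by gcongr
      _ = _ := by ring
  unfold constD
  refine add_le_add le_rfl ?_
  refine hE.trans (le_mul_of_one_le_left (Real.exp_pos _).le ?_)
  exact one_le_mul_of_one_le_of_one_le (one_le_mul_of_one_le_of_one_le (by linarith) h1) h2

/-- The terms containing l/κ go into the first summand of L̄, with √d ≤ W²; the divergence terms go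
into the second, where polynomial factors are absorbed by exp(2dS). -/
theorem chaining_const_le_Lbar (hd : 1 ≤ d) (hL : 1 ≤ L) (hW : d + 1 ≤ W) {κ l : ℝ}
    (hr : 0 ≤ l / κ) :
    l / κ * √d + 2 * (d * lip0 d L W) +
        4 * √(numParams d L W) * likelihoodLip d L W (l / κ) ≤
      48 * L * (W : ℝ) ^ 2 * Lbar d L W κ l := by
  obtain ⟨hS1, hS2, hS3⟩ := exponent_bounds hd hL hW
  have h0 := one_le_lip0 hd hL hW
  have hq := one_le_sqrt_numParams (d := d) (L := L) (W := W) hd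
  have hs := one_le_sqrt_dim hd
  have hd1 : (1 : ℝ) ≤ d := by exact_mod_cast hd
  have hL1 : (1 : ℝ) ≤ L := by exact_mod_cast hL
  have hWd : (d : ℝ) ≤ W := by exact_mod_cast (by omega : d ≤ W)
  have hsW : √(d : ℝ) ≤ (W : ℝ) ^ 2 := by
    have : √(d : ℝ) ≤ d := Real.sqrt_le_iff.2 ⟨by linarith, by nlinarith⟩
    nlinarith
  set a := l / κ
  set q := √(numParams d L W : ℝ)
  set s := √(d : ℝ)
  set c := lip0 d L W
  set S := s * q * lip1 d L W with hS
  have hSpos : 0 ≤ S := by linarith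
  have hE2 : 2 * d * s * q * lip1 d L W = 2 * d * S := by rw [hS]; ring
  have hE0 : Real.exp (s * c) ≤ Real.exp S := Real.exp_le_exp.2 hS1
  have hE1 : 1 ≤ Real.exp S := Real.one_le_exp hSpos
  have hEE : Real.exp S * Real.exp S ≤ Real.exp (2 * d * S) := by
    rw [← Real.exp_add, Real.exp_le_exp]; nlinarith
  have hEl : 2 * d * S ≤ Real.exp (2 * d * S) :=
    (le_add_of_nonneg_right zero_le_one).trans (Real.add_one_le_exp _)
  set E := Real.exp S
  set F := Real.exp (2 * d * S)
  have hF : 0 < F := Real.exp_pos _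
  have hW1 : 1 ≤ (W : ℝ) ^ 2 := hs.trans hsW
  have hLW : (W : ℝ) ^ 2 ≤ L * (W : ℝ) ^ 2 := le_mul_of_one_le_left (by positivity) hL1
  have hA : a * s + 4 * q * (a * (s * c * Real.exp (s * c))) ≤
      48 * (L * (W : ℝ) ^ 2) * (2 * (a * E * c * (2 * q))) := by
    have h1 : 1 ≤ q * c * E := one_le_mul_of_one_le_of_one_le
      (one_le_mul_of_one_le_of_one_le hq h0) hE1
    have h2 : q * c * Real.exp (s * c) ≤ q * c * E := by gcongr
    have h3 : a * s * (1 + 4 * (q * c * Real.exp (s * c))) ≤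
        a * (L * (W : ℝ) ^ 2) * (192 * (q * c * E)) := by
      gcongr
      · exact hsW.trans hLW
      · linarith
    linarith
  have hB : 2 * (d * c) + 4 * q * (d * (c * (s * c * Real.exp (s * c) + 1))) ≤ 14 * (d * F) := by
    -- Both qc and sc are at most S, so S² exp S ≤ 2 exp(2S) ≤ 2F suffices.
    have h1 : (q * c) * (s * c) * Real.exp (s * c) ≤ 2 * F := by
      calc (q * c) * (s * c) * Real.exp (s * c) ≤ S * S * E := by gcongr
        _ = S ^ 2 * E := by ring
        _ ≤ 2 * E * E := by gcongr; exact sq_le_two_mul_exp hSpos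
        _ ≤ 2 * F := by linarith
    have hSF : 2 * S ≤ F := by nlinarith
    have h4 : 2 * c + 4 * ((q * c) * (s * c) * Real.exp (s * c) + q * c) ≤ 14 * F := by linarith
    nlinarith [mul_le_mul_of_nonneg_left h4 (by linarith : (0 : ℝ) ≤ d)]
  have hC : 14 * (d * F) ≤ 48 * (L * (W : ℝ) ^ 2) * (2 * ((d.factorial : ℝ) * 2 ^ (d + 1) *
      s ^ d * F * d * (2 * q) ^ (d - 1))) := by
    have h1 := four_le_factorial_mul hd
    have h2 : 1 ≤ s ^ d := one_le_pow₀ hs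
    have h3 : 1 ≤ (2 * q) ^ (d - 1) := one_le_pow₀ (by linarith)
    have h4 : 4 * (1 * (F * d) * 1) ≤ (d.factorial : ℝ) * 2 ^ (d + 1) *
      (s ^ d * (F * d) * (2 * q) ^ (d - 1)) := by gcongr
    have h5 : 1 * (4 * (1 * (F * d) * 1)) ≤ (L * (W : ℝ) ^ 2) * ((d.factorial : ℝ) * 2 ^ (d + 1) *
      (s ^ d * (F * d) * (2 * q) ^ (d - 1))) := by
      gcongr
      exact hW1.trans hLW
    have h6 : 0 ≤ F * d := by positivity
    linarith
  unfold likelihoodLip Lbar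
  rw [hE2]
  linarith

end Constants

/-! ### From the generalization error to the empirical process. -/

section Probability

variable {d L W n : ℕ} {f : EuclideanSpace ℝ (Fin d) → ℝ} {κ : ℝ} {l : ℝ≥0}
  {ν μ : Measure (EuclideanSpace ℝ (Fin d))}

theorem HasDensityOn.ae_mem {f : EuclideanSpace ℝ (Fin d) → ℝ}
    (hμ : HasDensityOn μ f (cube d)) : ∀ᵐ x ∂μ, x ∈ cube d := by
  rw [hμ.2]
  exact (withDensity_absolutelyContinuous _ _).ae_le (ae_restrict_mem measurableSet_cube)

theorem integral_sub_empRisk_eq (hd : 1 ≤ d) (hL : 1 ≤ L) (hW : d + 1 ≤ W)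
    [IsProbabilityMeasure ν] {θ : Params d L W} (hθ : θ ∈ paramCube d L W)
    (hν : HasDensityOn ν f (cube d)) (hfc : ContinuousOn f (cube d))
    (hf : ∀ x ∈ cube d, 0 < f x) (hμ : ∀ᵐ x ∂μ, x ∈ cube d)
    {x : Fin n → EuclideanSpace ℝ (Fin d)} (hx : ∀ j, x j ∈ cube d) :
    (∫ z, -Real.log (contDensity (model ν θ) z) ∂μ) - empRisk (contDensity (model ν θ)) x =
      -deviation μ (logModel f θ) x := by
  have h1 : ∫ z, -Real.log (contDensity (model ν θ) z) ∂μ = -∫ z, logModel f θ z ∂μ := by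
    rw [← integral_neg]
    refine integral_congr_ae (hμ.mono fun z hz => ?_)
    simp only [log_contDensity_model hd hL hW hθ hν hfc hf hz]
  have h2 : ∑ j, Real.log (contDensity (model ν θ) (x j)) = ∑ j, logModel f θ (x j) :=
    Finset.sum_congr rfl fun j _ => log_contDensity_model hd hL hW hθ hν hfc hf (hx j)
  rw [h1, empRisk, h2, deviation]
  ring

/-- A strict lower bound on a supremum is exceeded by some single θ, even if the supremum is not
attained. The truncated subtraction is harmless because ε and b are nonnegative. -/
theorem exists_deviation_gt_of_genError_gt (hd : 1 ≤ d) (hL : 1 ≤ L) (hW : d + 1 ≤ W)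
    [IsProbabilityMeasure ν] (hν : HasDensityOn ν f (cube d)) (hfc : ContinuousOn f (cube d))
    (hf : ∀ x ∈ cube d, 0 < f x) (hμ : ∀ᵐ x ∂μ, x ∈ cube d)
    {x : Fin n → EuclideanSpace ℝ (Fin d)} (hx : ∀ j, x j ∈ cube d) {ε b c : ℝ} (hε : 0 ≤ ε)
    (hb : 0 ≤ b) (hcb : c ≤ b)
    (h : ENNReal.ofReal ε < genError d L W ν μ x - ENNReal.ofReal b) :
    ∃ v : ParamIndex d L W → ℝ, (∀ i, |v i| ≤ 1) ∧
      c + ε < |deviation μ (logModel f (Params.ofEntries v)) x| := by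
  rw [lt_tsub_iff_right, ← ENNReal.ofReal_add hε hb, genError] at h
  obtain ⟨θ, h⟩ := lt_iSup_iff.1 h
  obtain ⟨hθ, h⟩ := lt_iSup_iff.1 h
  rw [integral_sub_empRisk_eq hd hL hW hθ hν hfc hf hμ hx, abs_neg] at h
  obtain ⟨v, hv, rfl⟩ := Params.exists_ofEntries_eq hθ
  have h' := (ENNReal.ofReal_lt_ofReal_iff_of_nonneg (by positivity)).1 h
  exact ⟨v, hv, by linarith⟩

theorem measure_genError_gt_le (hd : 1 ≤ d) (hL : 1 ≤ L) (hW : d + 1 ≤ W) (hn : 1 ≤ n)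
    [IsProbabilityMeasure ν] [IsProbabilityMeasure μ] (hκ : 0 < κ)
    (hν : HasDensityOn ν f (cube d)) (hl : LipschitzOnWith l f (cube d))
    (hf : ∀ x ∈ cube d, κ ≤ f x) (hμ : ∀ᵐ x ∂μ, x ∈ cube d)
    {Ω : Type*} [MeasurableSpace Ω] {P : Measure Ω} [IsProbabilityMeasure P]
    {X : Fin n → Ω → EuclideanSpace ℝ (Fin d)} (hXm : ∀ j, Measurable (X j))
    (hXi : iIndepFun X P) (hXd : ∀ j, P.map (X j) = μ) {ε : ℝ} (hε : 0 < ε) :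
    P {ω | ENNReal.ofReal ε < genError d L W ν μ (fun j => X j ω)
        - ENNReal.ofReal (48 * L * (W : ℝ) ^ 2 * (Lbar d L W κ l / √n))} ≤
      ENNReal.ofReal (Real.exp (-(1 / 4) * (ε ^ 2 * n / constD d L W κ l ^ 2))) := by
  have hfam := isLipschitzFamily_logModel hd hL hW hκ hl hf
  have : Nonempty (ParamIndex d L W) := ⟨.inr (.inr (.inr ⟨0, hd⟩))⟩
  have hmap : P.map (fun ω j => X j ω) = Measure.pi fun _ => μ := by
    rw [(iIndepFun_iff_map_fun_eq_pi_map fun j => (hXm j).aemeasurable).1 hXi]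
    simp_rw [hXd]
  have hmem : ∀ᵐ ω ∂P, ∀ j, X j ω ∈ cube d := by
    rw [ae_all_iff]
    intro j
    refine ae_of_ae_map (hXm j).aemeasurable ?_
    rwa [hXd j]
  have hr : (0 : ℝ) ≤ l / κ := by positivity
  have hconst := chaining_const_le_Lbar hd hL hW hr
  have hn0 : (0 : ℝ) < √n := Real.sqrt_pos.2 (by exact_mod_cast hn)
  rw [← card_paramIndex] at hconst
  have hdiv := div_le_div_of_nonneg_right hconst hn0.le
  rw [mul_div_assoc] at hdiv
  have hLip : 0 < likelihoodLip d L W (l / κ) := hfam.pos.1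
  have hR := hfam.pos.2.1
  have hpos : 0 ≤ 48 * L * (W : ℝ) ^ 2 * (Lbar d L W κ l / √n) := le_trans (by positivity) hdiv
  have hsub : ∀ᵐ ω ∂P, ω ∈ {ω | ENNReal.ofReal ε < genError d L W ν μ (fun j => X j ω)
        - ENNReal.ofReal (48 * L * (W : ℝ) ^ 2 * (Lbar d L W κ l / √n))} →
      ω ∈ (fun ω j => X j ω) ⁻¹' {x | ∃ v : ParamIndex d L W → ℝ, (∀ i, |v i| ≤ 1) ∧
        (l / κ * √d + 2 * (d * lip0 d L W) + 4 * √(Fintype.card (ParamIndex d L W)) *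
          likelihoodLip d L W (l / κ)) / √n + ε <
        |deviation μ (logModel f (Params.ofEntries v)) x|} := by
    filter_upwards [hmem] with ω hω h
    exact exists_deviation_gt_of_genError_gt hd hL hW hν hl.continuousOn
      (fun x hx => hκ.trans_le (hf x hx)) hμ hω hε.le hpos hdiv h
  -- The event about all parameters is not known to be measurable; `Measure.le_map_apply` gives the
  -- needed inequality for arbitrary sets.
  refine (measure_mono_ae hsub).trans
    ((Measure.le_map_apply (measurable_pi_lambda _ hXm).aemeasurable _).trans ?_)
  rw [hmap]
  refine (measure_exists_deviation_gt_le hn hfam hε).trans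
    (ENNReal.ofReal_le_ofReal (Real.exp_le_exp.2 ?_))
  have h1 : ε ^ 2 * n / constD d L W κ l ^ 2 ≤
      ε ^ 2 * n / (l / κ * √d + 2 * (d * lip0 d L W)) ^ 2 := by
    have hD := range_le_constD hd hL hW (κ := κ) (l := l)
    gcongr
  -- The rate available is 1/2; nonnegativity allows it to be weakened to 1/4.
  have h2 : 0 ≤ ε ^ 2 * n / constD d L W κ l ^ 2 := by positivity
  linarith

end Probability

end LtI

/-! ### The theorem. -/

theorem mainTheorem4
    (d k L W n : ℕ) (hd : 1 ≤ d) (hk : 3 ≤ k) (hL : 1 ≤ L) (hW : d + 1 ≤ W) (hn : 1 ≤ n)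
    (κ K : ℝ) (hκ : 0 < κ) (hκK : κ ≤ K) (Lν : ℝ≥0)
    (ν μ : Measure (EuclideanSpace ℝ (Fin d)))
    [IsProbabilityMeasure ν] [IsProbabilityMeasure μ]
    (fν fμ : EuclideanSpace ℝ (Fin d) → ℝ) (g : Fin d → ℝ → ℝ)
    (hν : LtI.HasDensityOn ν fν (LtI.cube d))
    (hfac : ∀ x ∈ LtI.cube d, fν x = ∏ i, g i (x i))
    (hgC : ∀ i, ContDiffOn ℝ k (g i) (Icc 0 1))
    (hg : ∀ i, LtI.HasDensityOn (ν.map (fun x => x i)) (g i) (Icc 0 1))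
    (hLip : LipschitzOnWith Lν fν (LtI.cube d))
    (hμ : LtI.HasDensityOn μ fμ (LtI.cube d))
    (hμC : ContDiffOn ℝ k fμ (LtI.cube d))
    (hνb : ∀ x ∈ LtI.cube d, κ ≤ fν x ∧ fν x ≤ K)
    (hμb : ∀ x ∈ LtI.cube d, κ ≤ fμ x ∧ fμ x ≤ K)
    {Ω : Type*} [MeasurableSpace Ω] (P : Measure Ω) [IsProbabilityMeasure P]
    (X : Fin n → Ω → EuclideanSpace ℝ (Fin d))
    (hXm : ∀ j, Measurable (X j)) (hXi : iIndepFun X P) (hXd : ∀ j, P.map (X j) = μ) :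
    (∀ θ ∈ LtI.paramCube d L W,
      (∀ x ∈ LtI.cube d, ∃ y, LtI.IsTrajectory (LtI.vectorField θ) x y ∧
        ∀ z, LtI.IsTrajectory (LtI.vectorField θ) x z → EqOn z y (Icc 0 1)) ∧
      LtI.IsContDensity (LtI.model ν θ) (LtI.contDensity (LtI.model ν θ)) ∧
      ∀ x ∈ LtI.cube d, 0 < LtI.contDensity (LtI.model ν θ) x) ∧
    ∀ ε : ℝ, 0 < ε →
      P {ω | ENNReal.ofReal ε <
          LtI.genError d L W ν μ (fun j => X j ω)
            - ENNReal.ofReal (48 * L * (W : ℝ) ^ 2 * (LtI.Lbar d L W κ Lν / √n))}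
        ≤ ENNReal.ofReal
            (Real.exp (-(1 / 4) * (ε ^ 2 * n / LtI.constD d L W κ Lν ^ 2))) := by
  have hf : ∀ x ∈ LtI.cube d, κ ≤ fν x := fun x hx => (hνb x hx).1
  refine ⟨fun θ hθ => ⟨fun x hx => ?_, ?_, fun x hx => ?_⟩, fun ε hε => ?_⟩
  · have hw := LtI.isCubeField_vectorField hd hL hW hθ
    obtain ⟨y, hy⟩ := hw.exists_isTrajectory hx
    exact ⟨y, hy, fun z hz => hw.eqOn hz hy⟩
  · exact LtI.isContDensity_contDensity
      (LtI.isContDensity_model hd hL hW hθ hν hLip.continuousOn)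
  · exact LtI.contDensity_model_pos hd hL hW hθ hν hLip.continuousOn
      (fun x hx => hκ.trans_le (hf x hx)) hx
  · exact LtI.measure_genError_gt_le hd hL hW hn hκ hν hLip hf hμ.ae_mem hXm hXi hXd hε
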